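/- Notation. Let $M=(M_k)_{k\ge 0}$ be a sequence of positive real numbers. For $U\subseteq\mathbb R^n$ open, $V\subseteq \mathbb R^m$ open ($n,m\ge 1$), $f\in C^\infty(U,\mathbb R^m)$, $K\subseteq U$ compact and $\rho>0$ put $$\|f\|^M_{K,\rho}:=\sup\Big\{\frac{\|f^{(k)}(x)\|}{k!\,\rho^k M_k}: x\in K,\ k\ge 0\Big\},$$ where $f^{(k)}(x)$ is the $k$-th Fréchet derivative with its operator norm as a $k$-linear map. The Beurling class $\mathcal E^{(M)}(U,V)$ (resp. the Roumieu class $\mathcal E^{\{M\}}(U,V)$) consists of all $C^\infty$ maps $f:U\to V$ such that for every compact $K\subseteq U$ one has $\|f\|^M_{K,\rho}<\infty$ for all $\rho>0$ (resp. for some $\rho>0$). The symbol $\mathcal E^{[M]}$ stands for one of $\mathcal E^{(M)}$, $\mathcal E^{\{M\}}$, the same one throughout; $\mathcal E^{[M]}(U):=\mathcal E^{[M]}(U,\mathbb R)$, and $\mathcal E^{[M]}(U,\mathbb C)$ is defined by $\mathbb C=\mathbb R^2$. In the following, $U,V,W$ range over all open subsets of $\mathbb R^p,\mathbb R^q,\mathbb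 R^r$ for all $p,q,r\ge 1$. The class $\mathcal E^{[M]}$ is *stable under derivation* if $f\in\mathcal E^{[M]}(U)$ implies $\partial_i f\in\mathcal E^{[M]}(U)$ for all $i$; *stable under composition* if $g\in\mathcal E^{[M]}(U,V)$ and $f\in\mathcal E^{[M]}(V,W)$ imply $f\circ g\in\mathcal E^{[M]}(U,W)$; *holomorphically closed* if $f\circ g\in\mathcal E^{[M]}(U,\mathbb C)$ for all $g\in\mathcal E^{[M]}(U)$ and all $f$ holomorphic in an open neighborhood in $\mathbb C$ of the range of $g$; *inverse closed* if $1/f\in\mathcal E^{[M]}(U)$ for every non-vanishing $f\in\mathcal E^{[M]}(U)$. Put $$T_M(t):=\sup_{k\ge0}\frac{t^k}{k!M_k},\quad M^{b(c)}_k:=\frac1{k!}\sup_{t>0}\frac{t^k}{T_M(t)},\qquad S_M(t):=\max_{0\le k\le t}\frac{t^k}{k!M_k},\quad M^{b(o)}_k:=\frac1{k!}\sup_{t\ge k}\frac{t^k}{S_M(t)}$$ (under the assumptions below, $(k!M_k)^{1/k}\to\infty$, so these are finite positive numbers). For a sequence $N$ of positive numbers, $(N_k^{1/k})_{k\ge1}$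 is *almost increasing* if there is $C>0$ with $N_j^{1/j}\le C N_k^{1/k}$ for all $1\le j\le k$; $N$ has the *(FdB)-property* if there is $C>0$ with $N_jN_{\alpha_1}\cdots N_{\alpha_j}\le C^kN_k$ for all positive integers $\alpha_1,\dots,\alpha_j$ with $\alpha_1+\cdots+\alpha_j=k$. **Theorem.** Let $M=(M_k)_{k\ge0}$ be a sequence of positive real numbers and assume that $\mathcal E^{[M]}$ is stable under derivation. Consider the conditions: 1. $\mathcal E^{[M]}$ is stable under composition. 2. $\mathcal E^{[M]}$ is holomorphically closed. 3. $\mathcal E^{[M]}$ is inverse closed. 4. $\big((M_k^{b(c)})^{1/k}\big)_{k\ge1}$ is almost increasing. 5. $\big((M_k^{b(o)})^{1/k}\big)_{k\ge1}$ is almost increasing. 6. $M^{b(c)}$ has the (FdB)-property. 7. $M^{b(o)}$ has the (FdB)-property. If $\liminf_{k\to\infty}M_k^{1/k}>0$ (the value $+\infty$ being allowed), then all seven conditions are equivalent in the Roumieu case $\mathcal E^{[M]}=\mathcal E^{\{M\}}$. If $\lim_{k\to\infty}M_k^{1/k}=\infty$, then all seven conditions are equivalent both in the Beurling case and in the Roumieu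 case. -/

import Mathlib

namespace UltraDiff

noncomputable section

/-- The type of a Denjoy–Carleman class: Beurling or Roumieu. -/
inductive Kind
  | beurling
  | roumieu

/-- The seminorm `‖f‖_{K,ρ}^M = sup {‖f^(k)(x)‖ / (k! ρ^k M_k) : x ∈ K, k ∈ ℕ}` is finite. Here
`f^(k)(x)` is the `k`-th Fréchet derivative, with the operator norm on `k`-linear maps. -/
def FiniteSeminorm {E F : Type*} [NormedAddCommGroup E] [NormedSpace ℝ E]
    [NormedAddCommGroup F] [NormedSpace ℝ F]
    (M : ℕ → ℝ) (K : Set E) (ρ : ℝ) (f : E → F) : Prop :=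
  ∃ C : ℝ, ∀ x ∈ K, ∀ k : ℕ, ‖iteratedFDeriv ℝ k f x‖ / ((k.factorial : ℝ) * ρ ^ k * M k) ≤ C

/-- The growth condition on a compact set `K`: the seminorms are finite for every `ρ > 0`
(Beurling), respectively for some `ρ > 0` (Roumieu). -/
def GrowthOn {E F : Type*} [NormedAddCommGroup E] [NormedSpace ℝ E]
    [NormedAddCommGroup F] [NormedSpace ℝ F]
    (κ : Kind) (M : ℕ → ℝ) (K : Set E) (f : E → F) : Prop :=
  match κ with
  | .beurling => ∀ ρ : ℝ, 0 < ρ → FiniteSeminorm M K ρ f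
  | .roumieu => ∃ ρ : ℝ, 0 < ρ ∧ FiniteSeminorm M K ρ f

/-- The class `ℰ^[M](U, V)` of `[M]`-ultradifferentiable mappings from the open set `U` to `V`.
Mappings on `U` are represented by total functions; as `U` is open, membership depends only on
the restriction to `U`. -/
def ultraClass {E F : Type*} [NormedAddCommGroup E] [NormedSpace ℝ E]
    [NormedAddCommGroup F] [NormedSpace ℝ F]
    (κ : Kind) (M : ℕ → ℝ) (U : Set E) (V : Set F) : Set (E → F) :=
  {f | Set.MapsTo f U V ∧ ContDiffOn ℝ ((⊤ : ℕ∞) : WithTop ℕ∞) f U ∧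
    ∀ K : Set E, K ⊆ U → IsCompact K → GrowthOn κ M K f}

/-- `ℰ^[M]` is stable under derivation: the partial derivatives of real functions in `ℰ^[M](U)`
lie in `ℰ^[M](U)`. -/
def StableUnderDerivation (κ : Kind) (M : ℕ → ℝ) : Prop :=
  ∀ n : ℕ, 0 < n → ∀ U : Set (EuclideanSpace ℝ (Fin n)), IsOpen U →
    ∀ f : EuclideanSpace ℝ (Fin n) → ℝ, f ∈ ultraClass κ M U Set.univ →
      ∀ i : Fin n,
        (fun x => fderiv ℝ f x (EuclideanSpace.single i (1 : ℝ))) ∈ ultraClass κ M U Set.univ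

/-- `ℰ^[M]` is stable under composition. -/
def StableUnderComposition (κ : Kind) (M : ℕ → ℝ) : Prop :=
  ∀ p q r : ℕ, 0 < p → 0 < q → 0 < r →
    ∀ (U : Set (EuclideanSpace ℝ (Fin p))) (V : Set (EuclideanSpace ℝ (Fin q)))
      (W : Set (EuclideanSpace ℝ (Fin r))), IsOpen U → IsOpen V → IsOpen W →
    ∀ (g : EuclideanSpace ℝ (Fin p) → EuclideanSpace ℝ (Fin q))
      (f : EuclideanSpace ℝ (Fin q) → EuclideanSpace ℝ (Fin r)),
      g ∈ ultraClass κ M U V → f ∈ ultraClass κ M V W → f ∘ g ∈ ultraClass κ M U W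

/-- `ℰ^[M]` is holomorphically closed: `f ∘ g ∈ ℰ^[M](U, ℂ)` for every real `g ∈ ℰ^[M](U)` and
every `f` holomorphic in a complex neighborhood `Ω` of the range of `g`. -/
def HolomorphicallyClosed (κ : Kind) (M : ℕ → ℝ) : Prop :=
  ∀ n : ℕ, 0 < n → ∀ U : Set (EuclideanSpace ℝ (Fin n)), IsOpen U →
    ∀ g : EuclideanSpace ℝ (Fin n) → ℝ, g ∈ ultraClass κ M U Set.univ →
      ∀ (Ω : Set ℂ) (f : ℂ → ℂ), IsOpen Ω → (∀ x ∈ U, (g x : ℂ) ∈ Ω) → DifferentiableOn ℂ f Ω →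
        (fun x => f (g x : ℂ)) ∈ ultraClass κ M U Set.univ

/-- `ℰ^[M]` is inverse closed: `1 / f ∈ ℰ^[M](U)` for every non-vanishing `f ∈ ℰ^[M](U)`. -/
def InverseClosed (κ : Kind) (M : ℕ → ℝ) : Prop :=
  ∀ n : ℕ, 0 < n → ∀ U : Set (EuclideanSpace ℝ (Fin n)), IsOpen U →
    ∀ f : EuclideanSpace ℝ (Fin n) → ℝ, f ∈ ultraClass κ M U Set.univ → (∀ x ∈ U, f x ≠ 0) →
      (fun x => 1 / f x) ∈ ultraClass κ M U Set.univ

/-- `T_M(t) = sup_k t^k / (k! M_k)`; the supremum is finite if `(k! M_k)^(1/k) → ∞`. -/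
def assocT (M : ℕ → ℝ) (t : ℝ) : ℝ :=
  ⨆ k : ℕ, t ^ k / ((k.factorial : ℝ) * M k)

/-- `M^{b(c)}_k = (1 / k!) sup_{t > 0} t^k / T_M(t)`. -/
def regC (M : ℕ → ℝ) (k : ℕ) : ℝ :=
  1 / (k.factorial : ℝ) * ⨆ t : Set.Ioi (0 : ℝ), (t : ℝ) ^ k / assocT M t

/-- `S_M(t) = max_{k ≤ t} t^k / (k! M_k)`, for `t ≥ 0`. -/
def assocS (M : ℕ → ℝ) (t : ℝ) : ℝ :=
  (Finset.Iic ⌊t⌋₊).sup' Finset.nonempty_Iic (fun k => t ^ k / ((k.factorial : ℝ) * M k))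

/-- `M^{b(o)}_k = (1 / k!) sup_{t ≥ k} t^k / S_M(t)`. -/
def regO (M : ℕ → ℝ) (k : ℕ) : ℝ :=
  1 / (k.factorial : ℝ) * ⨆ t : Set.Ici (k : ℝ), (t : ℝ) ^ k / assocS M t

/-- The sequence `(N_k^(1/k))_{k ≥ 1}` is almost increasing. -/
def RootAlmostIncreasing (N : ℕ → ℝ) : Prop :=
  ∃ C : ℝ, 0 < C ∧ ∀ j k : ℕ, 1 ≤ j → j ≤ k →
    N j ^ (1 / (j : ℝ)) ≤ C * N k ^ (1 / (k : ℝ))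

/-- The (FdB)-property: for some `C > 0`, `N_j N_{α_1} ⋯ N_{α_j} ≤ C^k N_k` for all positive
integers `α_1, …, α_j` with sum `k`. -/
def FdBProperty (N : ℕ → ℝ) : Prop :=
  ∃ C : ℝ, 0 < C ∧ ∀ (j k : ℕ) (α : Fin j → ℕ), (∀ i, 0 < α i) → ∑ i, α i = k →
    N j * ∏ i, N (α i) ≤ C ^ k * N k

/-- The seven conditions (stability under composition, holomorphic closedness, inverse closedness,
almost increasing roots of both regularizations, (FdB)-property of both regularizations)
are equivalent. -/
def ConditionsEquivalent (κ : Kind) (M : ℕ → ℝ) : Prop :=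
  [StableUnderComposition κ M,
    HolomorphicallyClosed κ M,
    InverseClosed κ M,
    RootAlmostIncreasing (regC M),
    RootAlmostIncreasing (regO M),
    FdBProperty (regC M),
    FdBProperty (regO M)].TFAE

end

end UltraDiff

namespace UltraDiff

/-! Everything passes through `regC M`: the number k! `regC M k` is the supremum of s tᵏ over all
geometric minorants s tⁱ ≤ i! Mᵢ, so that k! `regC M k` is the logarithmically convex minorant of k!
Mₖ. Two facts make it the right sequence.

First, M and `regC M` define the same class (`growthOn_regC`). This is a Cartan–Gorny interpolation:
if the derivatives of f are bounded near a point by a sequence B, then the k-th derivative at the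
point is bounded, up to a factor geometric in k, by a geometric minorant of B. In one variable one
Taylor expands between indices j ≤ k < n that maximize tⁱ/Bᵢ at scales t and 2t, and bounds the
coefficients of the Taylor polynomial by a Bernstein–Walsh inequality; polarization gives the case
of several variables. Faà di Bruno's formula and the (FdB)-property of `regC M` then yield stability
under composition and holomorphic closedness, and each of these applied to the reciprocal yields
inverse closedness.

Second, the class contains cosine series g whose even derivatives at 0 are nearly as large as k!
`regC M k` (`exists_cosSeries`). The derivatives at 0 of 1/(const − g) satisfy a recursion whose
terms all have the same sign, so they dominate j-th powers of the coefficients of g. If 1/(const −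
g) is in the class, this forces the roots of `regC M` to be almost increasing. Stability under
derivation, tested on g, bounds `regC M (k + 1)` by `regC M k` up to a geometric factor, and this
turns almost increasing roots into the (FdB)-property. The converse is the (FdB)-property with equal
blocks.

The cosine series are large only up to factors θₖᵏ with θ → ∞ arbitrary;
`le_const_of_forall_le_mul_of_tendsto` removes these. The sequence `regO M` agrees with `regC M` up
to geometric factors, so it satisfies the same conditions. -/

/-! ### Geometric minorants and the regularization `regC` -/

/-- The geometric sequence `s tⁱ` is a minorant of `i! Mᵢ`. -/
structure IsGeomMinorant (M : ℕ → ℝ) (s t : ℝ) : Prop where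
  pos_left : 0 < s
  pos_right : 0 < t
  le : ∀ i : ℕ, s * t ^ i ≤ (i.factorial : ℝ) * M i

/-- `M` is bounded below by the geometric sequence `c aᵏ`. -/
structure GeomBelow (M : ℕ → ℝ) (c a : ℝ) : Prop where
  pos_left : 0 < c
  pos_right : 0 < a
  le : ∀ k : ℕ, c * a ^ k ≤ M k

theorem GeomBelow.pos {M : ℕ → ℝ} {c a : ℝ} (h : GeomBelow M c a) (k : ℕ) : 0 < M k :=
  lt_of_lt_of_le (mul_pos h.pos_left (pow_pos h.pos_right k)) (h.le k)

theorem GeomBelow.factorial_mul_pos {M : ℕ → ℝ} {c a : ℝ} (h : GeomBelow M c a) (k : ℕ) :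
    0 < (k.factorial : ℝ) * M k :=
  mul_pos (by exact_mod_cast k.factorial_pos) (h.pos k)

theorem factorial_le_pow_self (k : ℕ) : (k.factorial : ℝ) ≤ (k : ℝ) ^ k := by
  exact_mod_cast Nat.factorial_le_pow k

theorem pow_self_le_three_pow_mul_factorial (k : ℕ) :
    (k : ℝ) ^ k ≤ 3 ^ k * (k.factorial : ℝ) := by
  have h := Real.pow_div_factorial_le_exp (k : ℝ) (Nat.cast_nonneg k) k
  have hk : (0 : ℝ) < k.factorial := by exact_mod_cast k.factorial_pos
  rw [div_le_iff₀ hk] at h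
  refine h.trans (mul_le_mul_of_nonneg_right ?_ hk.le)
  rw [← Real.exp_one_pow]
  exact pow_le_pow_left₀ (Real.exp_pos 1).le (Real.exp_one_lt_d9.le.trans (by norm_num)) k

theorem GeomBelow.term_le {M : ℕ → ℝ} {c a : ℝ} (h : GeomBelow M c a) {t : ℝ} (ht : 0 ≤ t) (k : ℕ) :
    t ^ k / ((k.factorial : ℝ) * M k) ≤ (t / a) ^ k / k.factorial / c := by
  have hk : (0 : ℝ) < k.factorial := by exact_mod_cast k.factorial_pos
  have h1 : (t / a) ^ k / k.factorial / c = t ^ k / ((k.factorial : ℝ) * (c * a ^ k)) := by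
    have := h.pos_left.ne'
    have := h.pos_right.ne'
    rw [div_pow]; field_simp
  rw [h1]
  exact div_le_div_of_nonneg_left (pow_nonneg ht k)
    (mul_pos hk (mul_pos h.pos_left (pow_pos h.pos_right k)))
    (mul_le_mul_of_nonneg_left (h.le k) hk.le)

theorem GeomBelow.term_le_exp {M : ℕ → ℝ} {c a : ℝ} (h : GeomBelow M c a) {t : ℝ} (ht : 0 ≤ t)
    (k : ℕ) : t ^ k / ((k.factorial : ℝ) * M k) ≤ Real.exp (t / a) / c := by
  refine (h.term_le ht k).trans (div_le_div_of_nonneg_right ?_ h.pos_left.le)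
  exact Real.pow_div_factorial_le_exp _ (div_nonneg ht h.pos_right.le) k

theorem GeomBelow.bddAbove_assocT {M : ℕ → ℝ} {c a : ℝ} (h : GeomBelow M c a) {t : ℝ}
    (ht : 0 ≤ t) : BddAbove (Set.range fun k : ℕ => t ^ k / ((k.factorial : ℝ) * M k)) :=
  ⟨Real.exp (t / a) / c, by rintro _ ⟨k, rfl⟩; exact h.term_le_exp ht k⟩

theorem GeomBelow.term_le_assocT {M : ℕ → ℝ} {c a : ℝ} (h : GeomBelow M c a) {t : ℝ}
    (ht : 0 ≤ t) (k : ℕ) : t ^ k / ((k.factorial : ℝ) * M k) ≤ assocT M t :=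
  le_ciSup (h.bddAbove_assocT ht) k

theorem GeomBelow.assocT_pos {M : ℕ → ℝ} {c a : ℝ} (h : GeomBelow M c a) {t : ℝ}
    (ht : 0 ≤ t) : 0 < assocT M t := by
  refine lt_of_lt_of_le ?_ (h.term_le_assocT ht 0)
  have := h.pos 0
  simp [this]

theorem GeomBelow.pow_le_mul_assocT {M : ℕ → ℝ} {c a : ℝ} (h : GeomBelow M c a) {t : ℝ}
    (ht : 0 ≤ t) (k : ℕ) : t ^ k ≤ (k.factorial : ℝ) * M k * assocT M t := by
  have := h.term_le_assocT ht k
  rwa [div_le_iff₀' (h.factorial_mul_pos k)] at this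

theorem factorial_mul_regC (M : ℕ → ℝ) (k : ℕ) :
    (k.factorial : ℝ) * regC M k = ⨆ t : Set.Ioi (0 : ℝ), (t : ℝ) ^ k / assocT M t := by
  have hk : (k.factorial : ℝ) ≠ 0 := by exact_mod_cast k.factorial_ne_zero
  rw [regC]; field_simp

theorem GeomBelow.bddAbove_regC {M : ℕ → ℝ} {c a : ℝ} (h : GeomBelow M c a) (k : ℕ) :
    BddAbove (Set.range fun t : Set.Ioi (0 : ℝ) => (t : ℝ) ^ k / assocT M t) := by
  refine ⟨(k.factorial : ℝ) * M k, ?_⟩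
  rintro _ ⟨⟨t, ht⟩, rfl⟩
  have ht' : (0 : ℝ) < t := ht
  exact (div_le_iff₀ (h.assocT_pos ht'.le)).2 (h.pow_le_mul_assocT ht'.le k)

/-- The minorant condition says that `assocT M t ≤ 1 / s`, so the competitor t in the supremum
defining `regC` already gives the bound. -/
theorem IsGeomMinorant.le_regC {M : ℕ → ℝ} {c a s t : ℝ} (hl : IsGeomMinorant M s t)
    (h : GeomBelow M c a) (k : ℕ) : s * t ^ k ≤ (k.factorial : ℝ) * regC M k := by
  rw [factorial_mul_regC]
  refine le_trans ?_ (le_ciSup (h.bddAbove_regC k) ⟨t, hl.pos_right⟩)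
  have h1 : assocT M t ≤ 1 / s := by
    refine ciSup_le fun i => ?_
    rw [div_le_div_iff₀ (h.factorial_mul_pos i) hl.pos_left]
    have := hl.le i
    linarith
  have h2 := h.assocT_pos hl.pos_right.le
  show s * t ^ k ≤ t ^ k / assocT M t
  rw [le_div_iff₀ h2]
  have h3 : s * assocT M t ≤ 1 := by
    rw [le_div_iff₀ hl.pos_left] at h1; linarith
  calc s * t ^ k * assocT M t = (s * assocT M t) * t ^ k := by ring
    _ ≤ 1 * t ^ k := mul_le_mul_of_nonneg_right h3 (pow_nonneg hl.pos_right.le k)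
    _ = t ^ k := one_mul _

theorem GeomBelow.isGeomMinorant_assocT {M : ℕ → ℝ} {c a : ℝ} (h : GeomBelow M c a) {t : ℝ}
    (ht : 0 < t) : IsGeomMinorant M (1 / assocT M t) t where
  pos_left := one_div_pos.2 (h.assocT_pos ht.le)
  pos_right := ht
  le i := by
    rw [one_div_mul_eq_div, div_le_iff₀ (h.assocT_pos ht.le)]
    exact h.pow_le_mul_assocT ht.le i

theorem GeomBelow.regC_le {M : ℕ → ℝ} {c a : ℝ} (h : GeomBelow M c a) (k : ℕ) :
    regC M k ≤ M k := by
  have hk : (0 : ℝ) < k.factorial := by exact_mod_cast k.factorial_pos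
  refine le_of_mul_le_mul_left ?_ hk
  rw [factorial_mul_regC]
  have : Nonempty (Set.Ioi (0 : ℝ)) := ⟨⟨1, Set.mem_Ioi.2 one_pos⟩⟩
  refine ciSup_le ?_
  rintro ⟨t, ht⟩
  have ht' : (0 : ℝ) < t := ht
  exact (div_le_iff₀ (h.assocT_pos ht'.le)).2 (h.pow_le_mul_assocT ht'.le k)

theorem GeomBelow.regC_pos {M : ℕ → ℝ} {c a : ℝ} (h : GeomBelow M c a) (k : ℕ) :
    0 < regC M k := by
  have hk : (0 : ℝ) < k.factorial := by exact_mod_cast k.factorial_pos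
  have hl := h.isGeomMinorant_assocT one_pos
  have := lt_of_lt_of_le (mul_pos hl.pos_left (pow_pos hl.pos_right k)) (hl.le_regC h k)
  exact (mul_pos_iff_of_pos_left hk).1 this

/-- An almost optimal minorant replaces an extremal one, so attainment of the supremum never has to
be discussed. The factor 2 is harmless because all later estimates hold up to geometric factors. -/
theorem GeomBelow.exists_isGeomMinorant {M : ℕ → ℝ} {c a : ℝ} (h : GeomBelow M c a) (k : ℕ) :
    ∃ s t, IsGeomMinorant M s t ∧ (k.factorial : ℝ) * regC M k ≤ 2 * (s * t ^ k) := by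
  have hk : (0 : ℝ) < k.factorial := by exact_mod_cast k.factorial_pos
  have : Nonempty (Set.Ioi (0 : ℝ)) := ⟨⟨1, Set.mem_Ioi.2 one_pos⟩⟩
  have hpos : 0 < (k.factorial : ℝ) * regC M k := mul_pos hk (h.regC_pos k)
  have hlt : (k.factorial : ℝ) * regC M k / 2 <
      ⨆ t : Set.Ioi (0 : ℝ), (t : ℝ) ^ k / assocT M t := by
    rw [← factorial_mul_regC]; linarith
  obtain ⟨⟨t, ht⟩, hlt⟩ := exists_lt_of_lt_ciSup hlt
  refine ⟨1 / assocT M t, t, h.isGeomMinorant_assocT ht, ?_⟩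
  have : (1 / assocT M t) * t ^ k = t ^ k / assocT M t := by ring
  rw [this]
  simp only at hlt
  linarith

theorem GeomBelow.isGeomMinorant {M : ℕ → ℝ} {c a : ℝ} (h : GeomBelow M c a) {x : ℝ}
    (hx : 0 < x) : IsGeomMinorant M (c * Real.exp (-x)) (a * x) where
  pos_left := mul_pos h.pos_left (Real.exp_pos _)
  pos_right := mul_pos h.pos_right hx
  le i := by
    have hi : (0 : ℝ) < i.factorial := by exact_mod_cast i.factorial_pos
    have h1 := Real.pow_div_factorial_le_exp _ hx.le i
    rw [div_le_iff₀ hi] at h1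
    calc c * Real.exp (-x) * (a * x) ^ i = (c * a ^ i) * (Real.exp (-x) * x ^ i) := by
          rw [mul_pow]; ring
      _ ≤ (c * a ^ i) * (Real.exp (-x) * (Real.exp x * i.factorial)) := by
          refine mul_le_mul_of_nonneg_left ?_
            (mul_pos h.pos_left (pow_pos h.pos_right i)).le
          exact mul_le_mul_of_nonneg_left h1 (Real.exp_pos _).le
      _ = (c * a ^ i) * i.factorial := by
          rw [← mul_assoc (Real.exp (-x)), ← Real.exp_add]; simp
      _ ≤ (i.factorial : ℝ) * M i := by
          rw [mul_comm]
          exact mul_le_mul_of_nonneg_left (h.le i) hi.le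

theorem exp_nat_le_three_pow (n : ℕ) : Real.exp n ≤ 3 ^ n := by
  rw [← Real.exp_one_pow]
  exact pow_le_pow_left₀ (Real.exp_pos 1).le (Real.exp_one_lt_d9.le.trans (by norm_num)) n

theorem GeomBelow.geomBelow_regC {M : ℕ → ℝ} {c a : ℝ} (h : GeomBelow M c a) :
    GeomBelow (regC M) (c / 3) (a / 3) where
  pos_left := div_pos h.pos_left (by norm_num)
  pos_right := div_pos h.pos_right (by norm_num)
  le k := by
    have hk : (0 : ℝ) < k.factorial := by exact_mod_cast k.factorial_pos
    -- The minorant with parameter x = k + 1 is used; x = k would fail to be positive at k = 0.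
    have hx : (0 : ℝ) < ((k + 1 : ℕ) : ℝ) := by positivity
    have h1 := (h.isGeomMinorant hx).le_regC h k
    refine le_of_mul_le_mul_left (le_trans ?_ h1) hk
    have h2 : (1 / 3 : ℝ) ^ (k + 1) ≤ Real.exp (-((k + 1 : ℕ) : ℝ)) := by
      rw [Real.exp_neg, one_div, inv_pow]
      exact inv_anti₀ (Real.exp_pos _) (exp_nat_le_three_pow _)
    have h3 : (k.factorial : ℝ) ≤ ((k + 1 : ℕ) : ℝ) ^ k :=
      (factorial_le_pow_self k).trans
        (pow_le_pow_left₀ (Nat.cast_nonneg k) (by push_cast; linarith) k)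
    have hc := h.pos_left
    have ha := h.pos_right
    calc (k.factorial : ℝ) * (c / 3 * (a / 3) ^ k)
        = c * (1 / 3) ^ (k + 1) * (a ^ k * k.factorial) := by rw [div_pow, one_div, inv_pow, pow_succ]; field_simp
      _ ≤ c * Real.exp (-((k + 1 : ℕ) : ℝ)) * (a ^ k * ((k + 1 : ℕ) : ℝ) ^ k) := by gcongr
      _ = c * Real.exp (-((k + 1 : ℕ) : ℝ)) * (a * ((k + 1 : ℕ) : ℝ)) ^ k := by rw [mul_pow]

/-- Log-convexity up to a constant: a minorant almost optimal at k + 1 bounds both neighbours from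
below, and a geometric sequence satisfies the relation with equality. The 4 is the square of the 2
lost in `exists_isGeomMinorant`. -/
theorem GeomBelow.regC_sq_le {M : ℕ → ℝ} {c a : ℝ} (h : GeomBelow M c a) (k : ℕ) :
    (((k + 1).factorial : ℝ) * regC M (k + 1)) ^ 2 ≤
      4 * (k.factorial * regC M k) *
        ((k + 2).factorial * regC M (k + 2)) := by
  obtain ⟨s, t, hl, hj⟩ := h.exists_isGeomMinorant (k + 1)
  have e1 := hl.le_regC h k
  have e2 := hl.le_regC h (k + 2)
  have hs := hl.pos_left
  have ht := hl.pos_right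
  have hp := (h.regC_pos (k + 1)).le
  have hp0 := (h.regC_pos k).le
  calc _ ≤ (2 * (s * t ^ (k + 1))) ^ 2 := by gcongr
    _ = 4 * (s * t ^ k) * (s * t ^ (k + 2)) := by ring
    _ ≤ _ := by gcongr

/-- The roots of `k! regC M k` are increasing up to a constant. -/
theorem GeomBelow.regC_pow_le {M : ℕ → ℝ} {c a : ℝ} (h : GeomBelow M c a) {m k : ℕ}
    (hmk : m ≤ k) : ((m.factorial : ℝ) * regC M m) ^ k ≤
      (2 * max 1 (regC M 0)) ^ k * ((k.factorial : ℝ) * regC M k) ^ m := by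
  obtain ⟨s, t, hl, hj⟩ := h.exists_isGeomMinorant m
  have e1 := hl.le_regC h 0
  have e2 := hl.le_regC h k
  have hs := hl.pos_left
  have ht := hl.pos_right
  have hp := (h.regC_pos m).le
  simp only [pow_zero, mul_one, Nat.factorial_zero, Nat.cast_one, one_mul] at e1
  set D := max 1 (regC M 0)
  have hD : 1 ≤ D := le_max_left _ _
  have hsD : s ≤ D := e1.trans (le_max_right _ _)
  obtain ⟨l, rfl⟩ := Nat.exists_eq_add_of_le hmk
  -- Only the surplus power sˡ has to be paid for, and s ≤ `regC M 0` absorbs it.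
  calc _ ≤ (2 * (s * t ^ m)) ^ (m + l) := by gcongr
    _ = 2 ^ (m + l) * s ^ l * (s * t ^ (m + l)) ^ m := by
        simp only [mul_pow, ← pow_mul, pow_add]
        ring
    _ ≤ 2 ^ (m + l) * D ^ (m + l) *
        (((m + l).factorial : ℝ) * regC M (m + l)) ^ m := by
        gcongr
        exact (pow_le_pow_left₀ hs.le hsD l).trans (pow_le_pow_right₀ hD (by omega))
    _ = _ := by rw [mul_pow 2 D]

/-! ### Roots and sequences that agree up to geometric factors -/

theorem root_pow_self {x : ℝ} (hx : 0 ≤ x) {k : ℕ} (hk : 1 ≤ k) : (x ^ (1 / (k : ℝ))) ^ k = x := by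
  rw [one_div]; exact Real.rpow_inv_natCast_pow hx (by omega)

theorem root_le_mul_root_iff {x y C : ℝ} (hx : 0 < x) (hy : 0 < y) (hC : 0 < C) {m k : ℕ}
    (hm : 1 ≤ m) (hk : 1 ≤ k) :
    x ^ (1 / (m : ℝ)) ≤ C * y ^ (1 / (k : ℝ)) ↔ x ^ k ≤ C ^ (m * k) * y ^ m := by
  have hx' : 0 ≤ x ^ (1 / (m : ℝ)) := Real.rpow_nonneg hx.le _
  have hy' : 0 ≤ C * y ^ (1 / (k : ℝ)) := mul_nonneg hC.le (Real.rpow_nonneg hy.le _)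
  rw [← pow_le_pow_iff_left₀ hx' hy' (n := m * k) (by positivity), mul_pow]
  have e1 : (x ^ (1 / (m : ℝ))) ^ (m * k) = x ^ k := by rw [pow_mul, root_pow_self hx.le hm]
  have e2 : (y ^ (1 / (k : ℝ))) ^ (m * k) = y ^ m := by
    rw [mul_comm m k, pow_mul, root_pow_self hy.le hk]
  rw [e1, e2]

theorem root_le_root_of_le_pow_mul {x y C : ℝ} (hx : 0 ≤ x) (hC : 0 ≤ C) (hy : 0 ≤ y)
    {k : ℕ} (hk : 1 ≤ k) (h : x ≤ C ^ k * y) : x ^ (1 / (k : ℝ)) ≤ C * y ^ (1 / (k : ℝ)) := by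
  calc x ^ (1 / (k : ℝ)) ≤ (C ^ k * y) ^ (1 / (k : ℝ)) :=
        Real.rpow_le_rpow hx h (by positivity)
    _ = C * y ^ (1 / (k : ℝ)) := by
        rw [Real.mul_rpow (pow_nonneg hC k) hy, one_div, Real.pow_rpow_inv_natCast hC (by omega)]

/-- Two sequences of positive numbers which agree up to geometric factors for `k ≥ 1`. -/
structure GeomEquiv (N N' : ℕ → ℝ) (C : ℝ) : Prop where
  one_le : 1 ≤ C
  pos : ∀ k, 0 < N k
  pos' : ∀ k, 0 < N' k
  le : ∀ k, 1 ≤ k → N k ≤ C ^ k * N' k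
  ge : ∀ k, 1 ≤ k → N' k ≤ C ^ k * N k

theorem GeomEquiv.symm {N N' : ℕ → ℝ} {C : ℝ} (h : GeomEquiv N N' C) : GeomEquiv N' N C :=
  ⟨h.one_le, h.pos', h.pos, h.ge, h.le⟩

theorem GeomEquiv.rootAlmostIncreasing {N N' : ℕ → ℝ} {C : ℝ} (h : GeomEquiv N N' C)
    (hN : RootAlmostIncreasing N) : RootAlmostIncreasing N' := by
  obtain ⟨B, hB, hN⟩ := hN
  have hC : 0 < C := one_pos.trans_le h.one_le
  refine ⟨C * (B * C), by positivity, fun j k hj hjk => ?_⟩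
  have h1 := root_le_root_of_le_pow_mul (h.pos' j).le hC.le (h.pos j).le hj (h.ge j hj)
  have h2 := root_le_root_of_le_pow_mul (h.pos k).le hC.le (h.pos' k).le (hj.trans hjk)
    (h.le k (hj.trans hjk))
  calc _ ≤ C * N j ^ (1 / (j : ℝ)) := h1
    _ ≤ C * (B * N k ^ (1 / (k : ℝ))) := by gcongr; exact hN j k hj hjk
    _ ≤ C * (B * (C * N' k ^ (1 / (k : ℝ)))) := by gcongr
    _ = _ := by ring

theorem GeomEquiv.fdBProperty {N N' : ℕ → ℝ} {C : ℝ} (h : GeomEquiv N N' C)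
    (hN : FdBProperty N) : FdBProperty N' := by
  obtain ⟨B, hB, hN⟩ := hN
  have hC : 0 < C := one_pos.trans_le h.one_le
  refine ⟨C * C * B * C, by positivity, fun j k α hα hk => ?_⟩
  -- For j = 0 also k = 0 and the inequality is trivial, so index 0, where the sequences may differ
  -- by a constant, never matters.
  rcases Nat.eq_zero_or_pos j with rfl | hj
  · have : k = 0 := by simpa using hk.symm
    subst this; simp
  have hjk : j ≤ k := by
    rw [← hk]
    calc j = ∑ _i : Fin j, 1 := by simp
      _ ≤ _ := Finset.sum_le_sum fun i _ => hα i
  have h1 : ∏ i, N' (α i) ≤ C ^ k * ∏ i, N (α i) := by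
    calc ∏ i, N' (α i) ≤ ∏ i, (C ^ α i * N (α i)) :=
          Finset.prod_le_prod (fun i _ => (h.pos' _).le) fun i _ => h.ge _ (hα i)
      _ = _ := by rw [Finset.prod_mul_distrib, Finset.prod_pow_eq_pow_sum, hk]
  have hp : 0 ≤ ∏ i, N (α i) := Finset.prod_nonneg fun i _ => (h.pos _).le
  have hp' : 0 ≤ ∏ i, N' (α i) := Finset.prod_nonneg fun i _ => (h.pos' _).le
  have hNj := (h.pos j).le
  have hNj' := (h.pos' j).le
  calc N' j * ∏ i, N' (α i) ≤ (C ^ j * N j) * (C ^ k * ∏ i, N (α i)) := by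
        gcongr; exact h.ge j hj
    _ = C ^ j * C ^ k * (N j * ∏ i, N (α i)) := by ring
    _ ≤ C ^ k * C ^ k * (B ^ k * (C ^ k * N' k)) := by
        have e1 := h.one_le
        have e2 := (hN j k α hα hk).trans (mul_le_mul_of_nonneg_left (h.le k (hj.trans_le hjk))
          (pow_nonneg hB.le k))
        gcongr
    _ = _ := by simp only [mul_pow]; ring

theorem le_pow_mul_of_le_mul_pow {x y A X : ℝ} (hy : 0 ≤ y) (hX : 0 ≤ X) {k : ℕ} (hk : 1 ≤ k)
    (h : x ≤ A * X ^ k * y) : x ≤ (max 1 A * X) ^ k * y := by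
  refine h.trans (mul_le_mul_of_nonneg_right ?_ hy)
  rw [mul_pow]
  refine mul_le_mul_of_nonneg_right ?_ (pow_nonneg hX k)
  exact (le_max_right 1 A).trans (le_self_pow₀ (le_max_left _ _) (by omega))

/-! ### Comparison of `regO` with `regC` -/

theorem GeomBelow.term_le_assocS {M : ℕ → ℝ} {t : ℝ} (k : ℕ) (hk : k ≤ ⌊t⌋₊) :
    t ^ k / ((k.factorial : ℝ) * M k) ≤ assocS M t :=
  Finset.le_sup' (fun k => t ^ k / ((k.factorial : ℝ) * M k)) (Finset.mem_Iic.2 hk)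

theorem GeomBelow.inv_le_assocS {M : ℕ → ℝ} (t : ℝ) : 1 / M 0 ≤ assocS M t := by
  simpa using GeomBelow.term_le_assocS (M := M) (t := t) 0 (Nat.zero_le _)

theorem GeomBelow.assocS_pos {M : ℕ → ℝ} {c a : ℝ} (h : GeomBelow M c a) (t : ℝ) :
    0 < assocS M t :=
  (one_div_pos.2 (h.pos 0)).trans_le (GeomBelow.inv_le_assocS t)

theorem factorial_mul_regO (M : ℕ → ℝ) (k : ℕ) :
    (k.factorial : ℝ) * regO M k = ⨆ t : Set.Ici (k : ℝ), (t : ℝ) ^ k / assocS M t := by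
  have hk : (k.factorial : ℝ) ≠ 0 := by exact_mod_cast k.factorial_ne_zero
  rw [regO]; field_simp

theorem GeomBelow.le_regO {M : ℕ → ℝ} {c a : ℝ} (h : GeomBelow M c a) {k : ℕ} {t : ℝ}
    (ht : (k : ℝ) ≤ t) : t ^ k / assocS M t ≤ (k.factorial : ℝ) * regO M k := by
  rw [factorial_mul_regO]
  refine le_ciSup (f := fun t : Set.Ici (k : ℝ) => (t : ℝ) ^ k / assocS M t) ?_ ⟨t, ht⟩
  refine ⟨(k.factorial : ℝ) * M k, ?_⟩
  rintro _ ⟨⟨u, hu⟩, rfl⟩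
  have := GeomBelow.term_le_assocS (M := M) (t := u) k (Nat.le_floor hu)
  rw [div_le_iff₀ (h.factorial_mul_pos k)] at this
  show u ^ k / assocS M u ≤ _
  rw [div_le_iff₀ (h.assocS_pos u)]
  linarith

theorem GeomBelow.regO_pos {M : ℕ → ℝ} {c a : ℝ} (h : GeomBelow M c a) (k : ℕ) :
    0 < regO M k := by
  have hk : (0 : ℝ) < k.factorial := by exact_mod_cast k.factorial_pos
  have ht : (k : ℝ) ≤ (k + 1 : ℕ) := by push_cast; linarith
  have h1 : 0 < ((k + 1 : ℕ) : ℝ) ^ k / assocS M ((k + 1 : ℕ) : ℝ) :=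
    div_pos (by positivity) (h.assocS_pos _)
  exact (mul_pos_iff_of_pos_left hk).1 (h1.trans_le (h.le_regO ht))

/-- For t ≥ k a constant multiple of (εt)ⁱ / `assocS M t` is a minorant of i! Mᵢ: for i ≤ t by the
definition of `assocS`, for i > t because i! Mᵢ ≥ c (a i / 3)ⁱ. So every competitor for `regO`
yields one for `regC`. -/
theorem GeomBelow.exists_regO_le {M : ℕ → ℝ} {c a : ℝ} (h : GeomBelow M c a) :
    ∃ A X : ℝ, 0 ≤ X ∧ ∀ k : ℕ, 1 ≤ k → regO M k ≤ A * X ^ k * regC M k := by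
  set ε := min 1 (a / 3) with hε
  have ha := h.pos_right
  have hc := h.pos_left
  have hε0 : 0 < ε := lt_min one_pos (by linarith)
  have hM0 := h.pos 0
  refine ⟨M 0 / c, ε⁻¹, (inv_pos.2 hε0).le, fun k hk => ?_⟩
  have hkf : (0 : ℝ) < k.factorial := by exact_mod_cast k.factorial_pos
  refine le_of_mul_le_mul_left ?_ hkf
  rw [factorial_mul_regO]
  have : Nonempty (Set.Ici (k : ℝ)) := ⟨⟨k, Set.mem_Ici.2 le_rfl⟩⟩
  refine ciSup_le ?_
  rintro ⟨t, ht⟩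
  have ht' : (k : ℝ) ≤ t := ht
  have ht0 : 0 < t := lt_of_lt_of_le (by exact_mod_cast hk) ht'
  have hS := h.assocS_pos t
  have hcM : c ≤ M 0 := by simpa using h.le 0
  have hl : IsGeomMinorant M (c / M 0 / assocS M t) (ε * t) := by
    refine ⟨by positivity, by positivity, fun i => ?_⟩
    by_cases hi : i ≤ ⌊t⌋₊
    · have h1 := GeomBelow.term_le_assocS (M := M) i hi
      rw [div_le_iff₀ (h.factorial_mul_pos i)] at h1
      calc c / M 0 / assocS M t * (ε * t) ^ i = (c / M 0) * ε ^ i * (t ^ i / assocS M t) := by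
            rw [mul_pow]; ring
        _ ≤ 1 * 1 * (t ^ i / assocS M t) := by
            gcongr
            · exact (div_le_one hM0).2 hcM
            · exact pow_le_one₀ hε0.le (min_le_left _ _)
        _ ≤ _ := by rw [one_mul, one_mul, div_le_iff₀ hS]; linarith
    · have hti : t ≤ i := (Nat.floor_lt ht0.le).1 (not_le.1 hi) |>.le
      have h1 := GeomBelow.inv_le_assocS (M := M) t
      rw [div_le_iff₀ hM0] at h1
      have h2 : c / M 0 / assocS M t ≤ c := by
        rw [div_div]; exact div_le_self hc.le (by linarith)
      calc c / M 0 / assocS M t * (ε * t) ^ i ≤ c * (a / 3 * i) ^ i := by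
            gcongr; exact min_le_right _ _
        _ = c * a ^ i * ((i : ℝ) ^ i / 3 ^ i) := by rw [mul_pow, div_pow]; ring
        _ ≤ M i * i.factorial := by
            have := pow_self_le_three_pow_mul_factorial i
            refine mul_le_mul (h.le i) ?_ (by positivity) (h.pos i).le
            rw [div_le_iff₀ (by positivity)]; linarith
        _ = _ := mul_comm _ _
  have h1 := hl.le_regC h k
  show t ^ k / assocS M t ≤ _
  calc t ^ k / assocS M t = M 0 / c * ε⁻¹ ^ k * (c / M 0 / assocS M t * (ε * t) ^ k) := by
        rw [mul_pow, inv_pow]; field_simp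
    _ ≤ M 0 / c * ε⁻¹ ^ k * ((k.factorial : ℝ) * regC M k) := by gcongr
    _ = _ := by ring

/-- Take an almost optimal minorant s tⁱ. If t ≥ k, then `assocS M t ≤ 1 / s` and t competes for
`regO`. If t ≤ k, then s tᵏ ≤ M₀ kᵏ, and the competitor k serves because `assocS M k` grows at most
geometrically. -/
theorem GeomBelow.exists_regC_le {M : ℕ → ℝ} {c a : ℝ} (h : GeomBelow M c a) :
    ∃ A X : ℝ, 0 ≤ X ∧ ∀ k : ℕ, 1 ≤ k → regC M k ≤ A * X ^ k * regO M k := by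
  have ha := h.pos_right
  have hc := h.pos_left
  have hM0 := h.pos 0
  have hcM : c ≤ M 0 := by simpa using h.le 0
  refine ⟨2 * (M 0 / c), Real.exp (1 / a), (Real.exp_pos _).le, fun k hk => ?_⟩
  have hkf : (0 : ℝ) < k.factorial := by exact_mod_cast k.factorial_pos
  have hO := h.regO_pos k
  refine le_of_mul_le_mul_left ?_ hkf
  obtain ⟨s, t, hl, hD⟩ := h.exists_isGeomMinorant k
  have hs := hl.pos_left
  have ht := hl.pos_right
  have hsM : s ≤ M 0 := by simpa using hl.le 0
  have hX : 1 ≤ Real.exp (1 / a) ^ k := one_le_pow₀ (Real.one_le_exp (by positivity))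
  have hA : 1 ≤ M 0 / c := (one_le_div hc).2 hcM
  suffices hst : s * t ^ k ≤ M 0 / c * Real.exp (1 / a) ^ k * ((k.factorial : ℝ) * regO M k) by
    linarith
  rcases le_total (k : ℝ) t with hkt | hkt
  · have h1 := h.le_regO hkt
    have h2 : assocS M t ≤ 1 / s := by
      refine Finset.sup'_le _ _ fun i _ => ?_
      rw [div_le_div_iff₀ (h.factorial_mul_pos i) hs]
      have := hl.le i
      linarith
    have h3 : s * t ^ k ≤ t ^ k / assocS M t := by
      rw [le_div_iff₀ (h.assocS_pos t)]
      rw [le_div_iff₀ hs] at h2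
      calc s * t ^ k * assocS M t = (assocS M t * s) * t ^ k := by ring
        _ ≤ 1 * t ^ k := by gcongr
        _ = _ := one_mul _
    calc s * t ^ k ≤ 1 * 1 * ((k.factorial : ℝ) * regO M k) := by linarith
      _ ≤ _ := by gcongr
  · have h1 := h.le_regO (le_refl (k : ℝ))
    have h2 : assocS M (k : ℝ) ≤ Real.exp ((k : ℝ) / a) / c :=
      Finset.sup'_le _ _ fun i _ => h.term_le_exp (Nat.cast_nonneg k) i
    have h3 : Real.exp ((k : ℝ) / a) = Real.exp (1 / a) ^ k := by
      rw [← Real.exp_nat_mul]; congr 1; ring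
    rw [h3] at h2
    have h4 : (k : ℝ) ^ k ≤ Real.exp (1 / a) ^ k / c * ((k.factorial : ℝ) * regO M k) := by
      rw [div_le_iff₀ (h.assocS_pos _)] at h1
      calc (k : ℝ) ^ k ≤ (k.factorial : ℝ) * regO M k * assocS M (k : ℝ) := h1
        _ ≤ (k.factorial : ℝ) * regO M k * (Real.exp (1 / a) ^ k / c) := by gcongr
        _ = _ := mul_comm _ _
    calc s * t ^ k ≤ M 0 * (k : ℝ) ^ k := by gcongr
      _ ≤ M 0 * (Real.exp (1 / a) ^ k / c * ((k.factorial : ℝ) * regO M k)) := by gcongr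
      _ = _ := by ring

theorem GeomBelow.exists_geomEquiv {M : ℕ → ℝ} {c a : ℝ} (h : GeomBelow M c a) :
    ∃ C, GeomEquiv (regC M) (regO M) C := by
  obtain ⟨A, X, hX, hAX⟩ := h.exists_regO_le
  obtain ⟨B, Y, hY, hBY⟩ := h.exists_regC_le
  have hAX' := fun k hk => le_pow_mul_of_le_mul_pow (h.regC_pos k).le hX hk (hAX k hk)
  have hBY' := fun k hk => le_pow_mul_of_le_mul_pow (h.regO_pos k).le hY hk (hBY k hk)
  refine ⟨max 1 (max (max 1 A * X) (max 1 B * Y)), le_max_left _ _, h.regC_pos, h.regO_pos,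
    fun k hk => (hBY' k hk).trans ?_, fun k hk => (hAX' k hk).trans ?_⟩
  · have := (h.regO_pos k).le
    gcongr
    exact (le_max_right _ _).trans (le_max_right _ _)
  · have := (h.regC_pos k).le
    gcongr
    exact (le_max_left _ _).trans (le_max_right _ _)

/-! ### Almost increasing roots and the (FdB)-property -/

/-- Roots of `regC M` at indices of comparable size. -/
theorem GeomBelow.root_regC_le {M : ℕ → ℝ} {c a : ℝ} (h : GeomBelow M c a) {m k : ℕ}
    (hm : 1 ≤ m) (hmk : m ≤ k) (hkm : k ≤ 2 * m) :
    regC M m ^ (1 / (m : ℝ)) ≤ 12 * max 1 (regC M 0) * regC M k ^ (1 / (k : ℝ)) := by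
  have hD : (1 : ℝ) ≤ max 1 (regC M 0) := le_max_left _ _
  rw [root_le_mul_root_iff (h.regC_pos m) (h.regC_pos k) (by positivity) hm (hm.trans hmk)]
  have h1 := h.regC_pow_le hmk
  set D := max 1 (regC M 0)
  have hp := (h.regC_pos k).le
  have hp' := (h.regC_pos m).le
  have hmf : (0 : ℝ) < m.factorial := by exact_mod_cast m.factorial_pos
  have h2 : (k.factorial : ℝ) ^ m ≤ 6 ^ (m * k) * (m.factorial : ℝ) ^ k := by
    have hkm' : (k : ℝ) ≤ 2 * m := by exact_mod_cast hkm
    calc (k.factorial : ℝ) ^ m ≤ ((k : ℝ) ^ k) ^ m := by gcongr; exact factorial_le_pow_self k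
      _ ≤ ((2 * m : ℝ) ^ k) ^ m := by gcongr
      _ = 2 ^ (m * k) * ((m : ℝ) ^ m) ^ k := by
          simp only [mul_pow, ← pow_mul]; ring
      _ ≤ 2 ^ (m * k) * (3 ^ m * (m.factorial : ℝ)) ^ k := by
          gcongr; exact pow_self_le_three_pow_mul_factorial m
      _ = _ := by
          rw [show (6 : ℝ) = 2 * 3 by norm_num, mul_pow (2 : ℝ) 3, mul_pow, ← pow_mul]; ring
  have h3 : (2 * D) ^ k ≤ (2 * D) ^ (m * k) :=
    pow_le_pow_right₀ (by linarith) (Nat.le_mul_of_pos_left k hm)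
  refine le_of_mul_le_mul_left ?_ (pow_pos hmf k)
  calc (m.factorial : ℝ) ^ k * regC M m ^ k = ((m.factorial : ℝ) * regC M m) ^ k := by
        rw [mul_pow]
    _ ≤ (2 * D) ^ k * ((k.factorial : ℝ) * regC M k) ^ m := h1
    _ = (2 * D) ^ k * (k.factorial : ℝ) ^ m * regC M k ^ m := by rw [mul_pow]; ring
    _ ≤ (2 * D) ^ (m * k) * (6 ^ (m * k) * (m.factorial : ℝ) ^ k) * regC M k ^ m := by gcongr
    _ = _ := by
        rw [show 12 * D = (2 * D) * 6 by ring, mul_pow (2 * D) 6]; ring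

/-- It suffices to compare the roots of `regC M` along multiples of even indices. -/
theorem GeomBelow.rootAlmostIncreasing_of_even {M : ℕ → ℝ} {c a : ℝ} (h : GeomBelow M c a) {C : ℝ}
    (hC : 0 < C) (hr : ∀ m j : ℕ, 1 ≤ m → 1 ≤ j → Even m →
      regC M m ^ (1 / (m : ℝ)) ≤ C * regC M (m * j) ^ (1 / ((m * j : ℕ) : ℝ))) :
    RootAlmostIncreasing (regC M) := by
  have hD : (1 : ℝ) ≤ max 1 (regC M 0) := le_max_left _ _
  set Y := 12 * max 1 (regC M 0) with hY
  have hY1 : 1 ≤ Y := by linarith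
  have hroot : ∀ k, 0 ≤ regC M k ^ (1 / (k : ℝ)) := fun k => Real.rpow_nonneg (h.regC_pos k).le _
  have heven : ∀ m k : ℕ, 1 ≤ m → m ≤ k → Even m →
      regC M m ^ (1 / (m : ℝ)) ≤ C * Y * regC M k ^ (1 / (k : ℝ)) := by
    intro m k hm hmk he
    -- The largest multiple of m below k is at least k / 2, so the root at this multiple is
    -- comparable with the root at k.
    have hj : 1 ≤ k / m := (Nat.one_le_div_iff hm).2 hmk
    have h1 : m * (k / m) ≤ k := Nat.mul_div_le k m
    have h2 : k ≤ 2 * (m * (k / m)) := by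
      have e1 := Nat.div_add_mod k m
      have e2 := Nat.mod_lt k (show 0 < m from hm)
      have e3 : m ≤ m * (k / m) := Nat.le_mul_of_pos_right m hj
      omega
    have h3 := h.root_regC_le (Nat.mul_pos hm hj) h1 h2
    calc _ ≤ C * regC M (m * (k / m)) ^ (1 / ((m * (k / m) : ℕ) : ℝ)) := hr m _ hm hj he
      _ ≤ C * (Y * regC M k ^ (1 / (k : ℝ))) := by gcongr
      _ = _ := by ring
  refine ⟨Y * (C * Y) + C * Y + 1, by positivity, fun m k hm hmk => ?_⟩
  have hk0 := hroot k
  suffices hs : regC M m ^ (1 / (m : ℝ)) ≤ Y * (C * Y) * regC M k ^ (1 / (k : ℝ)) ∨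
      regC M m ^ (1 / (m : ℝ)) ≤ C * Y * regC M k ^ (1 / (k : ℝ)) ∨
      regC M m ^ (1 / (m : ℝ)) ≤ 1 * regC M k ^ (1 / (k : ℝ)) by
    rcases hs with hs | hs | hs <;> refine hs.trans ?_ <;> gcongr
    · have : 0 < C * Y := by positivity
      linarith
    · have : 0 < Y * (C * Y) := by positivity
      linarith
    · have : 0 < C * Y := by positivity
      have : 0 < Y * (C * Y) := by positivity
      linarith
  rcases Nat.even_or_odd m with he | ho
  · exact Or.inr (Or.inl (heven m k hm hmk he))
  · rcases hmk.eq_or_lt with rfl | hlt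
    · exact Or.inr (Or.inr (by rw [one_mul]))
    -- An odd m < k is replaced by the even index m + 1 ≤ k.
    · left
      have h1 := h.root_regC_le hm (Nat.le_succ m) (by omega)
      have h2 := heven (m + 1) k (by omega) hlt ho.add_one
      calc _ ≤ Y * regC M (m + 1) ^ (1 / ((m + 1 : ℕ) : ℝ)) := h1
        _ ≤ Y * (C * Y * regC M k ^ (1 / (k : ℝ))) := by gcongr
        _ = _ := by ring

/-- With j equal blocks of size m the (FdB)-property bounds N_j N_mʲ by a geometric multiple of
N_{mj}; the factor N_j is discarded by the geometric lower bound for `regC M`. -/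
theorem GeomBelow.rootAlmostIncreasing_of_fdBProperty {M : ℕ → ℝ} {c a : ℝ} (h : GeomBelow M c a)
    (hF : FdBProperty (regC M)) : RootAlmostIncreasing (regC M) := by
  obtain ⟨B, hB, hF⟩ := hF
  have hN := h.geomBelow_regC
  -- Truncating at 1 makes the powers of e b decrease, so exponent j may be enlarged to m j.
  set b := min (a / 3) 1
  set e := min (c / 3) 1
  have hb : 0 < b := lt_min hN.pos_right one_pos
  have he : 0 < e := lt_min hN.pos_left one_pos
  have hb1 : b ≤ 1 := min_le_right _ _
  have he1 : e ≤ 1 := min_le_right _ _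
  refine h.rootAlmostIncreasing_of_even (C := B / (e * b)) (by positivity)
    fun m j hm hj _ => ?_
  have hmj : 1 ≤ m * j := Nat.mul_pos hm hj
  rw [root_le_mul_root_iff (h.regC_pos m) (h.regC_pos _) (by positivity) hm hmj]
  have h1 := hF j (m * j) (fun _ => m) (fun _ => hm) (by simp [mul_comm])
  simp only [Finset.prod_const, Finset.card_univ, Fintype.card_fin] at h1
  have h2 : (e * b) ^ (m * j) ≤ regC M j := by
    calc (e * b) ^ (m * j) ≤ (e * b) ^ j :=
          pow_le_pow_of_le_one (by positivity) (mul_le_one₀ he1 hb.le hb1)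
            (Nat.le_mul_of_pos_left j hm)
      _ = e ^ j * b ^ j := mul_pow _ _ _
      _ ≤ (c / 3) * (a / 3) ^ j := by
          have : e ^ j ≤ e := pow_le_of_le_one he.le he1 (by omega)
          have hc := hN.pos_left.le
          gcongr
          · exact this.trans (min_le_left _ _)
          · exact min_le_left _ _
      _ ≤ _ := hN.le j
  have h3 : regC M m ^ j ≤ (B / (e * b)) ^ (m * j) * regC M (m * j) := by
    have hp := (h.regC_pos m).le
    rw [div_pow, div_mul_eq_mul_div, le_div_iff₀ (by positivity)]
    calc regC M m ^ j * (e * b) ^ (m * j) ≤ regC M m ^ j * regC M j := by gcongr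
      _ ≤ _ := by linarith
  calc regC M m ^ (m * j) = (regC M m ^ j) ^ m := by rw [← pow_mul, mul_comm]
    _ ≤ ((B / (e * b)) ^ (m * j) * regC M (m * j)) ^ m := by
        have hp := (h.regC_pos m).le
        gcongr
    _ = _ := by rw [mul_pow, ← pow_mul]; congr 2; ring

/-- If the roots of `N` are almost increasing and `N` is moderate under shifts, then `N` has the
(FdB)-property. -/
theorem fdBProperty_of_rootAlmostIncreasing {N : ℕ → ℝ} (hN : ∀ k, 0 < N k)
    (hr : RootAlmostIncreasing N) {C : ℝ} (hC : 0 < C)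
    (hs : ∀ k, N (k + 1) ≤ C ^ (k + 1) * N k) : FdBProperty N := by
  obtain ⟨B, hB, hr⟩ := hr
  set Z := max 1 (max (N 0) (max B C)) with hZ
  have hZ1 : 1 ≤ Z := le_max_left _ _
  have hZ0 : N 0 ≤ Z := (le_max_left _ _).trans (le_max_right _ _)
  have hZB : B ≤ Z := (le_max_left _ _).trans ((le_max_right _ _).trans (le_max_right _ _))
  have hZC : C ≤ Z := (le_max_right _ _).trans ((le_max_right _ _).trans (le_max_right _ _))
  refine ⟨Z * Z ^ 3, by positivity, fun j k α hα hk => ?_⟩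
  rcases Nat.eq_zero_or_pos j with rfl | hj
  · have : k = 0 := by simpa using hk.symm
    subst this; simp
  have hjk : j ≤ k := by
    rw [← hk]
    calc j = ∑ _i : Fin j, 1 := by simp
      _ ≤ _ := Finset.sum_le_sum fun i _ => hα i
  -- Up to geometric factors N_j is at most rʲ, and N at αᵢ is at most r to the power αᵢ − 1 after
  -- one shift. The exponents add up to exactly k, and rᵏ = N_k.
  set r := N k ^ (1 / (k : ℝ)) with hrk
  have hr0 : 0 ≤ r := Real.rpow_nonneg (hN k).le _
  have hrN : r ^ k = N k := root_pow_self (hN k).le (hj.trans_le hjk)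
  have hpow : ∀ m, 1 ≤ m → m ≤ k → N m ≤ Z ^ m * r ^ m := by
    intro m hm hmk
    rw [← root_pow_self (hN m).le hm, ← mul_pow]
    refine pow_le_pow_left₀ (Real.rpow_nonneg (hN m).le _) ((hr m k hm hmk).trans ?_) m
    gcongr
  have hα' : ∀ i, N (α i) ≤ (Z ^ 3) ^ α i * r ^ (α i - 1) := by
    intro i
    have hik : α i ≤ k := hk ▸ Finset.single_le_sum (fun i _ => Nat.zero_le _) (Finset.mem_univ i)
    obtain ⟨m, hm⟩ := Nat.exists_eq_add_of_le' (hα i)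
    rw [hm, Nat.add_sub_cancel]
    have h1 : N m ≤ Z ^ (m + 1) * r ^ m := by
      rcases Nat.eq_zero_or_pos m with rfl | hm0
      · simpa using hZ0
      · refine (hpow m hm0 (by omega)).trans ?_
        gcongr
        · omega
    calc N (m + 1) ≤ C ^ (m + 1) * N m := hs m
      _ ≤ Z ^ (m + 1) * (Z ^ (m + 1) * r ^ m) := by have := (hN m).le; gcongr
      _ = Z ^ (2 * (m + 1)) * r ^ m := by ring
      _ ≤ Z ^ (3 * (m + 1)) * r ^ m := by gcongr; norm_num
      _ = _ := by rw [pow_mul]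
  have hsum : j + ∑ i, (α i - 1) = k := by
    rw [← hk]
    calc j + ∑ i, (α i - 1) = ∑ i : Fin j, (1 + (α i - 1)) := by
          rw [Finset.sum_add_distrib]; simp
      _ = _ := Finset.sum_congr rfl fun i _ => by have := hα i; omega
  have hprod : ∏ i, N (α i) ≤ (Z ^ 3) ^ k * r ^ (∑ i, (α i - 1)) := by
    calc ∏ i, N (α i) ≤ ∏ i, ((Z ^ 3) ^ α i * r ^ (α i - 1)) :=
          Finset.prod_le_prod (fun i _ => (hN _).le) fun i _ => hα' i
      _ = _ := by
          rw [Finset.prod_mul_distrib, Finset.prod_pow_eq_pow_sum, Finset.prod_pow_eq_pow_sum, hk]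
  have hp : 0 ≤ ∏ i, N (α i) := Finset.prod_nonneg fun i _ => (hN _).le
  calc N j * ∏ i, N (α i) ≤ (Z ^ j * r ^ j) * ((Z ^ 3) ^ k * r ^ (∑ i, (α i - 1))) := by
        gcongr; exact hpow j hj hjk
    _ = Z ^ j * (Z ^ 3) ^ k * r ^ (j + ∑ i, (α i - 1)) := by rw [pow_add]; ring
    _ ≤ Z ^ k * (Z ^ 3) ^ k * r ^ (j + ∑ i, (α i - 1)) := by gcongr
    _ = _ := by rw [hsum, hrN, ← mul_pow]

/-! ### Bernstein–Walsh inequality and coefficient bounds -/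

open Finset in
/-- A Bernstein–Walsh type inequality: growth of a complex polynomial which is bounded on
`[-1, 1]`. -/
theorem norm_sum_le_of_bounded_on_Icc {m : ℕ} {b : ℕ → ℂ} {Q : ℝ}
    (hQ : ∀ x : ℝ, |x| ≤ 1 → ‖∑ i ∈ range m, b i * (x : ℂ) ^ i‖ ≤ Q) (z : ℂ) :
    ‖∑ i ∈ range m, b i * z ^ i‖ ≤ (1 + 2 * ‖z‖) ^ m * Q := by
  -- Joukowski substitution ζ = (w − w⁻¹)/(2i): q(w) = wᵐ P(ζ) is a polynomial because P has degree
  -- below m. On the unit circle ζ = Im w lies in [−1, 1], so the maximum principle bounds q on the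
  -- disc.
  set q : ℂ → ℂ := fun w =>
    ∑ i ∈ range m, b i * w ^ (m - i) * ((w ^ 2 - 1) / (2 * Complex.I)) ^ i with hq
  have hI : (2 * Complex.I : ℂ) ≠ 0 := by simp
  have hrel : ∀ w v ζ : ℂ, w * v = 1 → w - v = 2 * Complex.I * ζ →
      q w = w ^ m * ∑ i ∈ range m, b i * ζ ^ i := by
    intro w v ζ hwv hζ
    rw [hq, mul_sum]
    refine sum_congr rfl fun i hi => ?_
    have h1 : (w ^ 2 - 1) / (2 * Complex.I) = w * ζ := by
      rw [div_eq_iff hI, ← hwv]; linear_combination w * hζ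
    have h2 : w ^ m = w ^ (m - i) * w ^ i := by
      rw [← pow_add, Nat.sub_add_cancel (mem_range.1 hi).le]
    rw [h1, h2, mul_pow]; ring
  have hqd : Differentiable ℂ q := by
    rw [hq]; fun_prop
  have hsphere : ∀ w : ℂ, ‖w‖ = 1 → ‖q w‖ ≤ Q := by
    intro w hw
    have h1 : w * (starRingEnd ℂ) w = 1 := by
      rw [Complex.mul_conj, Complex.normSq_eq_norm_sq, hw]; simp
    have h2 : w - (starRingEnd ℂ) w = 2 * Complex.I * (w.im : ℂ) := by
      rw [Complex.sub_conj]; push_cast; ring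
    rw [hrel w _ _ h1 h2, norm_mul, norm_pow, hw, one_pow, one_mul]
    exact hQ _ ((Complex.abs_im_le_norm w).trans hw.le)
  have hball : ∀ w : ℂ, ‖w‖ ≤ 1 → ‖q w‖ ≤ Q := by
    intro w hw
    refine Complex.norm_le_of_forall_mem_frontier_norm_le (U := Metric.ball 0 1)
      Metric.isBounded_ball hqd.diffContOnCl (fun v hv => ?_) ?_
    · rw [frontier_ball _ one_ne_zero] at hv
      exact hsphere v (by simpa using hv)
    · rw [closure_ball _ one_ne_zero]; simpa using hw
  have hQ0 : 0 ≤ Q := (norm_nonneg _).trans (hQ 0 (by simp))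
  have hfin : ∀ w v : ℂ, w * v = 1 → w - v = 2 * Complex.I * z → ‖w‖ ≤ 1 →
      ‖v‖ ≤ 1 + 2 * ‖z‖ → ‖∑ i ∈ range m, b i * z ^ i‖ ≤ (1 + 2 * ‖z‖) ^ m * Q := by
    intro w v hwv hz hw hv
    have h1 : ∑ i ∈ range m, b i * z ^ i = v ^ m * q w := by
      rw [hrel w v z hwv hz, ← mul_assoc, ← mul_pow, mul_comm v w, hwv, one_pow, one_mul]
    rw [h1, norm_mul, norm_pow]
    exact mul_le_mul (pow_le_pow_left₀ (norm_nonneg _) hv m) (hball w hw) (norm_nonneg _)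
      (by positivity)
  -- For u² = 1 − z² the two preimages of z are iz + u and iz − u. Their product is −1, so one of
  -- them lies in the closed unit disc.
  obtain ⟨u, hu⟩ := IsAlgClosed.exists_pow_nat_eq (1 - z ^ 2) (n := 2) (by norm_num)
  have hun : ‖u‖ ≤ 1 + ‖z‖ := by
    have h1 : ‖u‖ ^ 2 ≤ 1 + ‖z‖ ^ 2 := by
      rw [← norm_pow, hu]
      refine (norm_sub_le _ _).trans ?_
      simp
    refine le_of_sq_le_sq ?_ (by positivity)
    nlinarith [norm_nonneg z]
  have hn1 : ‖Complex.I * z + u‖ ≤ 1 + 2 * ‖z‖ := by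
    refine (norm_add_le _ _).trans ?_
    rw [norm_mul, Complex.norm_I]; linarith
  have hn2 : ‖-(Complex.I * z) + u‖ ≤ 1 + 2 * ‖z‖ := by
    refine (norm_add_le _ _).trans ?_
    rw [norm_neg, norm_mul, Complex.norm_I]; linarith
  have hprod : (Complex.I * z + u) * (-(Complex.I * z) + u) = 1 := by
    linear_combination hu - z ^ 2 * Complex.I_sq
  rcases le_total ‖Complex.I * z + u‖ 1 with hle | hle
  · exact hfin _ _ hprod (by ring) hle hn2
  · refine hfin (-(-(Complex.I * z) + u)) (-(Complex.I * z + u))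
      (by linear_combination hprod) (by ring) ?_ (by rwa [norm_neg])
    rw [norm_neg]
    have h1 : ‖Complex.I * z + u‖ * ‖-(Complex.I * z) + u‖ = 1 := by
      rw [← norm_mul, hprod, norm_one]
    by_contra! hlt
    nlinarith

theorem norm_coeff_le_of_forall_norm_eval_le {p : Polynomial ℂ} {R C : ℝ} (hR : 0 < R)
    (hC : ∀ z : ℂ, ‖z‖ = R → ‖p.eval z‖ ≤ C) (k : ℕ) : ‖p.coeff k‖ ≤ C / R ^ k := by
  have hd : ∀ k : ℕ, iteratedDeriv k (fun z => p.eval z) =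
      fun z => (Polynomial.derivative^[k] p).eval z := by
    intro k
    induction k with
    | zero => simp
    | succ k ih =>
      rw [iteratedDeriv_succ, ih]
      funext z
      rw [Polynomial.deriv, Function.iterate_succ_apply']
  have h1 := Complex.norm_iteratedDeriv_le_of_forall_mem_sphere_norm_le (c := 0) k hR
    (p.differentiable.diffContOnCl) (fun z hz => hC z (by simpa using hz))
  rw [hd k] at h1
  simp only at h1
  rw [← Polynomial.coeff_zero_eq_eval_zero, Polynomial.coeff_iterate_derivative] at h1
  simp only [zero_add, Nat.descFactorial_self, nsmul_eq_mul, norm_mul, Complex.norm_natCast] at h1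
  have hk : (0 : ℝ) < k.factorial := by exact_mod_cast k.factorial_pos
  rw [mul_div_assoc] at h1
  exact le_of_mul_le_mul_left h1 hk

open Finset in
/-- Bound for the Taylor coefficients at `0` of a real polynomial of degree `< m` which is bounded
on `[-r, r]`. -/
theorem abs_coeff_le_of_bounded_on_Icc {m : ℕ} {b : ℕ → ℝ} {Q r : ℝ} (hr : 0 < r)
    (hQ : ∀ x : ℝ, |x| ≤ r → |∑ i ∈ range m, b i * x ^ i / (i.factorial : ℝ)| ≤ Q) {i : ℕ}
    (hi : i < m) : |b i| ≤ (9 * m / r) ^ i * Q := by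
  have hQ0 : 0 ≤ Q := (abs_nonneg _).trans (hQ 0 (by simpa using hr.le))
  rcases Nat.eq_zero_or_pos i with rfl | hi0
  · have h := hQ 0 (by simpa using hr.le)
    obtain ⟨l, rfl⟩ := Nat.exists_eq_add_of_le' (Nat.one_le_of_lt hi)
    rw [sum_range_succ'] at h
    simpa using h
  set a : ℕ → ℂ := fun j => ((b j * r ^ j / (j.factorial : ℝ) : ℝ) : ℂ) with ha
  have h1 : ∀ x : ℝ, |x| ≤ 1 → ‖∑ j ∈ range m, a j * (x : ℂ) ^ j‖ ≤ Q := by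
    intro x hx
    have hxr : |r * x| ≤ r := by
      rw [abs_mul, abs_of_pos hr]; exact mul_le_of_le_one_right hr.le hx
    have h2 : ∑ j ∈ range m, a j * (x : ℂ) ^ j =
        ((∑ j ∈ range m, b j * (r * x) ^ j / (j.factorial : ℝ) : ℝ) : ℂ) := by
      push_cast
      refine sum_congr rfl fun j _ => ?_
      rw [ha]; push_cast; rw [mul_pow]; ring
    rw [h2, Complex.norm_real]
    exact hQ _ hxr
  set p : Polynomial ℂ := ∑ j ∈ range m, Polynomial.C (a j) * Polynomial.X ^ j with hp
  have hev : ∀ z, p.eval z = ∑ j ∈ range m, a j * z ^ j := by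
    intro z; simp [hp, Polynomial.eval_finsetSum]
  have hco : p.coeff i = a i := by
    simp [hp, Polynomial.coeff_C_mul, Polynomial.coeff_X_pow, hi]
  have hi' : (0 : ℝ) < i := by exact_mod_cast hi0
  have hm' : (0 : ℝ) < m := by exact_mod_cast hi0.trans hi
  have hif : (0 : ℝ) < i.factorial := by exact_mod_cast i.factorial_pos
  -- On the circle of radius i/m the growth factor (1 + 2i/m)ᵐ is at most e²ⁱ ≤ 9ⁱ, and i! / (i/m)ⁱ
  -- ≤ mⁱ: both losses are geometric in i.
  have h3 := norm_coeff_le_of_forall_norm_eval_le (p := p) (R := (i : ℝ) / m)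
    (C := 9 ^ i * Q) (by positivity) (fun z hz => ?_) i
  · rw [hco, ha, Complex.norm_real, Real.norm_eq_abs, abs_div, abs_mul, abs_of_pos (pow_pos hr i),
      abs_of_pos hif, div_le_iff₀ hif] at h3
    have h4 : 9 ^ i * Q / ((i : ℝ) / m) ^ i * i.factorial ≤ (9 * m) ^ i * Q := by
      rw [div_pow, mul_pow]
      have := factorial_le_pow_self i
      have e : 9 ^ i * Q / ((i : ℝ) ^ i / (m : ℝ) ^ i) * i.factorial =
        9 ^ i * (m : ℝ) ^ i * Q * (i.factorial / (i : ℝ) ^ i) := by field_simp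
      rw [e]
      refine mul_le_of_le_one_right (by positivity) ((div_le_one (by positivity)).2 this)
    have h5 := h3.trans h4
    rw [div_pow, div_mul_eq_mul_div, le_div_iff₀ (pow_pos hr i)]
    exact h5
  · rw [hev]
    refine (norm_sum_le_of_bounded_on_Icc h1 z).trans ?_
    refine mul_le_mul_of_nonneg_right ?_ hQ0
    rw [hz]
    have h6 : 1 + 2 * ((i : ℝ) / m) ≤ Real.exp (2 * ((i : ℝ) / m)) := by
      linarith [Real.add_one_le_exp (2 * ((i : ℝ) / m))]
    calc (1 + 2 * ((i : ℝ) / m)) ^ m ≤ Real.exp (2 * ((i : ℝ) / m)) ^ m := by gcongr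
      _ = Real.exp ((2 * i : ℕ) : ℝ) := by
          rw [← Real.exp_nat_mul]; congr 1; push_cast; field_simp
      _ ≤ 3 ^ (2 * i) := exp_nat_le_three_pow _
      _ = 9 ^ i := by rw [pow_mul]; norm_num

/-! ### Taylor remainder for a chain of derivatives -/

open Finset in
-- Induction on m: the remainder of h j at order m + 1 has as derivative the remainder of h (j + 1)
-- at order m, and the mean value inequality integrates the bound.
theorem abs_sub_taylor_le_of_nonneg {δ : ℝ} {h : ℕ → ℝ → ℝ}
    (hd : ∀ i s, |s| ≤ δ → HasDerivAt (h i) (h (i + 1) s) s) {m : ℕ} :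
    ∀ {j : ℕ} {B : ℝ}, (∀ s, |s| ≤ δ → |h (j + m) s| ≤ B) → ∀ {s : ℝ}, 0 ≤ s → s ≤ δ →
      |h j s - ∑ i ∈ range m, h (j + i) 0 * s ^ i / (i.factorial : ℝ)| ≤
        B * s ^ m / m.factorial := by
  induction m with
  | zero =>
    intro j B hB s hs hsδ
    simpa using hB s (by rwa [abs_of_nonneg hs])
  | succ m ih =>
    intro j B hB s hs hsδ
    have hB' : ∀ s, |s| ≤ δ → |h (j + 1 + m) s| ≤ B := by
      intro s hs; rw [show j + 1 + m = j + (m + 1) by ring]; exact hB s hs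
    have habs : ∀ x ∈ Set.Icc 0 s, |x| ≤ δ := fun x hx => by
      rw [abs_of_nonneg hx.1]; exact hx.2.trans hsδ
    have hpd : ∀ x : ℝ, HasDerivAt
        (fun x : ℝ => ∑ i ∈ range (m + 1), h (j + i) 0 * x ^ i / (i.factorial : ℝ))
        (∑ i ∈ range m, h (j + 1 + i) 0 * x ^ i / (i.factorial : ℝ)) x := by
      intro x
      have h1 : HasDerivAt
          (fun x : ℝ => ∑ i ∈ range (m + 1), h (j + i) 0 * x ^ i / (i.factorial : ℝ))
          (∑ i ∈ range (m + 1), h (j + i) 0 * (i * x ^ (i - 1)) / (i.factorial : ℝ)) x :=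
        HasDerivAt.fun_sum fun i _ => ((hasDerivAt_pow i x).const_mul _).div_const _
      refine h1.congr_deriv ?_
      symm
      rw [sum_range_succ' _ m]
      simp only [Nat.cast_zero, zero_mul, mul_zero, zero_div, add_zero]
      refine sum_congr rfl fun i _ => ?_
      have hif : (i.factorial : ℝ) ≠ 0 := by exact_mod_cast i.factorial_ne_zero
      have hi1 : ((i : ℝ) + 1) ≠ 0 := by positivity
      rw [show j + 1 + i = j + (i + 1) by ring, Nat.factorial_succ]
      push_cast
      field_simp
    have hbd : ∀ x : ℝ, HasDerivAt (fun x : ℝ => B * x ^ (m + 1) / (m + 1).factorial)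
        (B * x ^ m / m.factorial) x := by
      intro x
      have h1 := ((hasDerivAt_pow (m + 1) x).const_mul B).div_const ((m + 1).factorial : ℝ)
      refine h1.congr_deriv ?_
      have hif : (m.factorial : ℝ) ≠ 0 := by exact_mod_cast m.factorial_ne_zero
      have hi1 : ((m : ℝ) + 1) ≠ 0 := by positivity
      rw [Nat.factorial_succ]
      push_cast
      field_simp
    have hφ : ∀ x ∈ Set.Icc 0 s, HasDerivAt
        (fun x => h j x - ∑ i ∈ range (m + 1), h (j + i) 0 * x ^ i / (i.factorial : ℝ))
        (h (j + 1) x - ∑ i ∈ range m, h (j + 1 + i) 0 * x ^ i / (i.factorial : ℝ)) x :=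
      fun x hx => (hd j x (habs x hx)).sub (hpd x)
    refine image_norm_le_of_norm_deriv_right_le_deriv_boundary (a := 0) (b := s)
      (f := fun x => h j x - ∑ i ∈ range (m + 1), h (j + i) 0 * x ^ i / (i.factorial : ℝ))
      (fun x hx => (hφ x hx).continuousAt.continuousWithinAt)
      (fun x hx => (hφ x ⟨hx.1, hx.2.le⟩).hasDerivWithinAt) ?_ hbd
      (fun x hx => ih hB' hx.1 (hx.2.le.trans hsδ)) ⟨hs, le_rfl⟩
    rw [sum_range_succ']
    simp

open Finset in
theorem abs_sub_taylor_le {δ : ℝ} {h : ℕ → ℝ → ℝ}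
    (hd : ∀ i s, |s| ≤ δ → HasDerivAt (h i) (h (i + 1) s) s) {m j : ℕ} {B : ℝ}
    (hB : ∀ s, |s| ≤ δ → |h (j + m) s| ≤ B) {s : ℝ} (hs : |s| ≤ δ) :
    |h j s - ∑ i ∈ range m, h (j + i) 0 * s ^ i / (i.factorial : ℝ)| ≤
      B * |s| ^ m / m.factorial := by
  rcases le_total 0 s with h0 | h0
  · rw [abs_of_nonneg h0] at hs ⊢
    exact abs_sub_taylor_le_of_nonneg hd hB h0 hs
  -- Reflection x ↦ −x, with signs (−1)ⁱ, reduces negative s to positive s.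
  · have hd' : ∀ i s, |s| ≤ δ → HasDerivAt (fun x => (-1) ^ i * h i (-x))
        ((-1) ^ (i + 1) * h (i + 1) (-s)) s := by
      intro i x hx
      have h1 := ((hd i (-x) (by rwa [abs_neg])).comp x (hasDerivAt_neg x)).const_mul ((-1) ^ i)
      refine h1.congr_deriv ?_
      ring
    have hB' : ∀ s, |s| ≤ δ → |(-1) ^ (j + m) * h (j + m) (-s)| ≤ B := by
      intro x hx
      rw [abs_mul, abs_pow, abs_neg, abs_one, one_pow, one_mul]
      exact hB _ (by rwa [abs_neg])
    have h2 := abs_sub_taylor_le_of_nonneg (h := fun i x => (-1) ^ i * h i (-x)) hd' hB'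
      (s := -s) (by linarith) (by rwa [abs_of_nonpos h0] at hs)
    rw [abs_of_nonpos h0]
    refine le_trans (le_of_eq ?_) h2
    have h3 : (-1) ^ j * h j (- -s) -
        ∑ i ∈ range m, (-1) ^ (j + i) * h (j + i) (-0) * (-s) ^ i / (i.factorial : ℝ) =
        (-1) ^ j * (h j s - ∑ i ∈ range m, h (j + i) 0 * s ^ i / (i.factorial : ℝ)) := by
      rw [neg_neg, neg_zero, mul_sub, mul_sum]
      congr 1
      refine sum_congr rfl fun i _ => ?_
      have : ((-1 : ℝ) ^ i) * (-1) ^ i = 1 := by rw [← mul_pow]; simp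
      rw [pow_add, neg_pow s]
      linear_combination ((-1) ^ j * h (j + i) 0 * s ^ i / (i.factorial : ℝ)) * this
    rw [h3, abs_mul, abs_pow, abs_neg, abs_one, one_pow, one_mul]

/-! ### Cartan–Gorny interpolation in one variable -/

/-- `j` maximizes `tⁱ / Bᵢ`. -/
def IsMaxIndex (B : ℕ → ℝ) (t : ℝ) (j : ℕ) : Prop := ∀ i, t ^ i / B i ≤ t ^ j / B j

theorem exists_isMaxIndex {B : ℕ → ℝ} (hB : ∀ i, 0 < B i)
    (hlim : ∀ t : ℝ, 0 < t → Filter.Tendsto (fun i => t ^ i / B i) Filter.atTop (nhds 0)) {t : ℝ}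
    (ht : 0 < t) : ∃ j, IsMaxIndex B t j := by
  have h0 : 0 < t ^ 0 / B 0 := div_pos (by simp) (hB 0)
  obtain ⟨n, hn⟩ := Filter.eventually_atTop.1 ((hlim t ht).eventually (gt_mem_nhds h0))
  obtain ⟨j, -, hj⟩ := Finset.exists_max_image (Finset.range (n + 1)) (fun i => t ^ i / B i)
    ⟨0, by simp⟩
  refine ⟨j, fun i => ?_⟩
  rcases lt_or_ge i n with hi | hi
  · exact hj i (by simp; omega)
  · exact (hn i hi).le.trans (hj 0 (by simp))

/-- Between two dyadic scales the maximal index jumps over `k`. -/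
theorem exists_isMaxIndex_jump {B : ℕ → ℝ} (hB : ∀ i, 0 < B i)
    (hlim : ∀ t : ℝ, 0 < t → Filter.Tendsto (fun i => t ^ i / B i) Filter.atTop (nhds 0))
    (k : ℕ) : ∃ t j n, 0 < t ∧ j ≤ k ∧ k < n ∧ IsMaxIndex B t j ∧ IsMaxIndex B (2 * t) n := by
  -- Index 0 is maximal at t₀ = (min B)/B₀ ≤ 1, so the dyadic chain t₀ 2ˡ starts with an index not
  -- exceeding k.
  obtain ⟨t₀, ht₀, hmax₀⟩ : ∃ t₀, 0 < t₀ ∧ IsMaxIndex B t₀ 0 := by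
    obtain ⟨j, hj⟩ := exists_isMaxIndex hB hlim one_pos
    have hj0 : 0 < B j := hB j
    have hB0 := hB 0
    have h1 : ∀ i, 1 / B i ≤ 1 / B j := fun i => by simpa using hj i
    have h2 : B j ≤ B 0 := (one_div_le_one_div hB0 hj0).1 (h1 0)
    have h3 : B j / B 0 ≤ 1 := (div_le_one hB0).2 h2
    refine ⟨B j / B 0, div_pos hj0 hB0, fun i => ?_⟩
    rcases Nat.eq_zero_or_pos i with rfl | hi
    · exact le_rfl
    · calc (B j / B 0) ^ i / B i = (B j / B 0) ^ i * (1 / B i) := by ring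
        _ ≤ (B j / B 0) ^ 1 * (1 / B j) := by
            have h4 : (B j / B 0) ^ i ≤ (B j / B 0) ^ 1 :=
              pow_le_pow_of_le_one (div_pos hj0 hB0).le h3 hi
            have h5 := (one_div_pos.2 (hB i)).le
            have h6 := (div_pos hj0 hB0).le
            exact mul_le_mul h4 (h1 i) h5 (by simpa using h6)
        _ = _ := by field_simp
  have hex : ∃ l : ℕ, (∃ j ≤ k, IsMaxIndex B (t₀ * 2 ^ l) j) ∧
      ¬ ∃ j ≤ k, IsMaxIndex B (t₀ * 2 ^ (l + 1)) j := by
    by_contra! hcon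
    have hall : ∀ l : ℕ, ∃ j ≤ k, IsMaxIndex B (t₀ * 2 ^ l) j := by
      intro l
      induction l with
      | zero => exact ⟨0, Nat.zero_le _, by simpa using hmax₀⟩
      | succ l ih => exact hcon l ih
    -- A maximal index j ≤ k at scale t > 1 forces t ≤ B_{k+1}/B_j ≤ X, which fails far along the
    -- chain.
    set X := ∑ j ∈ Finset.range (k + 1), B (k + 1) / B j with hX
    obtain ⟨l, hl⟩ : ∃ l : ℕ, max 1 X < t₀ * 2 ^ l := by
      have h1 : Filter.Tendsto (fun l : ℕ => t₀ * (2 : ℝ) ^ l) Filter.atTop Filter.atTop :=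
        (tendsto_pow_atTop_atTop_of_one_lt one_lt_two).const_mul_atTop ht₀
      exact (h1.eventually_gt_atTop _).exists
    obtain ⟨j, hjk, hj⟩ := hall l
    set t := t₀ * 2 ^ l
    have ht1 : 1 < t := (le_max_left _ _).trans_lt hl
    have ht0 : 0 < t := one_pos.trans ht1
    have h1 := hj (k + 1)
    rw [div_le_div_iff₀ (hB _) (hB _)] at h1
    have h2 : t * t ^ j ≤ t ^ (k + 1) := by
      rw [← pow_succ']; exact pow_le_pow_right₀ ht1.le (by omega)
    have h3 : t * B j ≤ B (k + 1) := by
      refine le_of_mul_le_mul_left ?_ (pow_pos ht0 j)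
      calc t ^ j * (t * B j) = (t * t ^ j) * B j := by ring
        _ ≤ t ^ (k + 1) * B j := mul_le_mul_of_nonneg_right h2 (hB j).le
        _ ≤ _ := h1
    have h4 : t ≤ B (k + 1) / B j := (le_div_iff₀ (hB j)).2 h3
    have h5 : B (k + 1) / B j ≤ X :=
      Finset.single_le_sum (f := fun j => B (k + 1) / B j)
        (fun i _ => (div_pos (hB _) (hB i)).le) (Finset.mem_range.2 (by omega))
    exact absurd (h4.trans (h5.trans (le_max_right 1 X))) (not_le.2 hl)
  obtain ⟨l, ⟨j, hjk, hj⟩, hl⟩ := hex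
  have ht : 0 < t₀ * 2 ^ l := by positivity
  obtain ⟨n, hn⟩ := exists_isMaxIndex hB hlim (t := t₀ * 2 ^ (l + 1)) (by positivity)
  refine ⟨t₀ * 2 ^ l, j, n, ht, hjk, ?_, hj, ?_⟩
  · by_contra! hnk
    exact hl ⟨n, hnk, hn⟩
  · rwa [show 2 * (t₀ * 2 ^ l) = t₀ * 2 ^ (l + 1) by ring]

theorem tendsto_pow_div_of_mul_pow_le {B : ℕ → ℝ} {a : ℝ} (ha : 0 < a) {i₀ : ℕ}
    (hB : ∀ i, 0 < B i)
    (hBa : ∀ i, i₀ ≤ i → (a * i) ^ i ≤ B i) {t : ℝ} (ht : 0 < t) :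
    Filter.Tendsto (fun i => t ^ i / B i) Filter.atTop (nhds 0) := by
  have h1 : Filter.Tendsto (fun i : ℕ => (1 / 2 : ℝ) ^ i) Filter.atTop (nhds 0) :=
    tendsto_pow_atTop_nhds_zero_of_lt_one (by norm_num) (by norm_num)
  refine squeeze_zero' (Filter.Eventually.of_forall fun i => (div_pos (pow_pos ht i) (hB i)).le)
    ?_ h1
  filter_upwards [Filter.eventually_ge_atTop i₀, Filter.eventually_ge_atTop ⌈2 * t / a⌉₊]
    with i hi hi'
  have h2 : 2 * t / a ≤ i := Nat.ceil_le.1 hi'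
  rw [div_le_iff₀ ha] at h2
  rw [div_le_iff₀ (hB i)]
  calc t ^ i ≤ (1 / 2 * (a * i)) ^ i := by gcongr; linarith
    _ = (1 / 2) ^ i * (a * i) ^ i := mul_pow _ _ _
    _ ≤ _ := by gcongr; exact hBa i hi

/-- **Cartan–Gorny type interpolation.** If all derivatives of a function on `[-δ, δ]` are bounded
by the sequence `B`, then its `k`-th derivative at `0` is bounded by the `k`-th term of a geometric
minorant of `B`, up to a geometric factor. -/
theorem exists_minorant_forall_abs_le {B : ℕ → ℝ} {a δ : ℝ} {i₀ : ℕ} (hδ : 0 < δ)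
    (haδ : 1 ≤ a * δ) (hB : ∀ i, 0 < B i) (hBa : ∀ i, i₀ ≤ i → (a * i) ^ i ≤ B i) :
    ∃ k₀ : ℕ, ∀ k, k₀ ≤ k → ∃ s t : ℝ, 0 < s ∧ 0 < t ∧ (∀ i, s * t ^ i ≤ B i) ∧
      ∀ h : ℕ → ℝ → ℝ, (∀ i s, |s| ≤ δ → HasDerivAt (h i) (h (i + 1) s) s) →
        (∀ i s, |s| ≤ δ → |h i s| ≤ B i) → |h k 0| ≤ 2 * 54 ^ k * (s * t ^ k) := by
  have ha : 0 < a := by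
    by_contra! hle
    nlinarith
  have hlim : ∀ t : ℝ, 0 < t → Filter.Tendsto (fun i => t ^ i / B i) Filter.atTop (nhds 0) :=
    fun t ht => tendsto_pow_div_of_mul_pow_le ha hB hBa ht
  obtain ⟨k₁, hk₁⟩ : ∃ k₁ : ℕ, B 0 < 2 ^ k₁ := pow_unbounded_of_one_lt _ one_lt_two
  refine ⟨max i₀ k₁, fun k hk => ?_⟩
  -- The minorant is the one touching B at j. With n = j + m and k = j + i, h k 0 is the derivative
  -- of order i at 0 of the Taylor polynomial of degree below m of h j.
  obtain ⟨t, j, n, ht, hjk, hkn, hj, hn⟩ := exists_isMaxIndex_jump hB hlim k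
  have hBj := hB j
  have hBn := hB n
  refine ⟨B j / t ^ j, t, by positivity, ht, fun i => ?_, fun h hd hb => ?_⟩
  · have := hj i
    rw [div_le_div_iff₀ (hB i) hBj] at this
    rw [div_mul_eq_mul_div, div_le_iff₀ (by positivity)]
    linarith
  obtain ⟨m, rfl⟩ := Nat.exists_eq_add_of_le (hjk.trans hkn.le)
  obtain ⟨i, rfl⟩ := Nat.exists_eq_add_of_le hjk
  have him : i < m := by omega
  have hm0 : (0 : ℝ) < m := by exact_mod_cast (Nat.zero_le i).trans_lt him
  have hmf : (0 : ℝ) < m.factorial := by exact_mod_cast m.factorial_pos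
  -- Comparing n with index 0 at scale 2t gives (an)ⁿ ≤ Bₙ ≤ (2t)ⁿ B₀ ≤ (4t)ⁿ. It ensures that the
  -- radius r below does not exceed δ.
  have hnt : a * (j + m : ℕ) ≤ 4 * t := by
    have h1 := hn 0
    rw [div_le_div_iff₀ (hB 0) hBn, pow_zero, one_mul] at h1
    have h2 := hBa (j + m) (by have := le_max_left i₀ k₁; omega)
    have h3 : B 0 ≤ 2 ^ (j + m) :=
      hk₁.le.trans (pow_le_pow_right₀ one_le_two (by have := le_max_right i₀ k₁; omega))
    have h4 : (a * (j + m : ℕ)) ^ (j + m) ≤ (4 * t) ^ (j + m) := by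
      calc _ ≤ B (j + m) := h2
        _ ≤ (2 * t) ^ (j + m) * B 0 := h1
        _ ≤ (2 * t) ^ (j + m) * 2 ^ (j + m) := by gcongr
        _ = _ := by rw [← mul_pow]; ring
    exact (pow_le_pow_iff_left₀ (by positivity) (by positivity) (by omega)).1 h4
  -- Since mᵐ ≤ 3ᵐ m!, this radius makes rᵐ/m! ≤ (2t)⁻ᵐ, which matches the scale 2t at which n is
  -- maximal; the remainder is then at most 2ʲ B_j.
  set r := (m : ℝ) / (6 * t) with hr
  have hr0 : 0 < r := by positivity
  have hrδ : r ≤ δ := by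
    rw [hr, div_le_iff₀ (by positivity)]
    push_cast at hnt
    have h1 : a * m ≤ 4 * t := le_trans (by gcongr; linarith [Nat.cast_nonneg (α := ℝ) j]) hnt
    calc (m : ℝ) ≤ (a * δ) * m := le_mul_of_one_le_left hm0.le haδ
      _ = δ * (a * m) := by ring
      _ ≤ δ * (4 * t) := by gcongr
      _ ≤ δ * (6 * t) := by gcongr; norm_num
  have hrm : r ^ m / m.factorial ≤ 1 / (2 * t) ^ m := by
    rw [div_le_div_iff₀ hmf (by positivity), one_mul, ← mul_pow]
    have h1 : r * (2 * t) = m / 3 := by rw [hr]; field_simp; norm_num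
    rw [h1, div_pow, div_le_iff₀ (by positivity)]
    linarith [pow_self_le_three_pow_mul_factorial m]
  have hBnj : B (j + m) * (1 / (2 * t) ^ m) ≤ 2 ^ j * B j := by
    have h1 := hn j
    rw [div_le_div_iff₀ hBj hBn] at h1
    have h2 := hj j
    rw [mul_one_div, div_le_iff₀ (by positivity)]
    refine le_of_mul_le_mul_left ?_ (pow_pos ht j)
    have h3 := hn j
    have h4 : 1 ≤ (2 : ℝ) ^ j := one_le_pow₀ one_le_two
    calc t ^ j * B (j + m) ≤ (2 * t) ^ j * B (j + m) := by gcongr; linarith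
      _ ≤ (2 * t) ^ (j + m) * B j := h1
      _ = t ^ j * (2 ^ j * B j * (2 * t) ^ m) := by rw [pow_add, mul_pow 2 t j]; ring
  have hpoly : ∀ x : ℝ, |x| ≤ r →
      |∑ l ∈ Finset.range m, h (j + l) 0 * x ^ l / (l.factorial : ℝ)| ≤ 2 * 2 ^ j * B j := by
    intro x hx
    have h1 := abs_sub_taylor_le hd (m := m) (j := j) (hb (j + m)) (hx.trans hrδ)
    have h2 := hb j x (hx.trans hrδ)
    have h3 : B (j + m) * |x| ^ m / m.factorial ≤ 2 ^ j * B j := by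
      calc B (j + m) * |x| ^ m / m.factorial ≤ B (j + m) * r ^ m / m.factorial := by gcongr
        _ = B (j + m) * (r ^ m / m.factorial) := by ring
        _ ≤ B (j + m) * (1 / (2 * t) ^ m) := by gcongr
        _ ≤ _ := hBnj
    have h4 : B j ≤ 2 ^ j * B j := le_mul_of_one_le_left hBj.le (one_le_pow₀ one_le_two)
    rw [abs_le] at h1 h2 ⊢
    constructor <;> linarith
  have hco := abs_coeff_le_of_bounded_on_Icc (b := fun l => h (j + l) 0) hr0 hpoly him
  have h9 : 9 * (m : ℝ) / r = 54 * t := by rw [hr]; field_simp; norm_num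
  rw [h9] at hco
  refine hco.trans ?_
  have h10 : B j / t ^ j * t ^ (j + i) = B j * t ^ i := by rw [pow_add]; field_simp
  rw [h10, mul_pow, pow_add]
  calc 54 ^ i * t ^ i * (2 * 2 ^ j * B j) = 2 * (2 ^ j * 54 ^ i) * (B j * t ^ i) := by ring
    _ ≤ 2 * (54 ^ j * 54 ^ i) * (B j * t ^ i) := by gcongr; norm_num

/-! ### Symmetry of iterated Fréchet derivatives -/

section Symmetry

variable {E F : Type*} [NormedAddCommGroup E] [NormedSpace ℝ E]
  [NormedAddCommGroup F] [NormedSpace ℝ F]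

theorem contDiffAt_iteratedFDeriv {f : E → F} {x : E}
    (hf : ContDiffAt ℝ ((⊤ : ℕ∞) : WithTop ℕ∞) f x) (k m : ℕ) :
    ContDiffAt ℝ (m : WithTop ℕ∞) (iteratedFDeriv ℝ k f) x := by
  refine hf.iteratedFDeriv_right ?_
  exact_mod_cast (le_top : ((m + k : ℕ) : ℕ∞) ≤ ⊤)

theorem hasFDerivAt_iteratedFDeriv {f : E → F} {x : E}
    (hf : ContDiffAt ℝ ((⊤ : ℕ∞) : WithTop ℕ∞) f x) (k : ℕ) :
    HasFDerivAt (iteratedFDeriv ℝ k f) (fderiv ℝ (iteratedFDeriv ℝ k f) x) x :=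
  ((contDiffAt_iteratedFDeriv hf k 1).differentiableAt (by simp)).hasFDerivAt

theorem hasFDerivAt_iteratedFDeriv_apply {f : E → F} {x : E}
    (hf : ContDiffAt ℝ ((⊤ : ℕ∞) : WithTop ℕ∞) f x) {k : ℕ} (w : Fin k → E) :
    HasFDerivAt (fun y => iteratedFDeriv ℝ k f y w)
      ((ContinuousMultilinearMap.apply ℝ (fun _ : Fin k => E) F w).comp
        (fderiv ℝ (iteratedFDeriv ℝ k f) x)) x :=
  (ContinuousMultilinearMap.apply ℝ (fun _ : Fin k => E) F w).hasFDerivAt.comp x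
    (hasFDerivAt_iteratedFDeriv hf k)

theorem fderiv_iteratedFDeriv_apply {f : E → F} {x : E}
    (hf : ContDiffAt ℝ ((⊤ : ℕ∞) : WithTop ℕ∞) f x) {k : ℕ} (w : Fin k → E) (v : E) :
    fderiv ℝ (fun y => iteratedFDeriv ℝ k f y w) x v =
      iteratedFDeriv ℝ (k + 1) f x (Fin.cons v w) := by
  rw [(hasFDerivAt_iteratedFDeriv_apply hf w).fderiv, iteratedFDeriv_succ_apply_left]
  simp

theorem iteratedFDeriv_cons_cons_swap {f : E → F} {x : E}
    (hf : ContDiffAt ℝ ((⊤ : ℕ∞) : WithTop ℕ∞) f x) {k : ℕ} (u v : E) (w : Fin k → E) :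
    iteratedFDeriv ℝ (k + 2) f x (Fin.cons u (Fin.cons v w)) =
      iteratedFDeriv ℝ (k + 2) f x (Fin.cons v (Fin.cons u w)) := by
  have hG := contDiffAt_iteratedFDeriv hf k 2
  have hsymm : IsSymmSndFDerivAt ℝ (iteratedFDeriv ℝ k f) x :=
    hG.isSymmSndFDerivAt (by simp)
  have hd : DifferentiableAt ℝ (fderiv ℝ (iteratedFDeriv ℝ k f)) x :=
    (hG.fderiv_right (m := 1) (by norm_num)).differentiableAt (by simp)
  have key : ∀ a b : E, iteratedFDeriv ℝ (k + 2) f x (Fin.cons a (Fin.cons b w)) =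
      fderiv ℝ (fderiv ℝ (iteratedFDeriv ℝ k f)) x a b w := by
    intro a b
    rw [← fderiv_iteratedFDeriv_apply hf]
    have h1 : (fun y => iteratedFDeriv ℝ (k + 1) f y (Fin.cons b w)) =
        fun y => fderiv ℝ (iteratedFDeriv ℝ k f) y b w := by
      funext y; rw [iteratedFDeriv_succ_apply_left]; simp
    rw [h1]
    have h2 := hd.hasFDerivAt.clm_apply (hasFDerivAt_const b x)
    have h3 := (ContinuousMultilinearMap.apply ℝ (fun _ : Fin k => E) F w).hasFDerivAt.comp x h2
    have h4 : (fun y => fderiv ℝ (iteratedFDeriv ℝ k f) y b w) =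
        (ContinuousMultilinearMap.apply ℝ (fun _ : Fin k => E) F w) ∘
          fun y => fderiv ℝ (iteratedFDeriv ℝ k f) y b := rfl
    rw [h4, h3.fderiv]; simp
  rw [key, key, hsymm u v]

/-- The iterated derivatives of a smooth function are symmetric. -/
theorem iteratedFDeriv_comp_perm_of_smoothOn {f : E → F} {U : Set E} (hU : IsOpen U)
    (hf : ∀ x ∈ U, ContDiffAt ℝ ((⊤ : ℕ∞) : WithTop ℕ∞) f x) :
    ∀ (k : ℕ) (x : E), x ∈ U → ∀ (v : Fin k → E) (σ : Equiv.Perm (Fin k)),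
      iteratedFDeriv ℝ k f x (v ∘ σ) = iteratedFDeriv ℝ k f x v := by
  intro k
  induction k with
  | zero => intro x _ v σ; congr 1; exact Subsingleton.elim _ _
  | succ k ih =>
    intro x hx v σ
    -- Adjacent transpositions generate the group. The one on the first two slots is the symmetry of
    -- a second derivative; the others follow by differentiating the symmetry of lower order, which
    -- holds on the open set U.
    have hσ : σ ∈ Submonoid.closure
        (Set.range fun i : Fin k => Equiv.swap i.castSucc i.succ) := by
      rw [Equiv.Perm.mclosure_swap_castSucc_succ]; trivial
    induction hσ using Submonoid.closure_induction generalizing v with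
    | one => rfl
    | mul σ τ _ _ h1 h2 =>
      have : v ∘ (σ * τ : Equiv.Perm _) = (v ∘ σ) ∘ τ := rfl
      rw [this, h2, h1]
    | mem σ hσ =>
      obtain ⟨i, rfl⟩ := hσ
      cases k with
      | zero => exact i.elim0
      | succ k =>
        refine Fin.cases ?_ (fun j => ?_) i
        · have e1 : v = Fin.cons (v 0) (Fin.cons (v 1) (fun l => v l.succ.succ)) := by
            funext l
            refine Fin.cases rfl (fun l => ?_) l
            refine Fin.cases rfl (fun l => rfl) l
          have e2 : v ∘ Equiv.swap (0 : Fin (k + 1)).castSucc (0 : Fin (k + 1)).succ =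
              Fin.cons (v 1) (Fin.cons (v 0) (fun l => v l.succ.succ)) := by
            funext l
            refine Fin.cases ?_ (fun l => ?_) l
            · simp
            · refine Fin.cases ?_ (fun l => ?_) l
              · have : ((0 : Fin (k + 1)).succ : Fin (k + 2)) = 1 := rfl
                simp
              · rw [Function.comp_apply, Equiv.swap_apply_of_ne_of_ne]
                · rfl
                · simp [Fin.ext_iff]
                · simp [Fin.ext_iff]
          rw [e2, iteratedFDeriv_cons_cons_swap (hf x hx), ← e1]
        · have e1 : v = Fin.cons (v 0) (Fin.tail v) := (Fin.cons_self_tail v).symm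
          have e2 : v ∘ Equiv.swap j.succ.castSucc j.succ.succ =
              Fin.cons (v 0) (Fin.tail v ∘ Equiv.swap j.castSucc j.succ) := by
            funext l
            refine Fin.cases ?_ (fun l => ?_) l
            · rw [Function.comp_apply, Equiv.swap_apply_of_ne_of_ne]
              · rfl
              · simp [Fin.ext_iff]
              · simp [Fin.ext_iff]
            · simp only [Function.comp_apply, Fin.cons_succ, Fin.tail]
              congr 1
              have : (j.succ.castSucc : Fin (k + 2)) = j.castSucc.succ := rfl
              rw [this, ← (Fin.succ_injective _).swap_apply]
          rw [e2, ← fderiv_iteratedFDeriv_apply (hf x hx)]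
          conv_rhs => rw [e1, ← fderiv_iteratedFDeriv_apply (hf x hx)]
          congr 1
          refine Filter.EventuallyEq.fderiv_eq ?_
          filter_upwards [hU.mem_nhds hx] with y hy
          exact ih y hy _ _

end Symmetry

/-! ### Polarization of symmetric multilinear maps -/

section Polarization

variable {E F : Type*} [NormedAddCommGroup E] [NormedSpace ℝ E]
  [NormedAddCommGroup F] [NormedSpace ℝ F]

/-- Some j is missed by r; flipping the sign of ε j negates the first product and fixes the second,
so the sum equals its negative. -/
theorem sum_signs_prod_mul_prod {k : ℕ} (r : Fin k → Fin k) (hr : ¬ Function.Bijective r) :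
    ∑ ε : Fin k → ℤˣ, (∏ i, (((ε i : ℤˣ) : ℤ) : ℝ)) * ∏ i, (((ε (r i) : ℤˣ) : ℤ) : ℝ) = 0 := by
  have hns : ¬ Function.Surjective r := fun h => hr (Finite.surjective_iff_bijective.1 h)
  rw [Function.Surjective] at hns
  push Not at hns
  obtain ⟨j, hj⟩ := hns
  set S := ∑ ε : Fin k → ℤˣ, (∏ i, (((ε i : ℤˣ) : ℤ) : ℝ)) * ∏ i, (((ε (r i) : ℤˣ) : ℤ) : ℝ)
  suffices h : S = -S by linarith
  rw [← Finset.sum_neg_distrib]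
  refine Fintype.sum_equiv (Equiv.mulRight (Pi.mulSingle j (-1 : ℤˣ))) _ _ fun ε => ?_
  have h1 : ∏ i, ((((ε * Pi.mulSingle j (-1 : ℤˣ) : Fin k → ℤˣ) i : ℤˣ) : ℤ) : ℝ) =
      -∏ i, (((ε i : ℤˣ) : ℤ) : ℝ) := by
    simp only [Pi.mul_apply, Units.val_mul, Int.cast_mul]
    rw [Finset.prod_mul_distrib]
    have h2 : ∏ i, (((Pi.mulSingle j (-1 : ℤˣ) : Fin k → ℤˣ) i : ℤˣ) : ℤ) = -1 := by
      rw [Finset.prod_eq_single j]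
      · simp
      · intro b _ hb; simp [hb]
      · simp
    have h3 : ∏ i, ((((Pi.mulSingle j (-1 : ℤˣ) : Fin k → ℤˣ) i : ℤˣ) : ℤ) : ℝ) = -1 := by
      exact_mod_cast h2
    rw [h3]; ring
  have h2 : ∀ i, (ε * Pi.mulSingle j (-1 : ℤˣ) : Fin k → ℤˣ) (r i) = ε (r i) := by
    intro i
    simp [Pi.mulSingle_eq_of_ne (hj i)]
  simp only [Equiv.coe_mulRight]
  rw [h1]
  simp only [h2]
  ring

/-- Multilinear expansion produces a sum over all maps r. The signed sum kills every r that is not a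
permutation, and by symmetry each of the k! permutations contributes 2ᵏ copies of L v. -/
theorem polarization_formula {k : ℕ} (L : E [×k]→L[ℝ] F)
    (hL : ∀ (v : Fin k → E) (σ : Equiv.Perm (Fin k)), L (v ∘ σ) = L v) (v : Fin k → E) :
    ∑ ε : Fin k → ℤˣ, (∏ i, (((ε i : ℤˣ) : ℤ) : ℝ)) •
      L (fun _ => ∑ j, (((ε j : ℤˣ) : ℤ) : ℝ) • v j) =
      (2 ^ k * (k.factorial : ℝ)) • L v := by
  have h1 : ∀ ε : Fin k → ℤˣ, L (fun _ => ∑ j, (((ε j : ℤˣ) : ℤ) : ℝ) • v j) =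
      ∑ r : Fin k → Fin k, (∏ i, (((ε (r i) : ℤˣ) : ℤ) : ℝ)) • L (v ∘ r) := by
    intro ε
    rw [L.map_sum (g := fun _ j => (((ε j : ℤˣ) : ℤ) : ℝ) • v j)]
    refine Finset.sum_congr rfl fun r _ => ?_
    exact L.map_smul_univ (fun i => (((ε (r i) : ℤˣ) : ℤ) : ℝ)) (fun i => v (r i))
  simp only [h1, Finset.smul_sum, smul_smul]
  rw [Finset.sum_comm]
  simp only [← Finset.sum_smul]
  have h2 : ∑ σ : Equiv.Perm (Fin k), (2 ^ k : ℝ) • L v =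
      ∑ r : Fin k → Fin k, (∑ ε : Fin k → ℤˣ, (∏ i, (((ε i : ℤˣ) : ℤ) : ℝ)) *
        ∏ i, (((ε (r i) : ℤˣ) : ℤ) : ℝ)) • L (v ∘ r) := by
    refine Finset.sum_of_injOn (fun σ : Equiv.Perm (Fin k) => (σ : Fin k → Fin k))
      (fun σ _ τ _ h => Equiv.coe_fn_injective h) (fun _ _ => Finset.mem_coe.2 (Finset.mem_univ _))
      (fun r _ hr => ?_) fun σ _ => ?_
    · rw [sum_signs_prod_mul_prod, zero_smul]
      intro hb
      exact hr ⟨Equiv.ofBijective r hb, by simp, rfl⟩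
    · rw [hL v σ]
      congr 1
      have h3 : ∀ ε : Fin k → ℤˣ, (∏ i, (((ε i : ℤˣ) : ℤ) : ℝ)) *
          ∏ i, (((ε (σ i) : ℤˣ) : ℤ) : ℝ) = 1 := by
        intro ε
        rw [Equiv.prod_comp σ (fun i => (((ε i : ℤˣ) : ℤ) : ℝ)), ← Finset.prod_mul_distrib]
        refine Finset.prod_eq_one fun i _ => ?_
        rcases Int.units_eq_one_or (ε i) with h | h <;> rw [h] <;> simp
      rw [Finset.sum_congr rfl fun ε _ => h3 ε]
      simp
  rw [← h2, Finset.sum_const, Finset.card_univ, Fintype.card_perm, Fintype.card_fin, ← Nat.cast_smul_eq_nsmul ℝ,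
    smul_smul, mul_comm]

theorem norm_apply_const_le {k : ℕ} (L : E [×k]→L[ℝ] F) {B : ℝ}
    (hB : ∀ v : E, ‖v‖ ≤ 1 → ‖L (fun _ => v)‖ ≤ B) {w : E} (hw : ‖w‖ ≤ k) :
    ‖L (fun _ => w)‖ ≤ (k : ℝ) ^ k * B := by
  rcases Nat.eq_zero_or_pos k with rfl | hk
  · simpa using (by simpa using hB w (by simp at hw; simp [hw]) : ‖L (fun _ => w)‖ ≤ B)
  · have hk' : (0 : ℝ) < k := by exact_mod_cast hk
    have h1 : w = (k : ℝ) • ((k : ℝ)⁻¹ • w) := by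
      rw [smul_smul, mul_inv_cancel₀ hk'.ne', one_smul]
    have h2 : L (fun _ => w) = ((k : ℝ) ^ k) • L (fun _ => (k : ℝ)⁻¹ • w) := by
      have := L.map_smul_univ (fun _ => (k : ℝ)) (fun _ => (k : ℝ)⁻¹ • w)
      simpa [← h1] using this
    rw [h2, norm_smul, norm_pow, Real.norm_of_nonneg hk'.le]
    refine mul_le_mul_of_nonneg_left (hB _ ?_) (by positivity)
    rw [norm_smul, norm_inv, Real.norm_of_nonneg hk'.le, inv_mul_le_iff₀ hk', mul_one]
    exact hw

/-- A symmetric multilinear map is controlled by its restriction to the diagonal. -/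
theorem norm_le_of_diagonal_le {k : ℕ} (L : E [×k]→L[ℝ] F)
    (hL : ∀ (v : Fin k → E) (σ : Equiv.Perm (Fin k)), L (v ∘ σ) = L v) {B : ℝ}
    (hB : ∀ v : E, ‖v‖ ≤ 1 → ‖L (fun _ => v)‖ ≤ B) : ‖L‖ ≤ 3 ^ k * B := by
  have hB0 : 0 ≤ B := (norm_nonneg _).trans (hB 0 (by simp))
  have hkf : (0 : ℝ) < k.factorial := by exact_mod_cast k.factorial_pos
  have hunit : ∀ v : Fin k → E, (∀ i, ‖v i‖ ≤ 1) → ‖L v‖ ≤ 3 ^ k * B := by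
    intro v hv
    have h1 := congrArg norm (polarization_formula L hL v)
    rw [norm_smul, Real.norm_of_nonneg (by positivity)] at h1
    have h2 : ∀ ε : Fin k → ℤˣ, ‖(∏ i, (((ε i : ℤˣ) : ℤ) : ℝ)) •
        L (fun _ => ∑ j, (((ε j : ℤˣ) : ℤ) : ℝ) • v j)‖ ≤ (k : ℝ) ^ k * B := by
      intro ε
      have hε : ∀ i, ‖(((ε i : ℤˣ) : ℤ) : ℝ)‖ = 1 := by
        intro i; rcases Int.units_eq_one_or (ε i) with h | h <;> rw [h] <;> simp
      rw [norm_smul, norm_prod, Finset.prod_eq_one fun i _ => hε i, one_mul]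
      refine norm_apply_const_le L hB ?_
      refine (norm_sum_le _ _).trans ?_
      calc ∑ j, ‖(((ε j : ℤˣ) : ℤ) : ℝ) • v j‖ ≤ ∑ _j : Fin k, (1 : ℝ) :=
            Finset.sum_le_sum fun j _ => by rw [norm_smul, hε, one_mul]; exact hv j
        _ = k := by simp
    have h3 : 2 ^ k * (k.factorial : ℝ) * ‖L v‖ ≤ 2 ^ k * ((k : ℝ) ^ k * B) := by
      rw [← h1]
      refine (norm_sum_le _ _).trans ((Finset.sum_le_sum fun ε _ => h2 ε).trans (le_of_eq ?_))
      simp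
    refine le_of_mul_le_mul_left ?_ (mul_pos (pow_pos two_pos k) hkf)
    refine h3.trans ?_
    have := pow_self_le_three_pow_mul_factorial k
    calc (2 : ℝ) ^ k * ((k : ℝ) ^ k * B) ≤ 2 ^ k * (3 ^ k * (k.factorial : ℝ) * B) := by gcongr
      _ = _ := by ring
  refine L.opNorm_le_bound (by positivity) fun v => ?_
  by_cases hv : ∃ i, v i = 0
  · obtain ⟨i, hi⟩ := hv
    rw [L.map_coord_zero i hi, norm_zero]
    positivity
  · push Not at hv
    have hpos : ∀ i, 0 < ‖v i‖ := fun i => norm_pos_iff.2 (hv i)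
    have h1 : L v = (∏ i, ‖v i‖) • L (fun i => ‖v i‖⁻¹ • v i) := by
      rw [← L.map_smul_univ]
      congr 1
      funext i
      rw [smul_smul, mul_inv_cancel₀ (hpos i).ne', one_smul]
    rw [h1, norm_smul, norm_prod]
    simp only [norm_norm]
    rw [mul_comm]
    refine mul_le_mul_of_nonneg_right (hunit _ fun i => ?_)
      (Finset.prod_nonneg fun i _ => norm_nonneg _)
    rw [norm_smul, norm_inv, norm_norm, inv_mul_cancel₀ (hpos i).ne']

end Polarization

/-! ### Seminorms, and equality of the classes of M and `regC M` -/

section Growth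

variable {E F G : Type*} [NormedAddCommGroup E] [NormedSpace ℝ E]
  [NormedAddCommGroup F] [NormedSpace ℝ F] [NormedAddCommGroup G] [NormedSpace ℝ G]

theorem finiteSeminorm_iff {M : ℕ → ℝ} (hM : ∀ k, 0 < M k) {K : Set E} {ρ : ℝ} (hρ : 0 < ρ)
    {f : E → F} : FiniteSeminorm M K ρ f ↔
      ∃ C : ℝ, 1 ≤ C ∧ ∀ x ∈ K, ∀ k : ℕ,
        ‖iteratedFDeriv ℝ k f x‖ ≤ C * ((k.factorial : ℝ) * ρ ^ k * M k) := by
  have hpos : ∀ k : ℕ, 0 < (k.factorial : ℝ) * ρ ^ k * M k := fun k =>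
    mul_pos (mul_pos (by exact_mod_cast k.factorial_pos) (pow_pos hρ k)) (hM k)
  constructor
  · rintro ⟨C, hC⟩
    refine ⟨max 1 C, le_max_left _ _, fun x hx k => ?_⟩
    have := hC x hx k
    rw [div_le_iff₀ (hpos k)] at this
    exact this.trans (mul_le_mul_of_nonneg_right (le_max_right _ _) (hpos k).le)
  · rintro ⟨C, -, hC⟩
    exact ⟨C, fun x hx k => (div_le_iff₀ (hpos k)).2 (hC x hx k)⟩

theorem FiniteSeminorm.mono_radius {M : ℕ → ℝ} (hM : ∀ k, 0 < M k) {K : Set E} {ρ ρ' : ℝ}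
    (hρ : 0 < ρ) (hρρ' : ρ ≤ ρ') {f : E → F} (h : FiniteSeminorm M K ρ f) :
    FiniteSeminorm M K ρ' f := by
  rw [finiteSeminorm_iff hM hρ] at h
  rw [finiteSeminorm_iff hM (hρ.trans_le hρρ')]
  obtain ⟨C, hC1, hC⟩ := h
  refine ⟨C, hC1, fun x hx k => (hC x hx k).trans ?_⟩
  have := (hM k).le
  gcongr

theorem FiniteSeminorm.mono_weight {M N : ℕ → ℝ} (hN : ∀ k, 0 < N k) (hNM : ∀ k, N k ≤ M k)
    {K : Set E} {ρ : ℝ} (hρ : 0 < ρ) {f : E → F} (h : FiniteSeminorm N K ρ f) :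
    FiniteSeminorm M K ρ f := by
  rw [finiteSeminorm_iff hN hρ] at h
  rw [finiteSeminorm_iff (fun k => (hN k).trans_le (hNM k)) hρ]
  obtain ⟨C, hC1, hC⟩ := h
  refine ⟨C, hC1, fun x hx k => (hC x hx k).trans ?_⟩
  have := hNM k
  gcongr

theorem GrowthOn.mono_weight {κ : Kind} {M N : ℕ → ℝ} (hN : ∀ k, 0 < N k)
    (hNM : ∀ k, N k ≤ M k) {K : Set E} {f : E → F} (h : GrowthOn κ N K f) :
    GrowthOn κ M K f := by
  cases κ with
  | beurling => exact fun ρ hρ => (h ρ hρ).mono_weight hN hNM hρ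
  | roumieu =>
    obtain ⟨ρ, hρ, h⟩ := h
    exact ⟨ρ, hρ, h.mono_weight hN hNM hρ⟩

/-- The standing growth assumption on the weight sequence: `liminf Mₖ^(1/k) > 0` in the Roumieu
case and `lim Mₖ^(1/k) = ∞` in the Beurling case. -/
def Admissible (κ : Kind) (M : ℕ → ℝ) : Prop :=
  match κ with
  | .beurling => ∀ a : ℝ, 0 < a → ∃ c, GeomBelow M c a
  | .roumieu => ∃ c a, GeomBelow M c a

theorem Admissible.exists_geomBelow {κ : Kind} {M : ℕ → ℝ} (h : Admissible κ M) :
    ∃ c a, GeomBelow M c a := by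
  cases κ with
  | beurling => obtain ⟨c, hc⟩ := h 1 one_pos; exact ⟨c, 1, hc⟩
  | roumieu => exact h

theorem Admissible.pos {κ : Kind} {M : ℕ → ℝ} (h : Admissible κ M) (k : ℕ) : 0 < M k := by
  obtain ⟨c, a, h⟩ := h.exists_geomBelow; exact h.pos k

theorem Admissible.admissible_regC {κ : Kind} {M : ℕ → ℝ} (h : Admissible κ M) :
    Admissible κ (regC M) := by
  cases κ with
  | beurling =>
    intro a ha
    obtain ⟨c, hc⟩ := h (3 * a) (by positivity)
    exact ⟨c / 3, by simpa using hc.geomBelow_regC⟩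
  | roumieu =>
    obtain ⟨c, a, h⟩ := h
    exact ⟨_, _, h.geomBelow_regC⟩

/-- Restricting to the line x + σv and pairing with a norming functional gives the one-variable
situation; polarization from the diagonal costs 3ᵏ, hence 162 = 3 · 54. The minorant does not depend
on f, U or x, so the bound is uniform. -/
theorem exists_minorant_forall_norm_iteratedFDeriv_le {B : ℕ → ℝ} {a δ : ℝ} {i₀ : ℕ} (hδ : 0 < δ)
    (haδ : 1 ≤ a * δ) (hB : ∀ i, 0 < B i) (hBa : ∀ i, i₀ ≤ i → (a * i) ^ i ≤ B i) :
    ∃ k₀ : ℕ, ∀ k, k₀ ≤ k → ∃ s t : ℝ, 0 < s ∧ 0 < t ∧ (∀ i, s * t ^ i ≤ B i) ∧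
      ∀ (f : E → F) (U : Set E) (x : E), IsOpen U → Metric.closedBall x δ ⊆ U →
        (∀ y ∈ U, ContDiffAt ℝ ((⊤ : ℕ∞) : WithTop ℕ∞) f y) →
        (∀ y ∈ Metric.closedBall x δ, ∀ i, ‖iteratedFDeriv ℝ i f y‖ ≤ B i) →
        ‖iteratedFDeriv ℝ k f x‖ ≤ 2 * 162 ^ k * (s * t ^ k) := by
  obtain ⟨k₀, hk₀⟩ := exists_minorant_forall_abs_le hδ haδ hB hBa
  refine ⟨k₀, fun k hk => ?_⟩
  obtain ⟨s, t, hs, ht, hst, H⟩ := hk₀ k hk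
  refine ⟨s, t, hs, ht, hst, fun f U x hU hxU hf hfB => ?_⟩
  have hxx : x ∈ U := hxU (Metric.mem_closedBall_self hδ.le)
  have h162 : 2 * 162 ^ k * (s * t ^ k) = 3 ^ k * (2 * 54 ^ k * (s * t ^ k)) := by
    rw [show (162 : ℝ) = 3 * 54 by norm_num, mul_pow]; ring
  rw [h162]
  refine norm_le_of_diagonal_le _ (iteratedFDeriv_comp_perm_of_smoothOn hU hf k x hxx) fun v hv => ?_
  obtain ⟨ℓ, hℓ, hℓv⟩ := exists_dual_vector'' ℝ (iteratedFDeriv ℝ k f x (fun _ => v))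
  have hmem : ∀ σ : ℝ, |σ| ≤ δ → x + σ • v ∈ Metric.closedBall x δ := by
    intro σ hσ
    rw [Metric.mem_closedBall, dist_eq_norm, add_sub_cancel_left, norm_smul, Real.norm_eq_abs]
    exact (mul_le_mul hσ hv (norm_nonneg _) hδ.le).trans (mul_one δ).le
  have h1 := H (fun i σ => ℓ (iteratedFDeriv ℝ i f (x + σ • v) (fun _ => v))) ?_ ?_
  · simp only [zero_smul, add_zero] at h1
    rw [hℓv] at h1
    simpa using h1
  · intro i σ hσ
    have h2 := hasFDerivAt_iteratedFDeriv_apply (hf _ (hxU (hmem σ hσ))) (fun _ : Fin i => v)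
    have h3 : HasDerivAt (fun σ : ℝ => x + σ • v) v σ := by
      simpa using ((hasDerivAt_id σ).smul_const v).const_add x
    have h4 := ℓ.hasFDerivAt.comp_hasDerivAt σ (h2.comp_hasDerivAt σ h3)
    refine h4.congr_deriv ?_
    congr 1
  · intro i σ hσ
    have h2 : ‖iteratedFDeriv ℝ i f (x + σ • v) (fun _ => v)‖ ≤ B i := by
      refine (ContinuousMultilinearMap.le_opNorm _ _).trans ?_
      refine (mul_le_of_le_one_right (norm_nonneg _) ?_).trans (hfB _ (hmem σ hσ) i)
      exact Finset.prod_le_one (fun _ _ => norm_nonneg _) fun _ _ => hv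
    refine (ℓ.le_opNorm _).trans ?_
    exact (mul_le_of_le_one_left (norm_nonneg _) hℓ).trans h2

/-- Regularization of the weight sequence at the level of seminorms. -/
theorem finiteSeminorm_regC {M : ℕ → ℝ} {c a ρ δ : ℝ} (hM : GeomBelow M c a) (hρ : 0 < ρ)
    (hδ : 0 < δ) (hρa : 6 ≤ ρ * a * δ) {K U : Set E} {f : E → F} (hU : IsOpen U)
    (hKU : Metric.cthickening δ K ⊆ U)
    (hf : ∀ y ∈ U, ContDiffAt ℝ ((⊤ : ℕ∞) : WithTop ℕ∞) f y)
    (h : FiniteSeminorm M (Metric.cthickening δ K) ρ f) :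
    FiniteSeminorm (regC M) K (162 * ρ) f := by
  obtain ⟨C, hC1, hC⟩ := (finiteSeminorm_iff hM.pos hρ).1 h
  rw [finiteSeminorm_iff hM.regC_pos (by positivity)]
  have hC0 : 0 < C := one_pos.trans_le hC1
  have hc := hM.pos_left
  have ha := hM.pos_right
  set B : ℕ → ℝ := fun i => C * ((i.factorial : ℝ) * ρ ^ i * M i) with hBdef
  have hBpos : ∀ i, 0 < B i := fun i =>
    mul_pos hC0 (mul_pos (mul_pos (by exact_mod_cast i.factorial_pos) (pow_pos hρ i)) (hM.pos i))
  obtain ⟨i₀, hi₀⟩ : ∃ i₀ : ℕ, 1 / c < 2 ^ i₀ := pow_unbounded_of_one_lt _ one_lt_two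
  have hBa : ∀ i, i₀ ≤ i → (ρ * a / 6 * i) ^ i ≤ B i := by
    intro i hi
    have h1 : 1 ≤ c * 2 ^ i := by
      rw [div_lt_iff₀ hc] at hi₀
      have : (2 : ℝ) ^ i₀ ≤ 2 ^ i := pow_le_pow_right₀ one_le_two hi
      nlinarith
    have h2 : (i : ℝ) ^ i / 3 ^ i ≤ i.factorial := by
      rw [div_le_iff₀ (by positivity)]
      linarith [pow_self_le_three_pow_mul_factorial i]
    have h3 := hM.le i
    calc (ρ * a / 6 * i) ^ i = 1 * (ρ * a / 6 * i) ^ i := (one_mul _).symm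
      _ ≤ (c * 2 ^ i) * (ρ * a / 6 * i) ^ i := by gcongr
      _ = 1 * ((i : ℝ) ^ i / 3 ^ i * ρ ^ i * (c * a ^ i)) := by
          rw [show (6 : ℝ) = 2 * 3 by norm_num]
          simp only [mul_pow, div_pow]
          field_simp
      _ ≤ C * ((i.factorial : ℝ) * ρ ^ i * M i) := by gcongr
  obtain ⟨k₀, hk₀⟩ := exists_minorant_forall_norm_iteratedFDeriv_le (E := E) (F := F) hδ
    (show 1 ≤ ρ * a / 6 * δ by linarith) hBpos hBa
  have hN := hM.regC_pos
  have hX0 : 0 ≤ ∑ k ∈ Finset.range k₀, M k / regC M k :=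
    Finset.sum_nonneg fun k _ => (div_pos (hM.pos k) (hN k)).le
  -- The interpolation covers only k ≥ k₀; the constant X takes care of the finitely many other
  -- orders.
  set X := ∑ k ∈ Finset.range k₀, M k / regC M k with hX
  refine ⟨C * (2 + X), by nlinarith, fun x hx k => ?_⟩
  have hball : Metric.closedBall x δ ⊆ Metric.cthickening δ K :=
    Metric.closedBall_subset_cthickening hx δ
  have hkf : (0 : ℝ) < k.factorial := by exact_mod_cast k.factorial_pos
  have hNk := hN k
  have hMk := (hM.pos k).le
  rcases lt_or_ge k k₀ with hk | hk
  · have h1 := hC x (hball (Metric.mem_closedBall_self hδ.le)) k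
    have h2 : M k ≤ X * regC M k := by
      rw [← div_le_iff₀ hNk]
      exact Finset.single_le_sum (f := fun k => M k / regC M k)
        (fun k _ => (div_pos (hM.pos k) (hN k)).le) (Finset.mem_range.2 hk)
    calc _ ≤ C * ((k.factorial : ℝ) * ρ ^ k * M k) := h1
      _ ≤ C * ((k.factorial : ℝ) * (162 * ρ) ^ k * (X * regC M k)) := by
          gcongr; linarith
      _ = C * X * ((k.factorial : ℝ) * (162 * ρ) ^ k * regC M k) := by ring
      _ ≤ _ := by gcongr; linarith
  · obtain ⟨s, t, hs, ht, hst, H⟩ := hk₀ k hk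
    have h1 := H f U x hU (hball.trans hKU) hf fun y hy i => hC y (hball hy) i
    -- Dividing out the weight C ρⁱ turns the minorant of B into a minorant of i! Mᵢ.
    have hl : IsGeomMinorant M (s / C) (t / ρ) := by
      refine ⟨by positivity, by positivity, fun i => ?_⟩
      have h2 := hst i
      simp only [hBdef] at h2
      rw [div_pow, div_mul_div_comm, div_le_iff₀ (by positivity)]
      linarith
    have h3 := hl.le_regC hM k
    rw [div_pow, div_mul_div_comm, div_le_iff₀ (by positivity)] at h3
    calc _ ≤ 2 * 162 ^ k * (s * t ^ k) := h1
      _ ≤ 2 * 162 ^ k * (k.factorial * regC M k * (C * ρ ^ k)) := by gcongr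
      _ = C * 2 * ((k.factorial : ℝ) * (162 * ρ) ^ k * regC M k) := by
          rw [mul_pow]; ring
      _ ≤ _ := by gcongr; linarith

/-- The classes defined by `M` and by `regC M` coincide. -/
theorem growthOn_regC [ProperSpace E] {κ : Kind} {M : ℕ → ℝ} (hM : Admissible κ M) {U K : Set E}
    (hU : IsOpen U) {f : E → F} (hf : ∀ y ∈ U, ContDiffAt ℝ ((⊤ : ℕ∞) : WithTop ℕ∞) f y)
    (h : ∀ K : Set E, K ⊆ U → IsCompact K → GrowthOn κ M K f) (hKU : K ⊆ U) (hK : IsCompact K) :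
    GrowthOn κ (regC M) K f := by
  obtain ⟨δ, hδ, hδU⟩ := hK.exists_cthickening_subset_open hU hKU
  have h1 := h _ hδU hK.cthickening
  cases κ with
  | beurling =>
    intro ρ hρ
    -- The condition 6 ≤ ρ a δ is met here by a large a, for a prescribed radius; in the Roumieu
    -- case a is given and the radius is enlarged.
    obtain ⟨c, hc⟩ := hM (6 / (ρ / 162 * δ)) (by positivity)
    have h2 := finiteSeminorm_regC hc (show 0 < ρ / 162 by positivity) hδ
      (by field_simp; exact le_rfl) hU hδU hf (h1 _ (by positivity))
    rwa [mul_div_cancel₀ _ (by norm_num)] at h2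
  | roumieu =>
    obtain ⟨ρ, hρ, h1⟩ := h1
    obtain ⟨c, a, hc⟩ := hM
    have ha := hc.pos_right
    have hρ' : 0 < max ρ (6 / (a * δ)) := lt_max_of_lt_left hρ
    refine ⟨162 * max ρ (6 / (a * δ)), by positivity, ?_⟩
    refine finiteSeminorm_regC hc hρ' hδ ?_ hU hδU hf
      (h1.mono_radius hc.pos hρ (le_max_left _ _))
    have h2 : 6 / (a * δ) ≤ max ρ (6 / (a * δ)) := le_max_right _ _
    rw [div_le_iff₀ (by positivity)] at h2
    linarith

end Growth

/-! ### Faà di Bruno's formula and composition -/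

theorem sum_partSize_orderedFinpartition {n : ℕ} (c : OrderedFinpartition n) :
    ∑ i, c.partSize i = n := by
  have h := Fintype.card_congr c.equivSigma
  simpa using h

/-- `∑ j! α₁! ⋯ αⱼ!` over all partitions of an `n`-element set with block sizes `αᵢ`. -/
theorem sum_factorial_orderedFinpartition_le (n : ℕ) :
    ∑ c : OrderedFinpartition n,
      ((c.length.factorial * ∏ i, (c.partSize i).factorial : ℕ) : ℝ) ≤ 3 ^ n * n.factorial := by
  induction n with
  | zero =>
    rw [Fintype.sum_unique]
    have h : (default : OrderedFinpartition 0).length = 0 :=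
      Nat.le_zero.1 (OrderedFinpartition.length_le _)
    have h' : IsEmpty (Fin (default : OrderedFinpartition 0).length) := by rw [h]; infer_instance
    rw [Finset.univ_eq_empty, Finset.prod_empty, h]
    simp
  | succ n ih =>
    -- A new point either forms a singleton block, multiplying the summand by length + 1, or joins
    -- block k, multiplying it by the size of that block plus 1. These factors sum to at most 3(n +
    -- 1).
    rw [← (OrderedFinpartition.extendEquiv n).sum_comp, Fintype.sum_sigma]
    simp only [Fintype.sum_option]
    have hc : ∀ c : OrderedFinpartition n,
        ((((OrderedFinpartition.extendEquiv n) ⟨c, none⟩).length.factorial *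
          ∏ i, (((OrderedFinpartition.extendEquiv n) ⟨c, none⟩).partSize i).factorial : ℕ) : ℝ) +
        ∑ k : Fin c.length,
          ((((OrderedFinpartition.extendEquiv n) ⟨c, some k⟩).length.factorial *
          ∏ i, (((OrderedFinpartition.extendEquiv n) ⟨c, some k⟩).partSize i).factorial : ℕ) : ℝ)
        ≤ ((c.length.factorial * ∏ i, (c.partSize i).factorial : ℕ) : ℝ) * (3 * (n + 1)) := by
      intro c
      have e1 : (((OrderedFinpartition.extendEquiv n) ⟨c, none⟩).length.factorial *
          ∏ i, (((OrderedFinpartition.extendEquiv n) ⟨c, none⟩).partSize i).factorial) =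
          (c.length.factorial * ∏ i, (c.partSize i).factorial) * (c.length + 1) := by
        change (c.length + 1).factorial * ∏ i : Fin (c.length + 1),
          ((Fin.cons 1 c.partSize : Fin (c.length + 1) → ℕ) i).factorial = _
        rw [Fin.prod_univ_succ, Nat.factorial_succ]
        simp
        ring
      have e2 : ∀ k : Fin c.length,
          (((OrderedFinpartition.extendEquiv n) ⟨c, some k⟩).length.factorial *
          ∏ i, (((OrderedFinpartition.extendEquiv n) ⟨c, some k⟩).partSize i).factorial) =
          (c.length.factorial * ∏ i, (c.partSize i).factorial) * (c.partSize k + 1) := by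
        intro k
        change c.length.factorial * ∏ i : Fin c.length,
          ((Function.update c.partSize k (c.partSize k + 1)) i).factorial = _
        have h1 : ∀ i, ((Function.update c.partSize k (c.partSize k + 1)) i).factorial =
            (c.partSize i).factorial * Function.update (fun _ => 1) k (c.partSize k + 1) i := by
          intro i
          by_cases hi : i = k
          · subst hi; simp [Nat.factorial_succ, mul_comm]
          · simp [hi]
        rw [Finset.prod_congr rfl fun i _ => h1 i, Finset.prod_mul_distrib,
          Finset.prod_update_of_mem (Finset.mem_univ k)]
        simp
        ring
      rw [e1]
      simp only [e2]
      push_cast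
      rw [← Finset.mul_sum, ← mul_add]
      refine mul_le_mul_of_nonneg_left ?_ (by positivity)
      have h2 : (∑ i, (c.partSize i : ℝ)) = n := by
        exact_mod_cast sum_partSize_orderedFinpartition c
      have h3 : (c.length : ℝ) ≤ n := by exact_mod_cast c.length_le
      rw [Finset.sum_add_distrib, h2]
      simp
      linarith
    refine (Finset.sum_le_sum fun c _ => hc c).trans ?_
    rw [← Finset.sum_mul]
    calc _ ≤ 3 ^ n * (n.factorial : ℝ) * (3 * (n + 1)) := by gcongr
      _ = _ := by rw [Nat.factorial_succ]; push_cast; ring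

section Composition

variable {E F G : Type*} [NormedAddCommGroup E] [NormedSpace ℝ E]
  [NormedAddCommGroup F] [NormedSpace ℝ F] [NormedAddCommGroup G] [NormedSpace ℝ G]

theorem norm_iteratedFDeriv_comp_le_sum {f : F → G} {g : E → F} {x : E}
    (hf : ContDiffAt ℝ ((⊤ : ℕ∞) : WithTop ℕ∞) f (g x))
    (hg : ContDiffAt ℝ ((⊤ : ℕ∞) : WithTop ℕ∞) g x) (n : ℕ) :
    ‖iteratedFDeriv ℝ n (f ∘ g) x‖ ≤ ∑ c : OrderedFinpartition n,
      ‖iteratedFDeriv ℝ c.length f (g x)‖ * ∏ i, ‖iteratedFDeriv ℝ (c.partSize i) g x‖ := by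
  rw [iteratedFDeriv_comp hf hg (by exact_mod_cast le_top)]
  refine (norm_sum_le _ _).trans (Finset.sum_le_sum fun c _ => ?_)
  exact c.norm_compAlongOrderedFinpartition_le _ _

/-- In each term of Faà di Bruno's formula the (FdB)-property reduces the weights to Hⁿ Nₙ, and τ ≥
1 lets τⁿ dominate the powers of σB. The remaining factorials sum to at most 3ⁿ n!. -/
theorem norm_iteratedFDeriv_comp_le_of_fdBProperty {N : ℕ → ℝ} (hN : ∀ k, 0 < N k) {H : ℝ}
    (hH : ∀ (j k : ℕ) (α : Fin j → ℕ), (∀ i, 0 < α i) → ∑ i, α i = k →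
      N j * ∏ i, N (α i) ≤ H ^ k * N k) (hH0 : 0 < H)
    {f : F → G} {g : E → F} {x : E}
    (hf : ContDiffAt ℝ ((⊤ : ℕ∞) : WithTop ℕ∞) f (g x))
    (hg : ContDiffAt ℝ ((⊤ : ℕ∞) : WithTop ℕ∞) g x) {A B σ ρ τ : ℝ} (hA : 0 ≤ A) (hB : 0 ≤ B)
    (hσ : 0 < σ) (hρ : 0 < ρ) (hτ : 1 ≤ τ) (hστ : σ * B ≤ τ)
    (hfA : ∀ k : ℕ, ‖iteratedFDeriv ℝ k f (g x)‖ ≤ A * (k.factorial * σ ^ k * N k))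
    (hgB : ∀ k : ℕ, ‖iteratedFDeriv ℝ k g x‖ ≤ B * (k.factorial * ρ ^ k * N k)) (n : ℕ) :
    ‖iteratedFDeriv ℝ n (f ∘ g) x‖ ≤ A * (n.factorial * (3 * τ * ρ * H) ^ n * N n) := by
  refine (norm_iteratedFDeriv_comp_le_sum hf hg n).trans ?_
  have hNn := (hN n).le
  have hterm : ∀ c : OrderedFinpartition n,
      ‖iteratedFDeriv ℝ c.length f (g x)‖ * ∏ i, ‖iteratedFDeriv ℝ (c.partSize i) g x‖ ≤
      ((c.length.factorial * ∏ i, (c.partSize i).factorial : ℕ) : ℝ) *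
        (A * (τ * ρ * H) ^ n * N n) := by
    intro c
    have hsum := sum_partSize_orderedFinpartition c
    have h1 : ∏ i, ‖iteratedFDeriv ℝ (c.partSize i) g x‖ ≤
        B ^ c.length * ((∏ i, ((c.partSize i).factorial : ℝ)) * ρ ^ n * ∏ i, N (c.partSize i)) := by
      calc _ ≤ ∏ i, (B * ((c.partSize i).factorial * ρ ^ (c.partSize i) * N (c.partSize i))) :=
            Finset.prod_le_prod (fun _ _ => norm_nonneg _) fun i _ => hgB _
        _ = _ := by
            simp only [Finset.prod_mul_distrib, Finset.prod_const, Finset.card_univ,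
              Fintype.card_fin, Finset.prod_pow_eq_pow_sum, hsum]
    have h2 := hH c.length n c.partSize c.partSize_pos hsum
    have h3 : (σ * B) ^ c.length ≤ τ ^ n :=
      (pow_le_pow_left₀ (by positivity) hστ _).trans (pow_le_pow_right₀ hτ c.length_le)
    have hp : 0 ≤ ∏ i, N (c.partSize i) := Finset.prod_nonneg fun i _ => (hN _).le
    have hNl := (hN c.length).le
    calc _ ≤ (A * (c.length.factorial * σ ^ c.length * N c.length)) *
          (B ^ c.length *
            ((∏ i, ((c.partSize i).factorial : ℝ)) * ρ ^ n * ∏ i, N (c.partSize i))) := by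
          refine mul_le_mul (hfA _) h1 (Finset.prod_nonneg fun _ _ => norm_nonneg _) (by positivity)
      _ = (c.length.factorial * ∏ i, ((c.partSize i).factorial : ℝ)) *
          (A * (σ * B) ^ c.length * ρ ^ n * (N c.length * ∏ i, N (c.partSize i))) := by
          rw [mul_pow]; ring
      _ ≤ (c.length.factorial * ∏ i, ((c.partSize i).factorial : ℝ)) *
          (A * τ ^ n * ρ ^ n * (H ^ n * N n)) := by gcongr
      _ = _ := by push_cast; rw [mul_pow, mul_pow]; ring
  refine (Finset.sum_le_sum fun c _ => hterm c).trans ?_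
  rw [← Finset.sum_mul]
  calc _ ≤ (3 ^ n * n.factorial) * (A * (τ * ρ * H) ^ n * N n) := by
        gcongr; exact sum_factorial_orderedFinpartition_le n
    _ = _ := by
        rw [show 3 * τ * ρ * H = 3 * (τ * ρ * H) by ring, mul_pow 3]; ring

theorem GrowthOn.comp {κ : Kind} {N : ℕ → ℝ} (hN : ∀ k, 0 < N k) (hF : FdBProperty N)
    {f : F → G} {g : E → F} {K : Set E}
    (hf : ∀ x ∈ K, ContDiffAt ℝ ((⊤ : ℕ∞) : WithTop ℕ∞) f (g x))
    (hg : ∀ x ∈ K, ContDiffAt ℝ ((⊤ : ℕ∞) : WithTop ℕ∞) g x)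
    (hfN : GrowthOn κ N (g '' K) f) (hgN : GrowthOn κ N K g) : GrowthOn κ N K (f ∘ g) := by
  obtain ⟨H, hH0, hH⟩ := hF
  cases κ with
  | beurling =>
    intro r hr
    -- The inner function is estimated first; its constant B then dictates the radius 1/B for the
    -- outer one, so that σB = 1 and the resulting radius is r.
    have hρ : 0 < r / (3 * H) := by positivity
    obtain ⟨B, hB1, hB⟩ := (finiteSeminorm_iff hN hρ).1 (hgN _ hρ)
    have hB0 : 0 < B := one_pos.trans_le hB1
    have hσ : 0 < 1 / B := by positivity
    obtain ⟨A, hA1, hA⟩ := (finiteSeminorm_iff hN hσ).1 (hfN _ hσ)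
    rw [finiteSeminorm_iff hN hr]
    refine ⟨A, hA1, fun x hx n => ?_⟩
    have := norm_iteratedFDeriv_comp_le_of_fdBProperty hN hH hH0 (hf x hx) (hg x hx)
      (zero_le_one.trans hA1) hB0.le hσ hρ le_rfl (by field_simp; exact le_rfl)
      (hA _ (Set.mem_image_of_mem g hx)) (hB x hx) n
    rwa [show 3 * 1 * (r / (3 * H)) * H = r by field_simp] at this
  | roumieu =>
    obtain ⟨ρ, hρ, hgN⟩ := hgN
    obtain ⟨σ, hσ, hfN⟩ := hfN
    obtain ⟨B, hB1, hB⟩ := (finiteSeminorm_iff hN hρ).1 hgN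
    obtain ⟨A, hA1, hA⟩ := (finiteSeminorm_iff hN hσ).1 hfN
    have hτ : (1 : ℝ) ≤ max 1 (σ * B) := le_max_left _ _
    have hpos : 0 < 3 * max 1 (σ * B) * ρ * H := by positivity
    refine ⟨_, hpos, (finiteSeminorm_iff hN hpos).2 ⟨A, hA1, fun x hx n => ?_⟩⟩
    exact norm_iteratedFDeriv_comp_le_of_fdBProperty hN hH hH0 (hf x hx) (hg x hx)
      (zero_le_one.trans hA1) (zero_le_one.trans hB1) hσ hρ hτ (le_max_right _ _)
      (hA _ (Set.mem_image_of_mem g hx)) (hB x hx) n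

end Composition

/-! ### Transfer of growth conditions between functions -/

/-- The isometric identification of the one-dimensional Euclidean space with `ℝ`. -/
noncomputable def euclideanOneEquiv : EuclideanSpace ℝ (Fin 1) ≃ₗᵢ[ℝ] ℝ where
  toLinearEquiv := (PiLp.equivOfUnique 2 ℝ (fun _ : Fin 1 => ℝ)).toLinearEquiv
  norm_map' x := by
    rw [EuclideanSpace.norm_eq]
    simp [Real.sqrt_sq_eq_abs]

section Growth

variable {E F G : Type*} [NormedAddCommGroup E] [NormedSpace ℝ E]
  [NormedAddCommGroup F] [NormedSpace ℝ F] [NormedAddCommGroup G] [NormedSpace ℝ G]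

theorem GrowthOn.of_norm_le {κ : Kind} {M : ℕ → ℝ} (hM : ∀ k, 0 < M k) {K : Set E} {f : E → F}
    {g : E → G} (hgf : ∀ x ∈ K, ∀ k, ‖iteratedFDeriv ℝ k g x‖ ≤ ‖iteratedFDeriv ℝ k f x‖)
    (h : GrowthOn κ M K f) : GrowthOn κ M K g := by
  have key : ∀ ρ : ℝ, 0 < ρ → FiniteSeminorm M K ρ f → FiniteSeminorm M K ρ g := by
    intro ρ hρ hf
    rw [finiteSeminorm_iff hM hρ] at hf ⊢
    obtain ⟨C, hC1, hC⟩ := hf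
    exact ⟨C, hC1, fun x hx k => (hgf x hx k).trans (hC x hx k)⟩
  cases κ with
  | beurling => exact fun ρ hρ => key ρ hρ (h ρ hρ)
  | roumieu =>
    obtain ⟨ρ, hρ, h⟩ := h
    exact ⟨ρ, hρ, key ρ hρ h⟩

/-- Analytic bounds suffice: with q = ρa, a lower bound c aᵏ ≤ Nₖ gives qᵏ ≤ ρᵏ Nₖ / c, and in the
Beurling case a can be matched to every ρ. -/
theorem growthOn_of_norm_iteratedFDeriv_le {κ : Kind} {N : ℕ → ℝ} (hN : Admissible κ N)
    {K : Set E} {f : E → F} {C q : ℝ} (hC : 0 ≤ C) (hq : 0 < q)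
    (h : ∀ x ∈ K, ∀ k : ℕ, ‖iteratedFDeriv ℝ k f x‖ ≤ C * (k.factorial * q ^ k)) :
    GrowthOn κ N K f := by
  have key : ∀ ρ c a : ℝ, 0 < ρ → GeomBelow N c a → q = ρ * a → FiniteSeminorm N K ρ f := by
    intro ρ c a hρ hca hqa
    have hc := hca.pos_left
    have hk : ∀ x ∈ K, ∀ k : ℕ, ‖iteratedFDeriv ℝ k f x‖ ≤
        (C / c) * (k.factorial * ρ ^ k * N k) := by
      intro x hx k
      have hle := hca.le k
      calc _ ≤ C * (k.factorial * q ^ k) := h x hx k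
        _ = (C / c) * (k.factorial * ρ ^ k * (c * a ^ k)) := by
            rw [hqa, mul_pow]; field_simp
        _ ≤ _ := by gcongr
    exact ⟨C / c, fun x hx k => by
      rw [div_le_iff₀ (mul_pos (mul_pos (by exact_mod_cast k.factorial_pos) (pow_pos hρ k))
        (hca.pos k))]
      exact hk x hx k⟩
  cases κ with
  | beurling =>
    intro ρ hρ
    obtain ⟨c, hc⟩ := hN (q / ρ) (by positivity)
    exact key ρ c _ hρ hc (by field_simp)
  | roumieu =>
    obtain ⟨c, a, hca⟩ := hN
    have ha := hca.pos_right
    exact ⟨q / a, by positivity, key _ c a (by positivity) hca (by field_simp)⟩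

theorem GrowthOn.clm_comp {κ : Kind} {M : ℕ → ℝ} (hM : ∀ k, 0 < M k) {K : Set E} {f : E → F}
    (hf : ∀ x ∈ K, ContDiffAt ℝ ((⊤ : ℕ∞) : WithTop ℕ∞) f x) (L : F →L[ℝ] G) (hL : ‖L‖ ≤ 1)
    (h : GrowthOn κ M K f) : GrowthOn κ M K (L ∘ f) := by
  refine h.of_norm_le hM fun x hx k => ?_
  refine (L.norm_iteratedFDeriv_comp_left (hf x hx) (by exact_mod_cast le_top)).trans ?_
  exact mul_le_of_le_one_left (norm_nonneg _) hL

theorem contDiffAt_of_mem_ultraClass {κ : Kind} {M : ℕ → ℝ} {U : Set E} {V : Set F} {f : E → F}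
    (hU : IsOpen U) (hf : f ∈ ultraClass κ M U V) {x : E} (hx : x ∈ U) :
    ContDiffAt ℝ ((⊤ : ℕ∞) : WithTop ℕ∞) f x :=
  hf.2.1.contDiffAt (hU.mem_nhds hx)

theorem mem_ultraClass_of_contDiffAt {κ : Kind} {M : ℕ → ℝ} {U : Set E} {V : Set F} {f : E → F}
    (hUV : Set.MapsTo f U V) (hf : ∀ x ∈ U, ContDiffAt ℝ ((⊤ : ℕ∞) : WithTop ℕ∞) f x)
    (h : ∀ K : Set E, K ⊆ U → IsCompact K → GrowthOn κ M K f) : f ∈ ultraClass κ M U V :=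
  ⟨hUV, fun x hx => (hf x hx).contDiffWithinAt, h⟩

theorem growthOn_regC_of_mem_ultraClass [ProperSpace E] {κ : Kind} {M : ℕ → ℝ}
    (hM : Admissible κ M) {U K : Set E} {V : Set F} (hU : IsOpen U) {f : E → F}
    (hf : f ∈ ultraClass κ M U V) (hKU : K ⊆ U) (hK : IsCompact K) :
    GrowthOn κ (regC M) K f :=
  growthOn_regC hM hU (fun _ hy => contDiffAt_of_mem_ultraClass hU hf hy) hf.2.2 hKU hK

theorem Admissible.growthOn_of_regC {κ : Kind} {M : ℕ → ℝ} (hM : Admissible κ M) {K : Set E}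
    {f : E → F} (h : GrowthOn κ (regC M) K f) : GrowthOn κ M K f := by
  obtain ⟨c, a, hca⟩ := hM.exists_geomBelow
  exact h.mono_weight hca.regC_pos hca.regC_le

theorem clm_comp_mem_ultraClass {κ : Kind} {M : ℕ → ℝ} (hM : ∀ k, 0 < M k) {U : Set E}
    (hU : IsOpen U) {V : Set F} {W : Set G} {f : E → F} (hf : f ∈ ultraClass κ M U V)
    (L : F →L[ℝ] G) (hL : ‖L‖ ≤ 1) (hW : ∀ x ∈ U, L (f x) ∈ W) : L ∘ f ∈ ultraClass κ M U W :=
  mem_ultraClass_of_contDiffAt hW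
    (fun x hx => L.contDiff.contDiffAt.comp x (contDiffAt_of_mem_ultraClass hU hf hx))
    fun K hKU hK => (hf.2.2 K hKU hK).clm_comp hM
      (fun _ hx => contDiffAt_of_mem_ultraClass hU hf (hKU hx)) L hL

end Growth

/-! ### Restrictions of holomorphic functions to the real line -/

section Holomorphic

variable {Ω : Set ℂ} {f : ℂ → ℂ}

theorem contDiffAt_comp_ofReal (hΩ : IsOpen Ω) (hf : DifferentiableOn ℂ f Ω) {y : ℝ}
    (hy : (y : ℂ) ∈ Ω) : ContDiffAt ℝ ((⊤ : ℕ∞) : WithTop ℕ∞) (fun y : ℝ => f (y : ℂ)) y := by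
  have h1 : ContDiffAt ℂ ((⊤ : ℕ∞) : WithTop ℕ∞) f (y : ℂ) :=
    (hf.analyticAt (hΩ.mem_nhds hy)).contDiffAt
  exact (h1.restrict_scalars ℝ).comp y Complex.ofRealCLM.contDiff.contDiffAt

theorem iteratedDeriv_comp_ofReal (hΩ : IsOpen Ω) (hf : DifferentiableOn ℂ f Ω) (k : ℕ) :
    ∀ y : ℝ, (y : ℂ) ∈ Ω →
      iteratedDeriv k (fun y : ℝ => f (y : ℂ)) y = iteratedDeriv k f (y : ℂ) := by
  induction k with
  | zero => intro y _; simp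
  | succ k ih =>
    intro y hy
    have hO : IsOpen {y : ℝ | (y : ℂ) ∈ Ω} := hΩ.preimage Complex.continuous_ofReal
    have h1 : iteratedDeriv k (fun y : ℝ => f (y : ℂ)) =ᶠ[nhds y]
        fun y : ℝ => iteratedDeriv k f (y : ℂ) := by
      filter_upwards [hO.mem_nhds hy] with z hz using ih z hz
    have h2 : DifferentiableAt ℂ (iteratedDeriv k f) (y : ℂ) := by
      rw [iteratedDeriv_eq_iterate]
      exact ((hf.analyticAt (hΩ.mem_nhds hy)).iterated_deriv k).differentiableAt
    rw [iteratedDeriv_succ, iteratedDeriv_succ, h1.deriv_eq]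
    exact h2.hasDerivAt.comp_ofReal.deriv

/-- Cauchy's estimates on complex discs of one radius δ around all points of K give analytic bounds.
-/
theorem growthOn_comp_ofReal {κ : Kind} {N : ℕ → ℝ} (hN : Admissible κ N) (hΩ : IsOpen Ω)
    (hf : DifferentiableOn ℂ f Ω) {K : Set ℝ} (hK : IsCompact K) (hKΩ : ∀ y ∈ K, (y : ℂ) ∈ Ω) :
    GrowthOn κ N K (fun y : ℝ => f (y : ℂ)) := by
  have hK' : IsCompact ((fun y : ℝ => (y : ℂ)) '' K) := hK.image Complex.continuous_ofReal
  obtain ⟨δ, hδ, hδΩ⟩ := hK'.exists_cthickening_subset_open hΩ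
    (by rintro _ ⟨y, hy, rfl⟩; exact hKΩ y hy)
  obtain ⟨C, hC⟩ := hK'.cthickening.exists_bound_of_continuousOn (hf.continuousOn.mono hδΩ)
  refine growthOn_of_norm_iteratedFDeriv_le hN (C := max C 0) (q := 1 / δ) (le_max_right _ _)
    (by positivity) fun y hy k => ?_
  have hball : Metric.closedBall (y : ℂ) δ ⊆ Metric.cthickening δ ((fun y : ℝ => (y : ℂ)) '' K) :=
    Metric.closedBall_subset_cthickening (Set.mem_image_of_mem _ hy) δ
  rw [norm_iteratedFDeriv_eq_norm_iteratedDeriv, iteratedDeriv_comp_ofReal hΩ hf k y (hKΩ y hy)]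
  refine (Complex.norm_iteratedDeriv_le_of_forall_mem_sphere_norm_le k hδ
    (hf.diffContOnCl_ball (hball.trans hδΩ)) fun z hz =>
      (hC z (hball (Metric.sphere_subset_closedBall hz))).trans (le_max_left C 0)).trans
      (le_of_eq ?_)
  rw [one_div, inv_pow]; ring

end Holomorphic

section Real

theorem contDiffAt_inv_real {y : ℝ} (hy : y ≠ 0) :
    ContDiffAt ℝ ((⊤ : ℕ∞) : WithTop ℕ∞) (fun y : ℝ => y⁻¹) y :=
  contDiffAt_inv ℝ hy

theorem differentiableOn_inv_compl_zero :
    DifferentiableOn ℂ (fun z : ℂ => z⁻¹) ({0}ᶜ : Set ℂ) := fun _ hz =>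
  (differentiableAt_inv hz).differentiableWithinAt

theorem reCLM_comp_inv_ofReal {α : Type*} (g : α → ℝ) :
    (Complex.reCLM ∘ fun x => ((g x : ℂ))⁻¹) = fun x => (g x)⁻¹ := by
  funext x
  simp only [Function.comp_apply, Complex.reCLM_apply]
  rw [← Complex.ofReal_inv, Complex.ofReal_re]

theorem growthOn_inv {κ : Kind} {N : ℕ → ℝ} (hN : Admissible κ N) {K : Set ℝ} (hK : IsCompact K)
    (hK0 : ∀ y ∈ K, y ≠ 0) : GrowthOn κ N K (fun y : ℝ => y⁻¹) := by
  have hΩ : IsOpen ({0}ᶜ : Set ℂ) := isOpen_compl_singleton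
  have hmem : ∀ y ∈ K, (y : ℂ) ∈ ({0}ᶜ : Set ℂ) := fun y hy => by simpa using hK0 y hy
  have h1 := growthOn_comp_ofReal hN hΩ differentiableOn_inv_compl_zero hK hmem
  have h2 := h1.clm_comp hN.pos
    (fun y hy => contDiffAt_comp_ofReal hΩ differentiableOn_inv_compl_zero (hmem y hy))
    Complex.reCLM Complex.reCLM_norm.le
  rwa [reCLM_comp_inv_ofReal (fun y => y)] at h2

end Real

/-! ### From the (FdB)-property to the closure properties -/

section Implications

variable {κ : Kind} {M : ℕ → ℝ}

theorem stableUnderComposition_of_fdBProperty (hM : Admissible κ M) (hF : FdBProperty (regC M)) :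
    StableUnderComposition κ M := by
  intro p q r _ _ _ U V W hU hV _ g f hg hf
  refine mem_ultraClass_of_contDiffAt (fun x hx => hf.1 (hg.1 hx)) (fun x hx =>
    (contDiffAt_of_mem_ultraClass hV hf (hg.1 hx)).comp x (contDiffAt_of_mem_ultraClass hU hg hx))
    fun K hKU hK => ?_
  have hgK : g '' K ⊆ V := by rintro _ ⟨x, hx, rfl⟩; exact hg.1 (hKU hx)
  have hcomp : IsCompact (g '' K) := hK.image_of_continuousOn (hg.2.1.continuousOn.mono hKU)
  refine hM.growthOn_of_regC (GrowthOn.comp hM.admissible_regC.pos hF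
    (fun x hx => contDiffAt_of_mem_ultraClass hV hf (hg.1 (hKU hx)))
    (fun x hx => contDiffAt_of_mem_ultraClass hU hg (hKU hx))
    (growthOn_regC_of_mem_ultraClass hM hV hf hgK hcomp)
    (growthOn_regC_of_mem_ultraClass hM hU hg hKU hK))

theorem holomorphicallyClosed_of_fdBProperty (hM : Admissible κ M) (hF : FdBProperty (regC M)) :
    HolomorphicallyClosed κ M := by
  intro n _ U hU g hg Ω f hΩ hgΩ hf
  have hsmooth : ∀ x ∈ U, ContDiffAt ℝ ((⊤ : ℕ∞) : WithTop ℕ∞) (fun y : ℝ => f (y : ℂ)) (g x) :=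
    fun x hx => contDiffAt_comp_ofReal hΩ hf (hgΩ x hx)
  refine mem_ultraClass_of_contDiffAt (Set.mapsTo_univ _ _) (fun x hx =>
    (hsmooth x hx).comp x (contDiffAt_of_mem_ultraClass hU hg hx)) fun K hKU hK => ?_
  have hcomp : IsCompact (g '' K) := hK.image_of_continuousOn (hg.2.1.continuousOn.mono hKU)
  exact hM.growthOn_of_regC (GrowthOn.comp (f := fun y : ℝ => f (y : ℂ))
    hM.admissible_regC.pos hF (fun x hx => hsmooth x (hKU hx))
    (fun x hx => contDiffAt_of_mem_ultraClass hU hg (hKU hx))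
    (growthOn_comp_ofReal hM.admissible_regC hΩ hf hcomp
      (by rintro _ ⟨x, hx, rfl⟩; exact hgΩ x (hKU hx)))
    (growthOn_regC_of_mem_ultraClass hM hU hg hKU hK))

theorem inverseClosed_of_holomorphicallyClosed (hM : ∀ k, 0 < M k)
    (h : HolomorphicallyClosed κ M) : InverseClosed κ M := by
  intro n hn U hU f hf hf0
  have h1 := h n hn U hU f hf ({0}ᶜ) (fun z => z⁻¹) isOpen_compl_singleton
    (fun x hx => by simpa using hf0 x hx) differentiableOn_inv_compl_zero
  have h2 := clm_comp_mem_ultraClass (W := Set.univ) hM hU h1 Complex.reCLM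
    Complex.reCLM_norm.le (fun _ _ => trivial)
  rw [reCLM_comp_inv_ofReal] at h2
  simpa only [one_div] using h2

/-- The outer function is the reciprocal on the punctured line, which belongs to the class by
Cauchy's estimates. `euclideanOneEquiv` is needed because composition is formulated on Euclidean
spaces. -/
theorem inverseClosed_of_stableUnderComposition (hM : Admissible κ M)
    (h : StableUnderComposition κ M) : InverseClosed κ M := by
  intro n hn U hU f hf hf0
  set e := euclideanOneEquiv
  have he : ‖(e.toContinuousLinearEquiv : EuclideanSpace ℝ (Fin 1) →L[ℝ] ℝ)‖ ≤ 1 :=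
    e.toLinearIsometry.norm_toContinuousLinearMap_le
  have he' : ‖(e.symm.toContinuousLinearEquiv : ℝ →L[ℝ] EuclideanSpace ℝ (Fin 1))‖ ≤ 1 :=
    e.symm.toLinearIsometry.norm_toContinuousLinearMap_le
  set V : Set (EuclideanSpace ℝ (Fin 1)) := {y | e y ≠ 0} with hVdef
  have hV : IsOpen V := isOpen_ne.preimage e.continuous
  have h1 : (e.symm.toContinuousLinearEquiv : ℝ →L[ℝ] EuclideanSpace ℝ (Fin 1)) ∘ f ∈
      ultraClass κ M U V :=
    clm_comp_mem_ultraClass hM.pos hU hf _ he' fun x hx => by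
      simpa [hVdef] using hf0 x hx
  have h2 : (fun y : EuclideanSpace ℝ (Fin 1) => (e y)⁻¹) ∈ ultraClass κ M V Set.univ := by
    refine mem_ultraClass_of_contDiffAt (Set.mapsTo_univ _ _) (fun y hy =>
      (contDiffAt_inv_real hy).comp y e.contDiff.contDiffAt) fun K hKV hK => ?_
    have h3 : GrowthOn κ M (e '' K) (fun y : ℝ => y⁻¹) :=
      growthOn_inv hM (hK.image e.continuous) (by rintro _ ⟨y, hy, rfl⟩; exact hKV hy)
    have key : ∀ ρ : ℝ, FiniteSeminorm M (e '' K) ρ (fun y : ℝ => y⁻¹) →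
        FiniteSeminorm M K ρ (fun y : EuclideanSpace ℝ (Fin 1) => (e y)⁻¹) := by
      rintro ρ ⟨C, hC⟩
      refine ⟨C, fun y hy k => ?_⟩
      have h4 := e.norm_iteratedFDeriv_comp_right (fun y : ℝ => y⁻¹) y k
      have h5 : (fun y : ℝ => y⁻¹) ∘ e = fun y : EuclideanSpace ℝ (Fin 1) => (e y)⁻¹ := rfl
      rw [← h5, h4]
      exact hC _ (Set.mem_image_of_mem _ hy) k
    cases κ with
    | beurling => exact fun ρ hρ => key ρ (h3 ρ hρ)
    | roumieu =>
      obtain ⟨ρ, hρ, h3⟩ := h3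
      exact ⟨ρ, hρ, key ρ h3⟩
  have h3 := clm_comp_mem_ultraClass (W := Set.univ) hM.pos hV h2
    (e.symm.toContinuousLinearEquiv : ℝ →L[ℝ] EuclideanSpace ℝ (Fin 1)) he' (fun _ _ => trivial)
  have h4 := h n 1 1 hn one_pos one_pos U V Set.univ hU hV isOpen_univ _ _ h1 h3
  have h5 := clm_comp_mem_ultraClass (W := Set.univ) hM.pos hU h4
    (e.toContinuousLinearEquiv : EuclideanSpace ℝ (Fin 1) →L[ℝ] ℝ) he (fun _ _ => trivial)
  convert h5 using 1
  funext x
  simp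

end Implications

/-! ### Test functions with large derivatives -/

/-- If r were unbounded, the square root of the running maximum m of max(1, r) would be an
admissible θ; then m ≤ Y √m, so m is bounded, a contradiction. -/
theorem le_const_of_forall_le_mul_of_tendsto {r : ℕ → ℝ}
    (h : ∀ θ : ℕ → ℝ, (∀ k, 1 ≤ θ k) → Filter.Tendsto θ Filter.atTop Filter.atTop →
      ∃ X, ∀ k, r k ≤ X * θ k) : ∃ X, ∀ k, r k ≤ X := by
  by_contra! hcon
  set m := partialSups (fun k => max 1 (r k)) with hm
  have hm1 : ∀ k, 1 ≤ m k := fun k => (le_max_left _ _).trans (le_partialSups (fun k => max 1 (r k)) k)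
  have hmt : Filter.Tendsto (fun k => √(m k)) Filter.atTop Filter.atTop := by
    refine Filter.Tendsto.comp Real.tendsto_sqrt_atTop ?_
    refine Filter.tendsto_atTop_atTop_of_monotone m.monotone fun b => ?_
    obtain ⟨k, hk⟩ := hcon b
    exact ⟨k, hk.le.trans ((le_max_right _ _).trans (le_partialSups (fun k => max 1 (r k)) k))⟩
  obtain ⟨X, hX⟩ := h (fun k => √(m k)) (fun k => Real.one_le_sqrt.2 (hm1 k)) hmt
  set Y := max 1 X
  have hY : 1 ≤ Y := le_max_left _ _
  have hmY : ∀ k, m k ≤ Y * √(m k) := by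
    intro k
    have hs : 1 ≤ √(m k) := Real.one_le_sqrt.2 (hm1 k)
    refine partialSups_le _ _ _ fun j hj => max_le (by nlinarith) ?_
    calc r j ≤ X * √(m j) := hX j
      _ ≤ Y * √(m k) := by
          gcongr
          exact le_max_right _ _
  have hb : ∀ k, √(m k) ≤ Y := by
    intro k
    have hs : 0 < √(m k) := Real.sqrt_pos.2 (one_pos.trans_le (hm1 k))
    have := hmY k
    nth_rewrite 1 [← Real.mul_self_sqrt (zero_le_one.trans (hm1 k))] at this
    exact le_of_mul_le_mul_right this hs
  obtain ⟨k, hk⟩ := (hmt.eventually_gt_atTop Y).exists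
  exact absurd (hb k) (not_le.2 hk)

/-- A family is uniformly bounded if it is dominated by every sequence tending to infinity. -/
theorem le_const_of_forall_le_mul_of_tendsto_family {r : ℕ → ℕ → ℝ}
    (h : ∀ θ : ℕ → ℝ, (∀ k, 1 ≤ θ k) → Filter.Tendsto θ Filter.atTop Filter.atTop →
      ∃ X, ∀ k j, r k j ≤ X * θ k) : ∃ X, ∀ k j, r k j ≤ X := by
  -- One particular θ shows that each row is bounded, so its supremum over j is meaningful.
  obtain ⟨X₀, hX₀⟩ := h (fun k => (k : ℝ) + 1) (fun k => by simp)
    (Filter.tendsto_atTop_add_const_right _ _ tendsto_natCast_atTop_atTop)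
  have hbdd : ∀ k, BddAbove (Set.range (r k)) := fun k =>
    ⟨_, by rintro _ ⟨j, rfl⟩; exact hX₀ k j⟩
  obtain ⟨X, hX⟩ := le_const_of_forall_le_mul_of_tendsto (r := fun k => ⨆ j, r k j)
    fun θ h1 hθ => by
      obtain ⟨X, hX⟩ := h θ h1 hθ
      exact ⟨X, fun k => ciSup_le (hX k)⟩
  exact ⟨X, fun k j => (le_ciSup (hbdd k) j).trans (hX k)⟩

section CosSeries

theorem iteratedDeriv_mul_cos (c t : ℝ) (i : ℕ) (x : ℝ) :
    iteratedDeriv i (fun x => c * Real.cos (t * x)) x =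
      c * (t ^ i * iteratedDeriv i Real.cos (t * x)) := by
  rw [iteratedDeriv_const_mul_field, iteratedDeriv_comp_const_mul Real.contDiff_cos]

theorem norm_iteratedFDeriv_mul_cos_le {c t : ℝ} (hc : 0 ≤ c) (ht : 0 ≤ t) (i : ℕ) (x : ℝ) :
    ‖iteratedFDeriv ℝ i (fun x => c * Real.cos (t * x)) x‖ ≤ c * t ^ i := by
  rw [norm_iteratedFDeriv_eq_norm_iteratedDeriv, iteratedDeriv_mul_cos, Real.norm_eq_abs,
    abs_mul, abs_mul, abs_of_nonneg hc, abs_of_nonneg (pow_nonneg ht i)]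
  have := Real.abs_iteratedDeriv_cos_le_one i (t * x)
  have h1 := mul_nonneg hc (pow_nonneg ht i)
  nlinarith

variable {c t : ℕ → ℝ}

/-- A smooth function given by a cosine series, together with its derivatives. -/
theorem cosSeries_props (hc : ∀ k, 0 ≤ c k) (ht : ∀ k, 0 ≤ t k)
    (hs : ∀ i : ℕ, Summable fun k => c k * t k ^ i) :
    ContDiff ℝ ((⊤ : ℕ∞) : WithTop ℕ∞) (fun x => ∑' k, c k * Real.cos (t k * x)) ∧
    (∀ i x, ‖iteratedFDeriv ℝ i (fun x => ∑' k, c k * Real.cos (t k * x)) x‖ ≤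
      ∑' k, c k * t k ^ i) ∧
    ∀ i x, iteratedDeriv i (fun x => ∑' k, c k * Real.cos (t k * x)) x =
      ∑' k, c k * (t k ^ i * iteratedDeriv i Real.cos (t k * x)) := by
  have hsmooth : ∀ k, ContDiff ℝ ((⊤ : ℕ∞) : WithTop ℕ∞) (fun x => c k * Real.cos (t k * x)) :=
    fun k => contDiff_const.mul (Real.contDiff_cos.comp (contDiff_const.mul contDiff_id))
  have hb : ∀ (i k : ℕ) (x : ℝ), (i : ℕ∞) ≤ ⊤ →
      ‖iteratedFDeriv ℝ i (fun x => c k * Real.cos (t k * x)) x‖ ≤ c k * t k ^ i :=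
    fun i k x _ => norm_iteratedFDeriv_mul_cos_le (hc k) (ht k) i x
  have hsum : ∀ i x, iteratedFDeriv ℝ i (fun x => ∑' k, c k * Real.cos (t k * x)) x =
      ∑' k, iteratedFDeriv ℝ i (fun x => c k * Real.cos (t k * x)) x := fun i x =>
    iteratedFDeriv_tsum_apply hsmooth (fun i _ => hs i) hb le_top x
  refine ⟨contDiff_tsum hsmooth (fun i _ => hs i) hb, fun i x => ?_, fun i x => ?_⟩
  · rw [hsum]
    exact tsum_of_norm_bounded (hs i).hasSum fun k => hb i k x le_top
  · have hsm : Summable fun k => iteratedFDeriv ℝ i (fun x => c k * Real.cos (t k * x)) x :=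
      .of_norm_bounded (hs i) fun k => hb i k x le_top
    rw [iteratedDeriv_eq_iteratedFDeriv, hsum, ContinuousMultilinearMap.tsum_eval hsm]
    refine tsum_congr fun k => ?_
    rw [← iteratedDeriv_eq_iteratedFDeriv, iteratedDeriv_mul_cos]

end CosSeries

/-- For every sequence `θ → ∞` the class contains a cosine series whose even derivatives at the
origin are, up to the factors `θₖᵏ`, as large as `k! regC M k`. -/
theorem exists_cosSeries {κ : Kind} {M : ℕ → ℝ} (hM : Admissible κ M) {θ : ℕ → ℝ}
    (hθ1 : ∀ k, 1 ≤ θ k) (hθ : Filter.Tendsto θ Filter.atTop Filter.atTop) :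
    ∃ g : ℝ → ℝ, ContDiff ℝ ((⊤ : ℕ∞) : WithTop ℕ∞) g ∧ GrowthOn κ M Set.univ g ∧
      (∀ x, |g x| ≤ 2 * M 0) ∧ (∀ j, iteratedDeriv (2 * j + 1) g 0 = 0) ∧
      ∀ j, ((2 * j).factorial : ℝ) * regC M (2 * j) ≤
        2 * (2 * θ (2 * j)) ^ (2 * j) * ((-1) ^ j * iteratedDeriv (2 * j) g 0) := by
  obtain ⟨c₀, a₀, hca⟩ := hM.exists_geomBelow
  choose s τ hl hD using hca.exists_isGeomMinorant
  have hθ0 : ∀ k, 0 < θ k := fun k => one_pos.trans_le (hθ1 k)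
  have hs : ∀ k, 0 < s k := fun k => (hl k).pos_left
  have hτ : ∀ k, 0 < τ k := fun k => (hl k).pos_right
  have hA : ∀ i, 0 < (i.factorial : ℝ) * M i := hca.factorial_mul_pos
  -- The k-th term uses the minorant almost optimal at index k; 2⁻ᵏ makes the series summable, and
  -- dividing the frequency by θₖ gives the decay needed in the Beurling case.
  set c : ℕ → ℝ := fun k => (1 / 2) ^ k * s k with hc
  set t : ℕ → ℝ := fun k => τ k / θ k with ht
  have hc0 : ∀ k, 0 < c k := fun k => mul_pos (by positivity) (hs k)
  have ht0 : ∀ k, 0 < t k := fun k => div_pos (hτ k) (hθ0 k)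
  have hterm : ∀ i k, c k * t k ^ i = (1 / 2) ^ k * (s k * τ k ^ i) * (1 / θ k) ^ i := by
    intro i k; simp only [hc, ht, div_pow, one_pow]; ring
  have hterm_le : ∀ i k, c k * t k ^ i ≤
      (1 / 2) ^ k * ((i.factorial : ℝ) * M i) * (1 / θ k) ^ i := by
    intro i k
    rw [hterm]
    have := (hl k).le i
    have := (hθ0 k).le
    gcongr
  have hterm_le' : ∀ i k, c k * t k ^ i ≤ (1 / 2) ^ k * ((i.factorial : ℝ) * M i) := by
    intro i k
    refine (hterm_le i k).trans (mul_le_of_le_one_right (mul_nonneg (by positivity) (hA i).le) ?_)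
    have h1 : 1 / θ k ≤ 1 := (div_le_one (hθ0 k)).2 (hθ1 k)
    exact pow_le_one₀ (one_div_pos.2 (hθ0 k)).le h1
  have hgeom : Summable fun k : ℕ => (1 / 2 : ℝ) ^ k := summable_geometric_two
  have hsum : ∀ i, Summable fun k => c k * t k ^ i := fun i =>
    Summable.of_nonneg_of_le (fun k => (mul_pos (hc0 k) (pow_pos (ht0 k) i)).le)
      (hterm_le' i) (hgeom.mul_right _)
  have htsum_le : ∀ i, ∑' k, c k * t k ^ i ≤ 2 * ((i.factorial : ℝ) * M i) := by
    intro i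
    refine ((hsum i).tsum_le_tsum (hterm_le' i) (hgeom.mul_right _)).trans (le_of_eq ?_)
    rw [tsum_mul_right, tsum_geometric_two]
  obtain ⟨h1, h2, h3⟩ := cosSeries_props (fun k => (hc0 k).le) (fun k => (ht0 k).le) hsum
  refine ⟨_, h1, ?_, fun x => ?_, fun j => ?_, fun j => ?_⟩
  · cases κ with
    | roumieu =>
      refine ⟨1, one_pos, (finiteSeminorm_iff hca.pos one_pos).2 ⟨2, one_le_two, fun x _ i => ?_⟩⟩
      refine (h2 i x).trans ((htsum_le i).trans (le_of_eq ?_))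
      simp
    | beurling =>
      intro ρ hρ
      -- Once θₖ ≥ 1/ρ, the factor θₖ⁻ⁱ supplies ρⁱ. The finitely many other cosines are estimated
      -- individually with constants Yₖ.
      have hY : ∀ k, ∃ Y : ℝ, 0 ≤ Y ∧ (1 / ρ ≤ θ k → Y = 0) ∧ ∀ i : ℕ,
          c k * t k ^ i ≤ ((1 / 2) ^ k + Y) * ((i.factorial : ℝ) * ρ ^ i * M i) := by
        intro k
        by_cases hk : 1 / ρ ≤ θ k
        · refine ⟨0, le_rfl, fun _ => rfl, fun i => ?_⟩
          refine (hterm_le i k).trans ?_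
          have h4 : 1 / θ k ≤ ρ := by
            rw [div_le_iff₀ hρ] at hk
            rw [div_le_iff₀ (hθ0 k)]; linarith
          have hpos := (hθ0 k).le
          have hAi := (hA i).le
          calc (1 / 2) ^ k * ((i.factorial : ℝ) * M i) * (1 / θ k) ^ i
              ≤ (1 / 2) ^ k * ((i.factorial : ℝ) * M i) * ρ ^ i := by gcongr
            _ = _ := by ring
        · refine ⟨c k * (Real.exp (t k / ρ / a₀) / c₀),
            mul_nonneg (hc0 k).le (div_nonneg (Real.exp_pos _).le hca.pos_left.le),
            fun h => absurd h hk, fun i => ?_⟩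
          have h4 := hca.term_le_exp (div_pos (ht0 k) hρ).le i
          rw [div_le_iff₀ (hA i), div_pow, div_le_iff₀ (pow_pos hρ i)] at h4
          have hMi := (hca.pos i).le
          calc c k * t k ^ i ≤ c k *
                (Real.exp (t k / ρ / a₀) / c₀ * ((i.factorial : ℝ) * M i) * ρ ^ i) := by
                have := (hc0 k).le
                gcongr
            _ = (c k * (Real.exp (t k / ρ / a₀) / c₀)) *
                ((i.factorial : ℝ) * ρ ^ i * M i) := by ring
            _ ≤ _ := by
                refine mul_le_mul_of_nonneg_right ?_ (by positivity)
                have : (0 : ℝ) < (1 / 2) ^ k := by positivity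
                linarith
      choose Y hY0 hYz hYle using hY
      have hYs : Summable Y := by
        refine summable_of_hasFiniteSupport ?_
        obtain ⟨n, hn⟩ := Filter.eventually_atTop.1 (hθ.eventually_ge_atTop (1 / ρ))
        refine (Set.finite_lt_nat n).subset fun k hk => ?_
        by_contra hkn
        exact hk (hYz k (hn k (not_lt.1 hkn)))
      have hXs := hgeom.add hYs
      refine ⟨∑' k, ((1 / 2) ^ k + Y k), fun x _ i => ?_⟩
      have hpos : 0 < (i.factorial : ℝ) * ρ ^ i * M i :=
        mul_pos (mul_pos (by exact_mod_cast i.factorial_pos) (pow_pos hρ i)) (hca.pos i)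
      rw [div_le_iff₀ hpos, ← tsum_mul_right]
      exact (h2 i x).trans
        ((hsum i).tsum_le_tsum (fun k => hYle k i) (hXs.mul_right _))
  · have h4 := h2 0 x
    rw [norm_iteratedFDeriv_zero] at h4
    refine h4.trans ((htsum_le 0).trans (le_of_eq ?_))
    simp
  · rw [h3]
    simp
  · rw [h3]
    have h4 : ∀ k, c k * (t k ^ (2 * j) * iteratedDeriv (2 * j) Real.cos (t k * 0)) =
        (-1) ^ j * (c k * t k ^ (2 * j)) := by
      intro k
      simp [Real.iteratedDeriv_even_cos]
      ring
    simp only [h4]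
    rw [tsum_mul_left, ← mul_assoc ((-1 : ℝ) ^ j), ← mul_pow]
    simp only [mul_neg, mul_one, neg_neg, one_pow, one_mul]
    -- At 0 all terms of an even derivative have the same sign, so the single term designed for this
    -- order is a lower bound.
    have h5 : c (2 * j) * t (2 * j) ^ (2 * j) ≤ ∑' k, c k * t k ^ (2 * j) :=
      (hsum (2 * j)).le_tsum _ fun k _ => (mul_pos (hc0 k) (pow_pos (ht0 k) _)).le
    have hpos := hθ0 (2 * j)
    calc _ ≤ 2 * (s (2 * j) * τ (2 * j) ^ (2 * j)) := hD (2 * j)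
      _ = 2 * (2 * θ (2 * j)) ^ (2 * j) * (c (2 * j) * t (2 * j) ^ (2 * j)) := by
          rw [hterm, mul_pow, div_pow, div_pow, one_pow]
          field_simp
      _ ≤ _ := by gcongr

/-! ### From stability properties to conditions on `regC M` -/

section Necessity

variable {κ : Kind} {M : ℕ → ℝ}

theorem comp_euclideanOneEquiv_mem_ultraClass {g : ℝ → ℝ}
    (hg : ContDiff ℝ ((⊤ : ℕ∞) : WithTop ℕ∞) g)
    (hgr : GrowthOn κ M Set.univ g) : g ∘ euclideanOneEquiv ∈ ultraClass κ M Set.univ Set.univ := by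
  refine mem_ultraClass_of_contDiffAt (Set.mapsTo_univ _ _)
    (fun x _ => (hg.comp euclideanOneEquiv.contDiff).contDiffAt) fun K _ _ => ?_
  have key : ∀ ρ : ℝ, FiniteSeminorm M Set.univ ρ g →
      FiniteSeminorm M K ρ (g ∘ euclideanOneEquiv) := by
    rintro ρ ⟨C, hC⟩
    refine ⟨C, fun y _ k => ?_⟩
    rw [euclideanOneEquiv.norm_iteratedFDeriv_comp_right g y k]
    exact hC _ trivial k
  cases κ with
  | beurling => exact fun ρ hρ => key ρ (hgr ρ hρ)
  | roumieu =>
    obtain ⟨ρ, hρ, h3⟩ := hgr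
    exact ⟨ρ, hρ, key ρ h3⟩

theorem exists_bound_iteratedDeriv_zero (hM : Admissible κ M) {g : ℝ → ℝ}
    (h : g ∘ euclideanOneEquiv ∈ ultraClass κ M Set.univ Set.univ) :
    ∃ C ρ : ℝ, 1 ≤ C ∧ 1 ≤ ρ ∧ ∀ k : ℕ,
      |iteratedDeriv k g 0| ≤ C * (k.factorial * ρ ^ k * regC M k) := by
  have hN := hM.admissible_regC.pos
  have h1 := growthOn_regC_of_mem_ultraClass hM isOpen_univ h (Set.subset_univ {0})
    isCompact_singleton
  have h2 : ∃ ρ : ℝ, 0 < ρ ∧ FiniteSeminorm (regC M) {0} ρ (g ∘ euclideanOneEquiv) := by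
    cases κ with
    | beurling => exact ⟨1, one_pos, h1 1 one_pos⟩
    | roumieu => exact h1
  obtain ⟨ρ, hρ, h3⟩ := h2
  have h4 := h3.mono_radius hN hρ (le_max_right 1 ρ)
  obtain ⟨C, hC1, hC⟩ := (finiteSeminorm_iff hN (one_pos.trans_le (le_max_left 1 ρ))).1 h4
  refine ⟨C, max 1 ρ, hC1, le_max_left _ _, fun k => ?_⟩
  have h5 := hC 0 rfl k
  rwa [euclideanOneEquiv.norm_iteratedFDeriv_comp_right g 0 k, map_zero,
    norm_iteratedFDeriv_eq_norm_iteratedDeriv, Real.norm_eq_abs] at h5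

theorem deriv_comp_mem_ultraClass (hder : StableUnderDerivation κ M) {g : ℝ → ℝ}
    (hg : Differentiable ℝ g)
    (h : g ∘ euclideanOneEquiv ∈ ultraClass κ M Set.univ Set.univ) :
    deriv g ∘ euclideanOneEquiv ∈ ultraClass κ M Set.univ Set.univ := by
  convert hder 1 one_pos Set.univ isOpen_univ _ h 0 using 1
  funext x
  have he : HasFDerivAt (euclideanOneEquiv : EuclideanSpace ℝ (Fin 1) → ℝ)
      (euclideanOneEquiv.toContinuousLinearEquiv : EuclideanSpace ℝ (Fin 1) →L[ℝ] ℝ) x :=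
    euclideanOneEquiv.toContinuousLinearEquiv.hasFDerivAt
  have h1 := ((hg (euclideanOneEquiv x)).hasDerivAt.hasFDerivAt.comp x he).fderiv
  rw [h1]
  simp [euclideanOneEquiv]

/-- Stability under derivation enters the equivalence only here. The derivative of the cosine series
belongs to the class, which bounds its derivative of order k − 1 at 0, for even k, by `regC M (k -
1)`. -/
theorem exists_regC_succ_le (hM : Admissible κ M) (hder : StableUnderDerivation κ M) :
    ∃ C : ℝ, 0 < C ∧ ∀ k, regC M (k + 1) ≤ C ^ (k + 1) * regC M k := by
  obtain ⟨c, a, hca⟩ := hM.exists_geomBelow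
  set D : ℕ → ℝ := fun k => (k.factorial : ℝ) * regC M k with hDdef
  have hD : ∀ k, 0 < D k := fun k => mul_pos (by exact_mod_cast k.factorial_pos) (hca.regC_pos k)
  obtain ⟨X, hX⟩ := le_const_of_forall_le_mul_of_tendsto
    (r := fun k => if Even k ∧ 1 ≤ k then (D k / D (k - 1)) ^ (1 / (k : ℝ)) else 0) <| by
    intro θ hθ1 hθ
    obtain ⟨g, hg, hgr, -, -, hge⟩ := exists_cosSeries hM hθ1 hθ
    obtain ⟨C, ρ, hC, hρ, hb⟩ := exists_bound_iteratedDeriv_zero hM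
      (deriv_comp_mem_ultraClass hder (hg.differentiable (by simp))
        (comp_euclideanOneEquiv_mem_ultraClass hg hgr))
    refine ⟨max 1 (2 * C) * (2 * ρ), fun k => ?_⟩
    have hθk := hθ1 k
    split_ifs with hk
    · obtain ⟨⟨j, rfl⟩, hk⟩ := hk
      rw [← two_mul] at *
      have h1 := hge j
      have h2 := hb (2 * j - 1)
      rw [← iteratedDeriv_succ', Nat.sub_add_cancel hk] at h2
      have h3 : (-1) ^ j * iteratedDeriv (2 * j) g 0 ≤ |iteratedDeriv (2 * j) g 0| := by
        refine (le_abs_self _).trans (le_of_eq ?_)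
        rw [abs_mul, abs_pow, abs_neg, abs_one, one_pow, one_mul]
      have hNpos := (hca.regC_pos (2 * j - 1)).le
      have h4 : D (2 * j) ≤ 2 * C * (2 * ρ * θ (2 * j)) ^ (2 * j) * D (2 * j - 1) := by
        calc D (2 * j) ≤ _ := h1
          _ ≤ 2 * (2 * θ (2 * j)) ^ (2 * j) *
              (C * (((2 * j - 1).factorial : ℝ) * ρ ^ (2 * j) * regC M (2 * j - 1))) := by
              refine mul_le_mul_of_nonneg_left ((h3.trans h2).trans ?_) (by positivity)
              gcongr
              exact Nat.sub_le _ _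
          _ = _ := by simp only [hDdef, mul_pow]; ring
      have h5 := le_pow_mul_of_le_mul_pow (hD _).le (by positivity) hk h4
      have h6 := root_le_root_of_le_pow_mul (x := D (2 * j) / D (2 * j - 1)) (y := 1)
        (C := max 1 (2 * C) * (2 * ρ * θ (2 * j))) (div_nonneg (hD _).le (hD _).le) (by positivity)
        zero_le_one hk (by rw [mul_one]; exact (div_le_iff₀ (hD _)).2 h5)
      rw [Real.one_rpow, mul_one] at h6
      exact h6.trans (le_of_eq (by ring))
    · positivity
  set Y := max 1 X
  have hY : 1 ≤ Y := le_max_left _ _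
  have heven : ∀ k, Even (k + 1) → D (k + 1) ≤ Y ^ (k + 1) * D k := by
    intro k hk
    have h1 := hX (k + 1)
    rw [if_pos ⟨hk, by omega⟩, Nat.add_sub_cancel] at h1
    have h0 : 0 ≤ D (k + 1) / D k := div_nonneg (hD _).le (hD _).le
    have h2 := pow_le_pow_left₀ (Real.rpow_nonneg h0 _) (h1.trans (le_max_right 1 X)) (k + 1)
    rw [root_pow_self h0 (by omega), div_le_iff₀ (hD k)] at h2
    exact h2
  have hstep : ∀ k, D (k + 1) ≤ (4 * Y ^ 2) ^ (k + 1) * D k := by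
    intro k
    have hDk := (hD k).le
    rcases Nat.even_or_odd (k + 1) with hk | hk
    · refine (heven k hk).trans ?_
      gcongr
      nlinarith
    -- By almost log-convexity D (k + 1) / D k ≤ 4 D (k + 2) / D (k + 1), and k + 2 is even.
    · have h1 := hca.regC_sq_le k
      have h2 := heven (k + 1) hk.add_one
      have h3 : D (k + 1) * D (k + 1) ≤ 4 * D k * Y ^ (k + 2) * D (k + 1) := by
        calc D (k + 1) * D (k + 1) = D (k + 1) ^ 2 := by ring
          _ ≤ 4 * D k * D (k + 2) := h1
          _ ≤ 4 * D k * (Y ^ (k + 2) * D (k + 1)) := by gcongr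
          _ = _ := by ring
      refine (le_of_mul_le_mul_right h3 (hD (k + 1))).trans ?_
      have h4 : 4 * Y ^ (k + 2) ≤ (4 * Y ^ 2) ^ (k + 1) := by
        rw [mul_pow, ← pow_mul]
        have h5 : (4 : ℝ) ≤ 4 ^ (k + 1) := le_self_pow₀ (by norm_num) (by omega)
        have h6 : Y ^ (k + 2) ≤ Y ^ (2 * (k + 1)) := pow_le_pow_right₀ hY (by omega)
        gcongr
      nlinarith
  refine ⟨4 * Y ^ 2, by positivity, fun k => ?_⟩
  have h1 := hstep k
  have hk : (0 : ℝ) < k.factorial := by exact_mod_cast k.factorial_pos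
  have h2 : (k.factorial : ℝ) ≤ (k + 1).factorial := by
    exact_mod_cast Nat.factorial_le (Nat.le_succ k)
  have h3 : (k.factorial : ℝ) * regC M (k + 1) ≤ D (k + 1) :=
    mul_le_mul_of_nonneg_right h2 (hca.regC_pos _).le
  refine le_of_mul_le_mul_left ((h3.trans h1).trans (le_of_eq ?_)) hk
  simp only [hDdef]; ring

section Reciprocal

/-- Lower bounds for the coefficients of a reciprocal exponential power series. -/
theorem reciprocal_coeff_le {a b : ℕ → ℝ} (ha0 : 0 < a 0) (hb0 : 0 < b 0)
    (hodd : ∀ i, a (2 * i + 1) = 0) (hneg : ∀ i, 1 ≤ i → (-1) ^ i * a (2 * i) ≤ 0)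
    (hconv : ∀ n, 1 ≤ n →
      ∑ i ∈ Finset.range (n + 1), (n.choose i : ℝ) * a i * b (n - i) = 0) (k : ℕ) :
    0 ≤ (-1) ^ k * b (2 * k) ∧ ∀ i, 1 ≤ i → i ≤ k →
      ((2 * k).choose (2 * i) : ℝ) * (-((-1) ^ i * a (2 * i))) *
        ((-1) ^ (k - i) * b (2 * (k - i))) ≤ a 0 * ((-1) ^ k * b (2 * k)) := by
  induction k using Nat.strong_induction_on with
  | _ k ih =>
  rcases Nat.eq_zero_or_pos k with rfl | hk
  · exact ⟨by simpa using hb0.le, fun i hi hi0 => by omega⟩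
  have hsum := hconv (2 * k) (by omega)
  rw [Finset.sum_range_succ'] at hsum
  -- These are the terms of the recursion for the coefficient 2k. Those with odd coefficient index
  -- vanish and the others are nonnegative by induction, so each is at most the sum.
  set u : ℕ → ℝ := fun i =>
    -(-1) ^ k * (((2 * k).choose (i + 1) : ℝ) * a (i + 1) * b (2 * k - (i + 1))) with hu
  have hsum' : a 0 * ((-1) ^ k * b (2 * k)) = ∑ i ∈ Finset.range (2 * k), u i := by
    simp only [hu]
    rw [← Finset.mul_sum, eq_neg_of_add_eq_zero_left hsum]
    simp
    ring
  have hterm : ∀ l, 1 ≤ l → l ≤ k → u (2 * l - 1) =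
      ((2 * k).choose (2 * l) : ℝ) * (-((-1) ^ l * a (2 * l))) *
        ((-1) ^ (k - l) * b (2 * (k - l))) := by
    intro l hl hlk
    simp only [hu]
    rw [Nat.sub_add_cancel (by omega), ← Nat.mul_sub]
    have h1 : (-1 : ℝ) ^ k = (-1) ^ l * (-1) ^ (k - l) := by
      rw [← pow_add, Nat.add_sub_cancel' hlk]
    rw [h1]; ring
  have hterm0 : ∀ l, 1 ≤ l → l ≤ k → 0 ≤ u (2 * l - 1) := by
    intro l hl hlk
    rw [hterm l hl hlk]
    have h1 := (ih (k - l) (by omega)).1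
    have h2 := hneg l hl
    exact mul_nonneg (mul_nonneg (by positivity) (by linarith)) h1
  have hu0 : ∀ i ∈ Finset.range (2 * k), 0 ≤ u i := by
    intro i hi
    rw [Finset.mem_range] at hi
    rcases Nat.even_or_odd' i with ⟨l, rfl | rfl⟩
    · simp [hu, hodd]
    · exact hterm0 (l + 1) (by omega) (by omega)
  have hpos : 0 ≤ (-1) ^ k * b (2 * k) := by
    have h1 := Finset.sum_nonneg hu0
    rw [← hsum'] at h1
    exact nonneg_of_mul_nonneg_right h1 ha0
  refine ⟨hpos, fun i hi hik => ?_⟩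
  rw [hsum', ← hterm i hi hik]
  exact Finset.single_le_sum hu0 (Finset.mem_range.2 (by omega))

/-- Iterating the single-term bound with i fixed: up to signs, b_{2ji}/(2ji)! is at least b₀ times
the j-th power of −a_{2i}/(a₀ (2i)!), as in a geometric series. -/
theorem reciprocal_coeff_pow_le {a b : ℕ → ℝ} (ha0 : 0 < a 0) (hb0 : 0 < b 0)
    (hodd : ∀ i, a (2 * i + 1) = 0) (hneg : ∀ i, 1 ≤ i → (-1) ^ i * a (2 * i) ≤ 0)
    (hconv : ∀ n, 1 ≤ n →
      ∑ i ∈ Finset.range (n + 1), (n.choose i : ℝ) * a i * b (n - i) = 0)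
    {i : ℕ} (hi : 1 ≤ i) (j : ℕ) :
    ((2 * (j * i)).factorial : ℝ) * (-((-1) ^ i * a (2 * i))) ^ j * b 0 ≤
      (-1) ^ (j * i) * b (2 * (j * i)) * (a 0 * (2 * i).factorial) ^ j := by
  induction j with
  | zero => simp
  | succ j ih =>
    have h1 := (reciprocal_coeff_le ha0 hb0 hodd hneg hconv ((j + 1) * i)).2 i hi
      (Nat.le_mul_of_pos_left i (Nat.succ_pos j))
    have hji : (j + 1) * i - i = j * i := by rw [Nat.succ_mul, Nat.add_sub_cancel]
    rw [hji] at h1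
    have h2 := Nat.choose_mul_factorial_mul_factorial
      (show 2 * i ≤ 2 * ((j + 1) * i) by nlinarith)
    rw [← Nat.mul_sub, hji] at h2
    have h3 : ((2 * ((j + 1) * i)).factorial : ℝ) = (2 * ((j + 1) * i)).choose (2 * i) *
        (2 * i).factorial * (2 * (j * i)).factorial := by exact_mod_cast h2.symm
    have h4 : 0 ≤ -((-1) ^ i * a (2 * i)) := neg_nonneg.2 (hneg i hi)
    rw [h3]
    set α := -((-1) ^ i * a (2 * i))
    set B := (-1) ^ (j * i) * b (2 * (j * i))
    set c := ((2 * ((j + 1) * i)).choose (2 * i) : ℝ)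
    have hc : 0 ≤ c := Nat.cast_nonneg _
    calc _ = c * (2 * i).factorial * α * ((2 * (j * i)).factorial * α ^ j * b 0) := by ring
      _ ≤ c * (2 * i).factorial * α * (B * (a 0 * (2 * i).factorial) ^ j) := by gcongr
      _ = c * α * B * ((2 * i).factorial * (a 0 * (2 * i).factorial) ^ j) := by ring
      _ ≤ a 0 * ((-1) ^ ((j + 1) * i) * b (2 * ((j + 1) * i))) *
          ((2 * i).factorial * (a 0 * (2 * i).factorial) ^ j) := by gcongr
      _ = _ := by ring

theorem sum_choose_mul_iteratedDeriv_inv_eq_zero {f : ℝ → ℝ}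
    (hf : ContDiff ℝ ((⊤ : ℕ∞) : WithTop ℕ∞) f) (hf0 : ∀ x, f x ≠ 0) {n : ℕ} (hn : 1 ≤ n) :
    ∑ i ∈ Finset.range (n + 1),
      (n.choose i : ℝ) * iteratedDeriv i f 0 * iteratedDeriv (n - i) (fun x => 1 / f x) 0 = 0 := by
  have hu : ContDiff ℝ ((⊤ : ℕ∞) : WithTop ℕ∞) (fun x => 1 / f x) := contDiff_const.div hf hf0
  rw [← iteratedDeriv_fun_mul (hf.contDiffAt.of_le (by exact_mod_cast le_top))
    (hu.contDiffAt.of_le (by exact_mod_cast le_top))]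
  have h1 : (fun x => f x * (1 / f x)) = fun _ => (1 : ℝ) := by
    funext x; exact mul_one_div_cancel (hf0 x)
  rw [h1, iteratedDeriv_const, if_neg (by omega)]

end Reciprocal

theorem GrowthOn.const_sub (hM : ∀ k, 0 < M k) {g : ℝ → ℝ} {K : Set ℝ} (c : ℝ)
    (h : GrowthOn κ M K g) : GrowthOn κ M K (fun x => c - g x) := by
  have key : ∀ ρ : ℝ, FiniteSeminorm M K ρ g → FiniteSeminorm M K ρ (fun x => c - g x) := by
    rintro ρ ⟨C, hC⟩
    refine ⟨|c| / M 0 + C, fun x hx k => ?_⟩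
    have h1 := hC x hx k
    have h0 : 0 ≤ |c| / M 0 := div_nonneg (abs_nonneg c) (hM 0).le
    rcases Nat.eq_zero_or_pos k with rfl | hk
    · simp only [norm_iteratedFDeriv_zero, Nat.factorial_zero, Nat.cast_one, pow_zero, mul_one,
        one_mul, Real.norm_eq_abs] at h1 ⊢
      have h2 := div_le_div_of_nonneg_right (abs_sub c (g x)) (hM 0).le
      rw [add_div] at h2
      linarith
    · rw [norm_iteratedFDeriv_eq_norm_iteratedDeriv] at h1 ⊢
      rw [iteratedDeriv_const_sub hk, iteratedDeriv_neg, norm_neg]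
      linarith
  cases κ with
  | beurling => exact fun ρ hρ => key ρ (h ρ hρ)
  | roumieu =>
    obtain ⟨ρ, hρ, h⟩ := h
    exact ⟨ρ, hρ, key ρ h⟩

/-- The test function is f = 2M₀ + 1 − g, positive because |g| ≤ 2M₀. The coefficient of order mj of
1/f dominates the j-th power of that of order m of g, and the class bound for 1/f turns this into
N_mʲ ≤ Cᵐʲ N_{mj}. -/
theorem rootAlmostIncreasing_of_inverseClosed (hM : Admissible κ M) (h : InverseClosed κ M) :
    RootAlmostIncreasing (regC M) := by
  obtain ⟨c, a, hca⟩ := hM.exists_geomBelow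
  have hN := hca.regC_pos
  set N := regC M with hNdef
  obtain ⟨X, hX⟩ := le_const_of_forall_le_mul_of_tendsto_family
    -- The shift j + 1 lets j range over all of ℕ while the multiple stays positive. Odd m carry no
    -- information here, since g has only even derivatives at 0, and get the value 0.
    (r := fun m j => if Even m ∧ 1 ≤ m then
      N m ^ (1 / (m : ℝ)) / N (m * (j + 1)) ^ (1 / ((m * (j + 1) : ℕ) : ℝ)) else 0) <| by
    intro θ hθ1 hθ
    obtain ⟨g, hg, hgr, hgb, hgo, hge⟩ := exists_cosSeries hM hθ1 hθ
    have hθ0 : ∀ k, 0 < θ k := fun k => one_pos.trans_le (hθ1 k)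
    set f : ℝ → ℝ := fun x => (2 * M 0 + 1) - g x with hf
    have hfs : ContDiff ℝ ((⊤ : ℕ∞) : WithTop ℕ∞) f := contDiff_const.sub hg
    have hfpos : ∀ x, 0 < f x := fun x => by
      have := (le_abs_self _).trans (hgb x)
      simp only [hf]; linarith
    have hfd : ∀ k, 1 ≤ k → iteratedDeriv k f 0 = -iteratedDeriv k g 0 := by
      intro k hk
      rw [hf, iteratedDeriv_const_sub hk, iteratedDeriv_neg]
    have hfgr : f ∘ euclideanOneEquiv ∈ ultraClass κ M Set.univ Set.univ :=
      comp_euclideanOneEquiv_mem_ultraClass hfs (hgr.const_sub hM.pos _)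
    have hinv : (fun x => 1 / f x) ∘ euclideanOneEquiv ∈ ultraClass κ M Set.univ Set.univ :=
      h 1 one_pos Set.univ isOpen_univ _ hfgr fun x _ => (hfpos _).ne'
    obtain ⟨C, ρ, hC, hρ, hb⟩ := exists_bound_iteratedDeriv_zero hM hinv
    set A := iteratedDeriv 0 f 0 with hA
    set B := iteratedDeriv 0 (fun x => 1 / f x) 0 with hB
    have hA0 : 0 < A := by simpa [hA] using hfpos 0
    have hB0 : 0 < B := by simpa [hB] using hfpos 0
    refine ⟨max 1 (C / B) * (max 1 (2 * A) * (2 * ρ)), fun m j => ?_⟩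
    have hθm := hθ0 m
    split_ifs with hm
    · obtain ⟨⟨i, rfl⟩, hi⟩ := hm
      rw [← two_mul] at *
      have hgnn : ∀ i, 0 ≤ (-1) ^ i * iteratedDeriv (2 * i) g 0 := by
        intro i
        have h1 : 0 < ((2 * i).factorial : ℝ) * N (2 * i) :=
          mul_pos (by exact_mod_cast (2 * i).factorial_pos) (hN _)
        have h2 := h1.trans_le (hge i)
        have h3 : 0 < 2 * (2 * θ (2 * i)) ^ (2 * i) := by
          have := hθ0 (2 * i); positivity
        exact (pos_of_mul_pos_right h2 h3.le).le
      have hpow := reciprocal_coeff_pow_le (a := fun k => iteratedDeriv k f 0)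
        (b := fun k => iteratedDeriv k (fun x => 1 / f x) 0) hA0 hB0
        (fun i => by rw [hfd _ (by omega), hgo, neg_zero])
        (fun i hi => by rw [hfd _ (by omega), mul_neg]; exact neg_nonpos.2 (hgnn i))
        (fun n hn => sum_choose_mul_iteratedDeriv_inv_eq_zero hfs (fun x => (hfpos x).ne') hn)
        (show 1 ≤ i by omega) (j + 1)
      have hidx : 2 * ((j + 1) * i) = 2 * i * (j + 1) := by ring
      rw [hfd _ hi, mul_neg, neg_neg, ← hA, ← hB, hidx] at hpow
      set n := 2 * i * (j + 1) with hn
      set G := (-1) ^ i * iteratedDeriv (2 * i) g 0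
      have hgi : ((2 * i).factorial : ℝ) * N (2 * i) ≤ 2 * (2 * θ (2 * i)) ^ (2 * i) * G := hge i
      have hn1 : 1 ≤ n := Nat.mul_pos hi (Nat.succ_pos j)
      have hbn : (-1) ^ ((j + 1) * i) * iteratedDeriv n (fun x => 1 / f x) 0 ≤
          C * (n.factorial * ρ ^ n * N n) := by
        refine (le_abs_self _).trans ((le_of_eq ?_).trans (hb n))
        rw [abs_mul, abs_pow, abs_neg, abs_one, one_pow, one_mul]
      have hNn := (hN n).le
      have hNi := (hN (2 * i)).le
      have hfi : (0 : ℝ) < (2 * i).factorial := by exact_mod_cast (2 * i).factorial_pos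
      have hfn : (0 : ℝ) < n.factorial := by exact_mod_cast n.factorial_pos
      have hmain : N (2 * i) ^ (j + 1) ≤
          C / B * (max 1 (2 * A) * (2 * θ (2 * i)) * ρ) ^ n * N n := by
        have h1 : ((2 * i).factorial * N (2 * i)) ^ (j + 1) * (n.factorial * B) ≤
            (2 * (2 * θ (2 * i)) ^ (2 * i)) ^ (j + 1) *
              (C * (n.factorial * ρ ^ n * N n) * (A * (2 * i).factorial) ^ (j + 1)) := by
          calc _ ≤ (2 * (2 * θ (2 * i)) ^ (2 * i) * G) ^ (j + 1) * (n.factorial * B) := by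
                gcongr
            _ = (2 * (2 * θ (2 * i)) ^ (2 * i)) ^ (j + 1) *
                (n.factorial * G ^ (j + 1) * B) := by rw [mul_pow _ G]; ring
            _ ≤ _ := mul_le_mul_of_nonneg_left
                (hpow.trans (mul_le_mul_of_nonneg_right hbn (by positivity))) (by positivity)
        have h2 : (2 * A) ^ (j + 1) ≤ max 1 (2 * A) ^ n := by
          refine (pow_le_pow_left₀ (by positivity) (le_max_right 1 _) _).trans ?_
          exact pow_le_pow_right₀ (le_max_left _ _) (Nat.le_mul_of_pos_left _ hi)
        have h3 : N (2 * i) ^ (j + 1) ≤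
            C / B * (2 * A) ^ (j + 1) * ((2 * θ (2 * i)) ^ n * ρ ^ n) * N n := by
          have hQ : ((2 * θ (2 * i)) ^ (2 * i)) ^ (j + 1) = (2 * θ (2 * i)) ^ n :=
            (pow_mul _ _ _).symm
          have h4 : 0 < ((2 * i).factorial : ℝ) ^ (j + 1) * (n.factorial * B) := by positivity
          refine le_of_mul_le_mul_right ?_ h4
          calc _ = ((2 * i).factorial * N (2 * i)) ^ (j + 1) * (n.factorial * B) := by ring
            _ ≤ _ := h1
            _ = _ := by
              rw [mul_pow 2 ((2 * θ (2 * i)) ^ (2 * i)), hQ, mul_pow A, mul_pow 2 A]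
              field_simp
        refine h3.trans ?_
        calc _ ≤ C / B * max 1 (2 * A) ^ n * ((2 * θ (2 * i)) ^ n * ρ ^ n) * N n := by gcongr
          _ = _ := by simp only [mul_pow]; ring
      have h5 := le_pow_mul_of_le_mul_pow hNn (by positivity) hn1 hmain
      rw [div_le_iff₀ (Real.rpow_pos_of_pos (hN n) _)]
      set Z := max 1 (C / B) * (max 1 (2 * A) * (2 * θ (2 * i)) * ρ) with hZ
      have hZ0 : 0 < Z := by positivity
      have h6 : N (2 * i) ^ (1 / ((2 * i : ℕ) : ℝ)) ≤ Z * N n ^ (1 / (n : ℝ)) := by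
        rw [root_le_mul_root_iff (hN _) (hN _) hZ0 hi hn1, hn, mul_comm (2 * i) (j + 1), pow_mul,
          mul_comm (2 * i) ((j + 1) * (2 * i)), pow_mul Z, ← mul_pow, mul_comm (j + 1) (2 * i),
          ← hn]
        gcongr
      refine h6.trans (le_of_eq ?_)
      rw [hZ]; ring
    · positivity
  set Y := max 1 X
  have hY : 0 < Y := one_pos.trans_le (le_max_left _ _)
  refine hca.rootAlmostIncreasing_of_even hY fun m j hm hj he => ?_
  have h1 := hX m (j - 1)
  rw [if_pos ⟨he, hm⟩, Nat.sub_add_cancel hj, div_le_iff₀ (Real.rpow_pos_of_pos (hN _) _)] at h1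
  exact h1.trans (mul_le_mul_of_nonneg_right (le_max_right _ _) (Real.rpow_nonneg (hN _).le _))

end Necessity

/-! ### Growth hypotheses and the equivalence -/

section Equivalence

variable {κ : Kind} {M : ℕ → ℝ}

/-- A geometric lower bound for all large indices extends to all indices. -/
theorem exists_geomBelow_of_eventually (hM : ∀ k, 0 < M k) {a : ℝ} (ha : 0 < a)
    (h : ∀ᶠ k : ℕ in Filter.atTop, a < M k ^ (1 / (k : ℝ))) : ∃ c, GeomBelow M c a := by
  obtain ⟨n, hn⟩ := Filter.eventually_atTop.1 (h.and (Filter.eventually_ge_atTop 1))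
  have hpos : ∀ k, 0 < M k / a ^ k := fun k => div_pos (hM k) (pow_pos ha k)
  obtain ⟨c, hc, hcle⟩ : ∃ c : ℝ, 0 < c ∧ ∀ k ∈ Finset.range (n + 1), c ≤ M k / a ^ k := by
    obtain ⟨k, -, hk⟩ := (Finset.range (n + 1)).exists_min_image (fun k => M k / a ^ k)
      ⟨0, by simp⟩
    exact ⟨_, hpos k, hk⟩
  refine ⟨min 1 c, lt_min one_pos hc, ha, fun k => ?_⟩
  rcases lt_or_ge k n with hk | hk
  · have h1 := (min_le_right 1 c).trans (hcle k (Finset.mem_range.2 (by omega)))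
    exact (le_div_iff₀ (pow_pos ha k)).1 h1
  · obtain ⟨h1, h2⟩ := hn k hk
    have h3 := pow_le_pow_left₀ ha.le h1.le k
    rw [root_pow_self (hM k).le h2] at h3
    exact (mul_le_of_le_one_left (pow_pos ha k).le (min_le_left _ _)).trans h3

theorem admissible_roumieu_of_liminf_pos (hM : ∀ k, 0 < M k)
    (h : 0 < Filter.liminf (fun k : ℕ => ((M k ^ (1 / (k : ℝ)) : ℝ) : EReal)) Filter.atTop) :
    Admissible .roumieu M := by
  obtain ⟨a, ha0, ha⟩ := EReal.lt_iff_exists_real_btwn.1 h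
  have h1 := Filter.eventually_lt_of_lt_liminf ha
  obtain ⟨c, hc⟩ := exists_geomBelow_of_eventually hM (a := a) (by exact_mod_cast ha0)
    (h1.mono fun k hk => by exact_mod_cast hk)
  exact ⟨c, a, hc⟩

theorem admissible_of_tendsto_atTop (hM : ∀ k, 0 < M k)
    (h : Filter.Tendsto (fun k : ℕ => M k ^ (1 / (k : ℝ))) Filter.atTop Filter.atTop) :
    Admissible κ M := by
  have h1 : ∀ a : ℝ, 0 < a → ∃ c, GeomBelow M c a := fun a ha =>
    exists_geomBelow_of_eventually hM ha (h.eventually_gt_atTop a)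
  cases κ with
  | beurling => exact h1
  | roumieu =>
    obtain ⟨c, hc⟩ := h1 1 one_pos
    exact ⟨c, 1, hc⟩

theorem conditionsEquivalent_of_admissible (hM : Admissible κ M)
    (hder : StableUnderDerivation κ M) : ConditionsEquivalent κ M := by
  obtain ⟨c, a, hca⟩ := hM.exists_geomBelow
  obtain ⟨C, hC⟩ := hca.exists_geomEquiv
  unfold ConditionsEquivalent
  tfae_have 4 → 6 := fun h => by
    obtain ⟨X, hX, hs⟩ := exists_regC_succ_le hM hder
    exact fdBProperty_of_rootAlmostIncreasing hca.regC_pos h hX hs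
  tfae_have 6 → 4 := hca.rootAlmostIncreasing_of_fdBProperty
  tfae_have 4 → 5 := hC.rootAlmostIncreasing
  tfae_have 5 → 4 := hC.symm.rootAlmostIncreasing
  tfae_have 6 → 7 := hC.fdBProperty
  tfae_have 7 → 6 := hC.symm.fdBProperty
  tfae_have 6 → 1 := stableUnderComposition_of_fdBProperty hM
  tfae_have 6 → 2 := holomorphicallyClosed_of_fdBProperty hM
  tfae_have 1 → 3 := inverseClosed_of_stableUnderComposition hM
  tfae_have 2 → 3 := inverseClosed_of_holomorphicallyClosed hM.pos
  tfae_have 3 → 4 := rootAlmostIncreasing_of_inverseClosed hM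
  tfae_finish

end Equivalence

end UltraDiff

theorem theorem3p2 (M : ℕ → ℝ) (hM : ∀ k, 0 < M k) (κ : UltraDiff.Kind)
    (hder : UltraDiff.StableUnderDerivation κ M) :
    (κ = UltraDiff.Kind.roumieu →
      0 < Filter.liminf (fun k : ℕ => ((M k ^ (1 / (k : ℝ)) : ℝ) : EReal)) Filter.atTop →
      UltraDiff.ConditionsEquivalent κ M) ∧
    (Filter.Tendsto (fun k : ℕ => M k ^ (1 / (k : ℝ))) Filter.atTop Filter.atTop →
      UltraDiff.ConditionsEquivalent κ M) := by
  refine ⟨fun hκ h => ?_, fun h => ?_⟩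
  · subst hκ
    exact UltraDiff.conditionsEquivalent_of_admissible
      (UltraDiff.admissible_roumieu_of_liminf_pos hM h) hder
  · exact UltraDiff.conditionsEquivalent_of_admissible
      (UltraDiff.admissible_of_tendsto_atTop hM h) hder
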